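/- Let $d\ge 2$ be an integer, $1/2<\alpha<(d+1)/2$, $1<p<d/(2\alpha-1)$ and $1/q=1/p-(2\alpha-1)/d$. All function spaces are over $\mathbb R^d$, all vector fields $u=(u^j)$ and $2$-tensor fields $\mathbf F=[F^{jk}]$ are real-valued, $\hat\varphi(\xi)=\int_{\mathbb R^d} e^{-2\pi i x\cdot\xi}\varphi(x)\,dx$, and $\Lambda^s\varphi=\big((2\pi|\cdot|)^s\hat\varphi\big)^\vee$. Consider the fractional Stokes system $$\Lambda^{2\alpha}u+\nabla p_*=\operatorname{div}\mathbf F,\qquad \operatorname{div}u=0\qquad\text{in }\mathbb R^d,\qquad (\operatorname{div}\mathbf F)^j=\sum_{k=1}^d D_kF^{jk}.$$ A field $u\in L^1+L^\infty$ is a very weak solution for $\mathbf F \in L^p$ if $$\int_{\mathbb R^d}u\cdot(\Lambda^{2\alpha}\Phi+\nabla\psi)\,dx=-\int_{\mathbb R^d}\sum_{j,k=1}^d F^{jk}D_k\Phi^j\,dx$$ for all divergence-free vector fields $\Phi\in C_c^\infty$ and all functions $\psi\in C_c^\infty$. Let $\mathbf U_\alpha=[U_{\alpha,j}^{kl}]$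 be the kernel $$U_{\alpha,j}^{kl}(x)=\frac{\Gamma(1+d/2-\alpha)}{2^{2\alpha}\pi^{d/2}\,\Gamma(1+\alpha)}\left[D_l\!\left(\frac{x_jx_k}{|x|^{d+2-2\alpha}}\right)-\frac{\delta_{jk}(2\alpha-1)x_l}{|x|^{d+2-2\alpha}}\right].$$ Let $\mathscr S_0$ be the space of Schwartz functions $\varphi$ such that all derivatives of $\hat\varphi$ vanish at $0$, with dual $\mathscr S_0'$. For $s\in\mathbb R$, $\Lambda^s$ acts on $\mathscr S_0'$ by $\langle\Lambda^sf,\varphi\rangle=\langle f,\Lambda^s\varphi\rangle$, and $\dot H^s=\{f\in\mathscr S_0':\Lambda^sf\in L^2\}$ with norm $\|\Lambda^s f\|_{2}$. **Theorem.** There is a constant $C>0$ depending only on $d,\alpha,p$ such that for every $\mathbf F\in L^p$ the following hold. 1. There is exactly one very weak solution $u\in L^q$ of the system. 2. It is given by $u=\mathbf U_\alpha*\mathbf F$, that is, for a.e. $x$, all the integrals defining the convolutions $(U_{\alpha,j}^{kl}*F^{kl})(x)$ converge absolutely and $u^j(x)=\sum_{k,l=1}^d(U_{\alpha,j}^{kl}*F^{kl})(x)$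 for $j=1,\dots,d$. 3. $\|u\|_{L^q}\le C\|\mathbf F\|_{L^p}$. 4. If in addition $\mathbf F\in\dot H^{1-\alpha}$, then $u\in\dot H^\alpha$ and $$\int_{\mathbb R^d}|\Lambda^\alpha u|^2\,dx=\langle\operatorname{div}\mathbf F,u\rangle,$$ where $\langle\operatorname{div}\mathbf F,\cdot\rangle$ is the extension by continuity to $\dot H^\alpha$ of the functional $\Phi\mapsto-\int_{\mathbb R^d}\sum_{j,k}F^{jk}D_k\Phi^j\,dx$ on $\mathscr S_0$ (which is bounded in the norm of $\dot H^\alpha$). -/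

import Mathlib

open MeasureTheory Filter Topology
open scoped ENNReal NNReal FourierTransform SchwartzMap Convolution ContDiff

namespace FracStokes

noncomputable section

/-- Points of `ℝ^d` and values of vector fields, with the Euclidean norm. -/
abbrev Vec (d : ℕ) : Type := EuclideanSpace ℝ (Fin d)

/-- Values of 2-tensor fields `F = [F^{jk}]`, with the norm `|F|² = F : F`. -/
abbrev Tens (d : ℕ) : Type := EuclideanSpace ℝ (Fin d × Fin d)

/-- The partial derivative `D_i f`. -/
def pd {d : ℕ} {V : Type*} [NormedAddCommGroup V] [NormedSpace ℝ V]
    (i : Fin d) (f : Vec d → V) (x : Vec d) : V :=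
  fderiv ℝ f x (EuclideanSpace.single i 1)

/-- The fractional Laplacian `Λ^s φ = ((2π|ξ|)^s φ̂)^∨`, with
`φ̂(ξ) = ∫ exp(-2πi x·ξ) φ(x) dx`. It is used for Schwartz functions `φ` if `s > 0`, and for
Schwartz functions `φ` all of whose moments vanish if `s` is any real number; in both cases
`(2π|ξ|)^s φ̂` is integrable. -/
def fracLap {d : ℕ} (s : ℝ) (φ : Vec d → ℂ) : Vec d → ℂ :=
  𝓕⁻ (fun ξ : Vec d => (((2 * Real.pi * ‖ξ‖) ^ s : ℝ) : ℂ) * 𝓕 φ ξ)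

/-- Membership in `𝓢₀`: all derivatives of `φ̂` vanish at the origin. -/
def MemS0 {d : ℕ} (φ : 𝓢(Vec d, ℂ)) : Prop :=
  ∀ n : ℕ, iteratedFDeriv ℝ n (𝓕 φ : 𝓢(Vec d, ℂ)) 0 = 0

/-- `Λ^s f = w` in `𝓢₀'` (componentwise), for `f` and `w` in `L^1 + L^∞`:
`⟨f, Λ^s φ⟩ = ⟨w, φ⟩` for all `φ ∈ 𝓢₀`. -/
def FracLapEq {d : ℕ} {ι : Type*} (s : ℝ) (f w : Vec d → EuclideanSpace ℝ ι) : Prop :=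
  ∀ φ : 𝓢(Vec d, ℂ), MemS0 φ → ∀ i : ι,
    ∫ x, (f x i : ℂ) * fracLap s φ x = ∫ x, (w x i : ℂ) * φ x

/-- Membership of a field `f` in `L^1 + L^∞` in the homogeneous Sobolev space
`Ḣ^s = {f ∈ 𝓢₀' : Λ^s f ∈ L^2}`. -/
def MemHomSobolev {d : ℕ} {ι : Type*} [Fintype ι] (s : ℝ)
    (f : Vec d → EuclideanSpace ℝ ι) : Prop :=
  ∃ w : Vec d → EuclideanSpace ℝ ι, MemLp w 2 volume ∧ FracLapEq s f w

/-- Membership in `L^1 + L^∞`. -/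
def MemL1AddLinfty {d : ℕ} (u : Vec d → Vec d) : Prop :=
  ∃ v w : Vec d → Vec d, MemLp v 1 volume ∧ MemLp w ∞ volume ∧ u =ᵐ[volume] v + w

/-- `u` is a very weak solution of `Λ^{2α} u + ∇p_* = div F`, `div u = 0` in `ℝ^d`. -/
def IsVeryWeakSolution {d : ℕ} (α : ℝ) (F : Vec d → Tens d) (u : Vec d → Vec d) : Prop :=
  MemL1AddLinfty u ∧
  ∀ (Φ : Vec d → Vec d) (ψ : Vec d → ℝ),
    ContDiff ℝ ∞ Φ → HasCompactSupport Φ →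
    (∀ x, ∑ j, pd j (fun y => Φ y j) x = 0) →
    ContDiff ℝ ∞ ψ → HasCompactSupport ψ →
    ∫ x, ∑ j, (u x j : ℂ) * (fracLap (2 * α) (fun y => (Φ y j : ℂ)) x + ((pd j ψ x : ℝ) : ℂ)) =
      -((∫ x, ∑ j, ∑ k, F x (j, k) * pd k (fun y => Φ y j) x : ℝ) : ℂ)

/-- The kernel `U_{α,j}^{kl}(x)`. -/
def stokesKernel (d : ℕ) (α : ℝ) (j k l : Fin d) (x : Vec d) : ℝ :=
  Real.Gamma (1 + d / 2 - α) /
      ((2 : ℝ) ^ (2 * α) * Real.pi ^ ((d : ℝ) / 2) * Real.Gamma (1 + α)) *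
    (pd l (fun y : Vec d => y j * y k / ‖y‖ ^ ((d : ℝ) + 2 - 2 * α)) x -
      (if j = k then 1 else 0) * (2 * α - 1) * x l / ‖x‖ ^ ((d : ℝ) + 2 - 2 * α))

/-- The convolution integral of `U_{α,j}^{kl}` and `F^{kl}` converges absolutely at `x`, for all
`j`, `k`, `l`. -/
def KernelConvExistsAt {d : ℕ} (α : ℝ) (F : Vec d → Tens d) (x : Vec d) : Prop :=
  ∀ j k l : Fin d, ConvolutionExistsAt (stokesKernel d α j k l) (fun y => F y (k, l)) x
    (ContinuousLinearMap.mul ℝ ℝ) volume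

/-- `U_α * F`, with components `∑_{k,l} U_{α,j}^{kl} * F^{kl}`. -/
def kernelConv {d : ℕ} (α : ℝ) (F : Vec d → Tens d) (x : Vec d) : Vec d :=
  WithLp.toLp 2 fun j => ∑ k, ∑ l,
    (stokesKernel d α j k l ⋆[ContinuousLinearMap.mul ℝ ℝ, volume] fun y => F y (k, l)) x

/-- `⟨div F, Φ⟩ = -⟨F, ∇Φ⟩` for a vector field `Φ` with components in `𝓢₀`; here
`(div F)^j = ∑_k D_k F^{jk}`. -/
def divAction {d : ℕ} (F : Vec d → Tens d) (Φ : Fin d → 𝓢(Vec d, ℂ)) : ℂ :=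
  -∫ x, ∑ j, ∑ k, (F x (j, k) : ℂ) * pd k (Φ j) x

/-- `⟨div F, u⟩ = c`, where `u ∈ Ḣ^s` is given by `w = Λ^s u ∈ L^2` and `⟨div F, ·⟩` is extended
by continuity from `𝓢₀` to `Ḣ^s`: the functional `Φ ↦ ⟨div F, Φ⟩` on `𝓢₀` is bounded in the norm
of `Ḣ^s`, and `c` is its limit along a sequence in `𝓢₀` that converges to `u` in `Ḣ^s`. -/
def DivPairingEq {d : ℕ} (s : ℝ) (F : Vec d → Tens d) (w : Vec d → Vec d) (c : ℂ) : Prop :=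
  (∃ C : ℝ≥0, ∀ Φ : Fin d → 𝓢(Vec d, ℂ), (∀ j, MemS0 (Φ j)) →
    ‖divAction F Φ‖ₑ ≤ C * ∑ j, eLpNorm (fracLap s (Φ j)) 2 volume) ∧
  ∃ Φ : ℕ → Fin d → 𝓢(Vec d, ℂ), (∀ n j, MemS0 (Φ n j)) ∧
    (∀ j, Tendsto
      (fun n => eLpNorm (fun x => fracLap s (Φ n j) x - (w x j : ℂ)) 2 volume) atTop (𝓝 0)) ∧
    Tendsto (fun n => divAction F (Φ n)) atTop (𝓝 c)

/-- The energy identity `∫ |Λ^α u|² dx = ⟨div F, u⟩`. -/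
def EnergyIdentity {d : ℕ} (α : ℝ) (F : Vec d → Tens d) (u : Vec d → Vec d) : Prop :=
  ∃ w : Vec d → Vec d, MemLp w 2 volume ∧ FracLapEq α u w ∧
    DivPairingEq α F w ((∫ x, ‖w x‖ ^ 2 : ℝ) : ℂ)

end

end FracStokes

open FracStokes

/-! On the Fourier side the pressure is removed by the projection onto `ξ^⊥`, and the solution is
`û^j = i σ_j^{kl} F̂^{kl}` (summed over `k`, `l`) with `σ_j^{kl}(ξ) = (2π|ξ|)^{-2α} 2πξ_l (δ_{jk} -
ξ_j ξ_k / |ξ|²)`, which is `stokesSymbol`. That `U_α` has this symbol is obtained without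
distribution theory. Both are integrals over `t > 0`, of `t^{α-1}/Γ(α) δ_{jk} D_l g_t + t^α/Γ(α+1)
D_j D_k D_l g_t` with the heat kernel `g_t` and of its Fourier transform. These integrals converge
absolutely, with bounds `C|x|^{2α-1-d}` and `C|ξ|^{1-2α}`, so Fubini reduces the claim to Gaussians
(`integral_stokesKernel_mul_fourierInv`).

Existence and the estimate: the bound `C|x|^{2α-1-d}` and the Hardy-Littlewood-Sobolev inequality
(`lintegral_rieszPot_rpow_le`, from the maximal theorem through Hedberg's inequality) give absolute
convergence of `U_α * F` and its `L^q` norm. In the very weak formulation the odd kernel is moved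
onto the test expression `Λ^{2α}Φ + ∇ψ`, where its symbol kills `∇ψ` and, as `div Φ = 0`, turns
`Λ^{2α}Φ` into `∇Φ` (`sum_stokesSymbol_mul_testSymbol`). The pairings make sense because `Λ^{2α}Φ`
is bounded and integrable (`integrable_fracLap`).

Uniqueness: let `w` in `L^q` solve the homogeneous problem. Testing with `ψ` gives `div w = 0`.
Testing with `Φ = D_k η e_j - D_j η e_k` gives that `Λ^{2α}` of the curl of `w` vanishes. These
translation-invariant conditions pass from compactly supported `η` to Schwartz functions
(`sum_integral_eq_zero_of_test`), so `Λ^{-2α}` can be inserted on `𝓢₀`. Hence `w` is divergence free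
and curl free there, each component annihilates `Δ𝓢₀ = 𝓢₀`, and `w = 0` because low frequencies are
negligible in `L^{q'}`, `q' > 1` (`ae_eq_zero_of_forall_memS0`).

Energy: with Riesz transforms `R_k`, `D_k = Λ^{1-α} R_k Λ^α` on `𝓢₀`. If `Λ^{1-α}F` is in `L²`, then
`div F` is represented by `G^k = ∑_l R_l Λ^{1-α}F^{kl}`, and `Λ^α u = PG` where `P = 1 + R ⊗ R`
projects orthogonally onto divergence-free fields. So `⟨div F, u⟩ = ⟨G, PG⟩ = ‖PG‖²`
(`sum_pairing_divPart_solPart`). -/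

namespace FracStokes

noncomputable section

/-- The weight `max(|ξ|, |ξ|⁻¹)`. -/
def wt {E : Type} [NormedAddCommGroup E] (ξ : E) : ℝ := max ‖ξ‖ ‖ξ‖⁻¹

/-! ### Functions flat at the origin and at infinity, and the multipliers that preserve them -/

section Flat

lemma one_le_wt {E : Type} [NormedAddCommGroup E] {ξ : E} (h : ξ ≠ 0) : 1 ≤ wt ξ := by
  rcases le_total 1 ‖ξ‖ with h1 | h1
  · exact h1.trans (le_max_left _ _)
  · exact ((one_le_inv₀ (norm_pos_iff.2 h)).2 h1).trans (le_max_right _ _)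

/-- The weight dominates both `‖ξ‖` and `‖ξ‖⁻¹`, so one integer power of it controls real powers of
either sign. -/
lemma rpow_norm_le_wt {E : Type} [NormedAddCommGroup E] {ξ : E} (h : ξ ≠ 0) (s : ℝ) : ‖ξ‖ ^ s ≤ wt ξ ^ ⌈|s|⌉₊ := by
  have h0 := norm_pos_iff.2 h
  have h1 : ‖ξ‖ ^ s ≤ wt ξ ^ |s| := by
    rcases le_total 0 s with hs | hs
    · rw [abs_of_nonneg hs]
      exact Real.rpow_le_rpow h0.le (le_max_left _ _) hs
    · rw [abs_of_nonpos hs, Real.rpow_neg (by unfold wt; positivity), ← Real.inv_rpow (by unfold wt; positivity)]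
      refine Real.rpow_le_rpow_of_nonpos (inv_pos.2 (lt_of_lt_of_le one_pos (one_le_wt h))) ?_ hs
      rw [inv_le_comm₀ (lt_of_lt_of_le one_pos (one_le_wt h)) h0]
      exact le_max_right _ _
  refine h1.trans ?_
  rw [← Real.rpow_natCast]
  exact Real.rpow_le_rpow_of_exponent_le (one_le_wt h) (Nat.le_ceil _)

variable {E : Type} [NormedAddCommGroup E] [NormedSpace ℝ E]

/-- Smooth off the origin, with derivatives of power growth at `0` and at `∞`. -/
structure IsPowerSymbol (m : E → ℂ) : Prop where
  contDiffAt : ∀ ξ, ξ ≠ 0 → ContDiffAt ℝ ∞ m ξ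
  bound : ∀ n : ℕ, ∃ (C : ℝ) (k : ℕ), ∀ ξ, ξ ≠ 0 → ‖iteratedFDeriv ℝ n m ξ‖ ≤ C * wt ξ ^ k

/-- Smooth off the origin, with derivatives that decay faster than every power at `0` and `∞`. -/
structure IsFlat {V : Type} [NormedAddCommGroup V] [NormedSpace ℝ V] (g : E → V) : Prop where
  zero : g 0 = 0
  contDiffAt : ∀ ξ, ξ ≠ 0 → ContDiffAt ℝ ∞ g ξ
  bound : ∀ n N : ℕ, ∃ C : ℝ, ∀ ξ, ξ ≠ 0 → wt ξ ^ N * ‖iteratedFDeriv ℝ n g ξ‖ ≤ C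

/-- Quadratic vanishing is `o(‖ξ‖)`, which is enough for the derivative at the origin to exist and
be zero. -/
lemma IsFlat.norm_le {V : Type} [NormedAddCommGroup V] [NormedSpace ℝ V] {g : E → V}
    (hg : IsFlat g) : ∃ C : ℝ, 0 ≤ C ∧ ∀ ξ, ‖g ξ‖ ≤ C * ‖ξ‖ ^ 2 := by
  obtain ⟨C, hC⟩ := hg.bound 0 2
  refine ⟨|C|, abs_nonneg _, fun ξ => ?_⟩
  rcases eq_or_ne ξ 0 with rfl | h
  · simp [hg.zero]
  have h0 := norm_pos_iff.2 h
  have h1 := hC ξ h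
  rw [norm_iteratedFDeriv_zero] at h1
  have h2 : (‖ξ‖⁻¹) ^ 2 * ‖g ξ‖ ≤ |C| :=
    (mul_le_mul_of_nonneg_right (pow_le_pow_left₀ (by positivity) (le_max_right _ _) 2)
      (norm_nonneg _)).trans (h1.trans (le_abs_self C))
  rw [inv_pow, inv_mul_le_iff₀ (by positivity)] at h2
  linarith

lemma IsFlat.hasFDerivAt_zero {V : Type} [NormedAddCommGroup V] [NormedSpace ℝ V] {g : E → V}
    (hg : IsFlat g) : HasFDerivAt g (0 : E →L[ℝ] V) 0 := by
  obtain ⟨C, hC, h⟩ := hg.norm_le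
  rw [hasFDerivAt_iff_isLittleO_nhds_zero]
  simp only [zero_add, hg.zero, sub_zero, zero_apply]
  refine Asymptotics.IsBigO.trans_isLittleO (g := fun ξ : E => ‖ξ‖ ^ 2) ?_ ?_
  · exact Asymptotics.IsBigO.of_bound C (Eventually.of_forall fun ξ => by simpa using h ξ)
  · exact Asymptotics.isLittleO_norm_pow_id (by norm_num)

lemma IsFlat.fderiv {V : Type} [NormedAddCommGroup V] [NormedSpace ℝ V] {g : E → V}
    (hg : IsFlat g) : IsFlat (fderiv ℝ g) where
  zero := hg.hasFDerivAt_zero.fderiv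
  contDiffAt ξ h := (hg.contDiffAt ξ h).fderiv_right (by simp)
  bound n N := by
    obtain ⟨C, hC⟩ := hg.bound (n + 1) N
    exact ⟨C, fun ξ h => by rw [norm_iteratedFDeriv_fderiv]; exact hC ξ h⟩

lemma IsFlat.differentiable {V : Type} [NormedAddCommGroup V] [NormedSpace ℝ V] {g : E → V}
    (hg : IsFlat g) : Differentiable ℝ g := fun ξ => by
  rcases eq_or_ne ξ 0 with rfl | h
  · exact hg.hasFDerivAt_zero.differentiableAt
  · exact (hg.contDiffAt ξ h).differentiableAt (by simp)

/-- Flatness passes to the derivative, so only the first derivative at the origin has to be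
examined. The target space is quantified inside the induction because `fderiv` changes it. -/
lemma IsFlat.contDiff_nat (n : ℕ) : ∀ {V : Type} [NormedAddCommGroup V] [NormedSpace ℝ V]
    {g : E → V}, IsFlat g → ContDiff ℝ n g := by
  induction n with
  | zero => intro V _ _ g hg; exact contDiff_zero.2 hg.differentiable.continuous
  | succ n ih =>
    intro V _ _ g hg
    rw [Nat.cast_succ, contDiff_succ_iff_fderiv]
    exact ⟨hg.differentiable, by simp, ih hg.fderiv⟩

lemma IsFlat.iteratedFDeriv_zero (n : ℕ) : ∀ {V : Type} [NormedAddCommGroup V] [NormedSpace ℝ V]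
    {g : E → V}, IsFlat g → iteratedFDeriv ℝ n g 0 = 0 := by
  induction n with
  | zero =>
    intro V _ _ g hg
    rw [← norm_eq_zero, norm_iteratedFDeriv_zero, hg.zero, norm_zero]
  | succ n ih =>
    intro V _ _ g hg
    rw [← norm_eq_zero, ← norm_iteratedFDeriv_fderiv, ih hg.fderiv, norm_zero]

/-- A flat function as a Schwartz function. -/
def IsFlat.toSchwartz {V : Type} [NormedAddCommGroup V] [NormedSpace ℝ V] {g : E → V}
    (hg : IsFlat g) : 𝓢(E, V) where
  toFun := g
  smooth' := contDiff_infty.2 fun n => hg.contDiff_nat n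
  decay' k n := by
    obtain ⟨C, hC⟩ := hg.bound n k
    refine ⟨|C|, fun ξ => ?_⟩
    rcases eq_or_ne ξ 0 with rfl | h
    · simp [hg.iteratedFDeriv_zero n]
    · exact (mul_le_mul_of_nonneg_right (pow_le_pow_left₀ (norm_nonneg _) (le_max_left _ _) k)
        (norm_nonneg _)).trans ((hC ξ h).trans (le_abs_self C))

/-- Leibniz rule on the open complement of the origin: the growth `wt ^ k` of a derivative of `m` is
paid for by asking `k` more powers of decay from `g`. This is why homogeneous multipliers of any
real order act on `𝓢₀`. -/
lemma IsFlat.symbol_mul {m g : E → ℂ} (hm : IsPowerSymbol m) (hg : IsFlat g) :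
    IsFlat (fun ξ => m ξ * g ξ) where
  zero := by simp [hg.zero]
  contDiffAt ξ h := (hm.contDiffAt ξ h).mul (hg.contDiffAt ξ h)
  bound n N := by
    choose C k hC using hm.bound
    have hg' := hg.bound
    choose D hD using hg'
    refine ⟨∑ i ∈ Finset.range (n + 1), (n.choose i : ℝ) * |C i| * |D (n - i) (N + k i)|,
      fun ξ h => ?_⟩
    have ho : IsOpen ({0}ᶜ : Set E) := isOpen_compl_singleton
    have hmem : ξ ∈ ({0}ᶜ : Set E) := h
    have h1 := norm_iteratedFDerivWithin_mul_le (𝕜 := ℝ) (s := ({0}ᶜ : Set E)) (f := m) (g := g)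
      (N := ∞) (fun x hx => (hm.contDiffAt x hx).contDiffWithinAt)
      (fun x hx => (hg.contDiffAt x hx).contDiffWithinAt) ho.uniqueDiffOn hmem
      (n := n) (by exact_mod_cast le_top)
    simp only [iteratedFDerivWithin_of_isOpen _ ho hmem] at h1
    have hw : 0 ≤ wt ξ := zero_le_one.trans (one_le_wt h)
    refine (mul_le_mul_of_nonneg_left h1 (pow_nonneg hw N)).trans ?_
    rw [Finset.mul_sum]
    refine Finset.sum_le_sum fun i _ => ?_
    have h2 : ‖iteratedFDeriv ℝ i m ξ‖ ≤ |C i| * wt ξ ^ k i :=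
      (hC i ξ h).trans (mul_le_mul_of_nonneg_right (le_abs_self _) (pow_nonneg hw _))
    have h3 := (hD (n - i) (N + k i) ξ h).trans (le_abs_self _)
    calc wt ξ ^ N * ((n.choose i : ℝ) * ‖iteratedFDeriv ℝ i m ξ‖ * ‖iteratedFDeriv ℝ (n - i) g ξ‖)
        ≤ wt ξ ^ N * ((n.choose i : ℝ) * (|C i| * wt ξ ^ k i) * ‖iteratedFDeriv ℝ (n - i) g ξ‖) := by
          gcongr
      _ = (n.choose i : ℝ) * |C i| * (wt ξ ^ (N + k i) * ‖iteratedFDeriv ℝ (n - i) g ξ‖) := by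
          rw [pow_add]; ring
      _ ≤ _ := by gcongr

/-- The mean value inequality on the ball of radius `‖ξ‖` gains one power of `‖ξ‖` at the price of
one derivative. Since all derivatives vanish at the origin this can be repeated `N` times. -/
lemma schwartz_norm_iteratedFDeriv_le_pow {V : Type} [NormedAddCommGroup V] [NormedSpace ℝ V]
    (g : 𝓢(E, V)) (h : ∀ n, iteratedFDeriv ℝ n g 0 = 0) (N : ℕ) :
    ∀ n, ∃ C : ℝ, 0 ≤ C ∧ ∀ ξ, ‖iteratedFDeriv ℝ n g ξ‖ ≤ C * ‖ξ‖ ^ N := by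
  induction N with
  | zero =>
    intro n
    obtain ⟨C, hC, h1⟩ := g.decay 0 n
    exact ⟨C, hC.le, by simpa using h1⟩
  | succ N ih =>
    intro n
    obtain ⟨C, hC, h1⟩ := ih (n + 1)
    refine ⟨C, hC, fun ξ => ?_⟩
    have h2 := (convex_closedBall (0 : E) ‖ξ‖).norm_image_sub_le_of_norm_fderiv_le (𝕜 := ℝ)
      (f := iteratedFDeriv ℝ n g) (C := C * ‖ξ‖ ^ N) (x := 0) (y := ξ)
      (fun x _ => ((g.smooth (n + 1 : ℕ)).differentiable_iteratedFDeriv (m := n)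
        (by exact_mod_cast Nat.lt_succ_self n)) x)
      (fun x hx => by
        rw [norm_fderiv_iteratedFDeriv]
        refine (h1 x).trans ?_
        gcongr
        simpa using hx) (by simp) (by simp)
    rw [h n, sub_zero, sub_zero] at h2
    calc _ ≤ _ := h2
      _ = _ := by ring

lemma isFlat_of_schwartz {V : Type} [NormedAddCommGroup V] [NormedSpace ℝ V]
    (g : 𝓢(E, V)) (h : ∀ n, iteratedFDeriv ℝ n g 0 = 0) : IsFlat g where
  zero := by
    have := h 0
    rw [← norm_eq_zero, norm_iteratedFDeriv_zero, norm_eq_zero] at this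
    exact this
  contDiffAt ξ _ := g.contDiffAt ⊤
  bound n N := by
    obtain ⟨C, _, hC⟩ := g.decay N n
    obtain ⟨D, hD0, hD⟩ := schwartz_norm_iteratedFDeriv_le_pow g h N n
    refine ⟨max C D, fun ξ hξ => ?_⟩
    have h0 := norm_pos_iff.2 hξ
    rcases le_total ‖ξ‖ ‖ξ‖⁻¹ with h1 | h1
    · rw [wt, max_eq_right h1, inv_pow, inv_mul_le_iff₀ (by positivity)]
      refine (hD ξ).trans ?_
      rw [mul_comm]
      gcongr
      exact le_max_right _ _
    · rw [wt, max_eq_left h1]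
      exact (hC ξ).trans (le_max_left _ _)

/-- A smooth homogeneous function is a power symbol. -/
lemma IsPowerSymbol.of_homogeneous [FiniteDimensional ℝ E] {m : E → ℂ} (s : ℝ)
    (hm : ∀ ξ, ξ ≠ 0 → ContDiffAt ℝ ∞ m ξ)
    (hs : ∀ (t : ℝ) (ξ : E), 0 < t → m (t • ξ) = t ^ s • m ξ) : IsPowerSymbol m where
  contDiffAt := hm
  bound n := by
    have ho : IsOpen ({0}ᶜ : Set E) := isOpen_compl_singleton
    have hc : ContinuousOn (fun ξ => ‖iteratedFDeriv ℝ n m ξ‖) (Metric.sphere (0 : E) 1) := by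
      have h1 : ContinuousOn (iteratedFDerivWithin ℝ n m {0}ᶜ) ({0}ᶜ : Set E) :=
        ContDiffOn.continuousOn_iteratedFDerivWithin (n := ∞)
          (fun x hx => (hm x hx).contDiffWithinAt) (by exact_mod_cast le_top) ho.uniqueDiffOn
      refine ContinuousOn.norm (ContinuousOn.congr (h1.mono ?_) ?_)
      · intro x hx h
        rw [h] at hx
        simp at hx
      · intro x hx
        refine (iteratedFDerivWithin_of_isOpen n ho ?_).symm
        intro h
        rw [h] at hx
        simp at hx
    obtain ⟨C, hC⟩ := ((isCompact_sphere (0 : E) 1).image_of_continuousOn hc).bddAbove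
    refine ⟨|C|, ⌈|s - n|⌉₊, fun ξ hξ => ?_⟩
    have h0 := norm_pos_iff.2 hξ
    -- Rescaling to the unit sphere: `m = t ^ s • m(t⁻¹ •)`, so the `n`-th derivative at `ξ` is at
    -- most `t ^ (s - n)` times its maximum over the compact sphere.
    set t := ‖ξ‖ with ht
    let g : E ≃L[ℝ] E := ContinuousLinearEquiv.smulLeft (Units.mk0 t⁻¹ (inv_ne_zero h0.ne'))
    have hg : ∀ x, g x = t⁻¹ • x := fun x => rfl
    have hmg : m = t ^ s • (m ∘ g) := by
      funext x
      simp only [Pi.smul_apply, Function.comp, hg]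
      rw [← hs t _ h0, smul_smul, mul_inv_cancel₀ h0.ne', one_smul]
    have hgξ : g ξ ∈ Metric.sphere (0 : E) 1 := by
      simp [hg, norm_smul, ← ht, abs_of_pos h0, h0.ne']
    have hgne : g ξ ≠ 0 := by
      rw [hg]; exact smul_ne_zero (inv_ne_zero h0.ne') hξ
    have h1 : iteratedFDeriv ℝ n m ξ = t ^ s •
        (iteratedFDeriv ℝ n m (g ξ)).compContinuousLinearMap fun _ => (g : E →L[ℝ] E) := by
      conv_lhs => rw [hmg]
      rw [iteratedFDeriv_const_smul_apply]
      · congr 1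
        have := g.iteratedFDerivWithin_comp_right m (uniqueDiffOn_univ) (x := ξ) (Set.mem_univ _) n
        simpa [iteratedFDerivWithin_univ] using this
      · exact (((hm _ hgne).comp ξ g.contDiff.contDiffAt)).of_le (by exact_mod_cast le_top)
    have h2 : ‖iteratedFDeriv ℝ n m (g ξ)‖ ≤ |C| :=
      (hC (Set.mem_image_of_mem _ hgξ)).trans (le_abs_self C)
    have h3 : ‖(g : E →L[ℝ] E)‖ ≤ t⁻¹ := by
      refine ContinuousLinearMap.opNorm_le_bound _ (by positivity) fun x => ?_
      change ‖g x‖ ≤ _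
      rw [hg, norm_smul, Real.norm_of_nonneg (by positivity)]
    calc ‖iteratedFDeriv ℝ n m ξ‖ ≤ t ^ s * (|C| * ∏ _i : Fin n, t⁻¹) := by
          rw [h1, norm_smul, Real.norm_of_nonneg (by positivity)]
          gcongr
          refine (ContinuousMultilinearMap.norm_compContinuousLinearMap_le _ _).trans ?_
          gcongr
      _ = |C| * t ^ (s - n) := by
          rw [Real.rpow_sub h0, Real.rpow_natCast]
          simp
          ring
      _ ≤ _ := by gcongr; exact rpow_norm_le_wt hξ _

end Flat

/-! ### Fractional Laplacian, Riesz transforms and derivatives on `𝓢₀` -/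

section Multipliers

variable {d : ℕ}

lemma isPowerSymbol_rpow (s : ℝ) :
    IsPowerSymbol (fun ξ : Vec d => (((2 * Real.pi * ‖ξ‖) ^ s : ℝ) : ℂ)) := by
  refine IsPowerSymbol.of_homogeneous s (fun ξ hξ => ?_) fun t ξ ht => ?_
  · refine Complex.ofRealCLM.contDiff.contDiffAt.comp ξ ?_
    refine ContDiffAt.rpow_const_of_ne (contDiffAt_const.mul (contDiffAt_norm ℝ hξ)) ?_
    have := norm_pos_iff.2 hξ
    positivity
  · rw [norm_smul, Real.norm_of_nonneg ht.le, show 2 * Real.pi * (t * ‖ξ‖) = t * (2 * Real.pi * ‖ξ‖) by ring,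
      Real.mul_rpow ht.le (by positivity)]
    simp

/-- The coordinate `ξ_l` as a continuous linear functional. -/
def coordL (l : Fin d) : Vec d →L[ℝ] ℝ := EuclideanSpace.proj l

lemma coordL_apply (l : Fin d) (x : Vec d) : coordL l x = x l := rfl

lemma isPowerSymbol_deriv (l : Fin d) :
    IsPowerSymbol (fun ξ : Vec d => 2 * Real.pi * Complex.I * (ξ l : ℂ)) := by
  refine IsPowerSymbol.of_homogeneous 1 (fun ξ hξ => ?_) fun t ξ ht => ?_
  · refine contDiffAt_const.mul (Complex.ofRealCLM.contDiff.contDiffAt.comp ξ ?_)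
    exact (coordL l).contDiff.contDiffAt
  · simp
    ring

lemma isPowerSymbol_riesz (l : Fin d) :
    IsPowerSymbol (fun ξ : Vec d => Complex.I * ((ξ l / ‖ξ‖ : ℝ) : ℂ)) := by
  refine IsPowerSymbol.of_homogeneous 0 (fun ξ hξ => ?_) fun t ξ ht => ?_
  · refine contDiffAt_const.mul (Complex.ofRealCLM.contDiff.contDiffAt.comp ξ ?_)
    exact (coordL l).contDiff.contDiffAt.div (contDiffAt_norm ℝ hξ) (norm_ne_zero_iff.2 hξ)
  · rw [norm_smul, Real.norm_of_nonneg ht.le]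
    simp [mul_div_mul_left _ _ ht.ne']

lemma MemS0.isFlat {φ : 𝓢(Vec d, ℂ)} (h : MemS0 φ) : IsFlat (𝓕 φ : 𝓢(Vec d, ℂ)) :=
  isFlat_of_schwartz _ h

lemma IsFlat.memS0 {g : Vec d → ℂ} (h : IsFlat g) : MemS0 (𝓕⁻ h.toSchwartz : 𝓢(Vec d, ℂ)) := by
  intro n
  rw [FourierTransform.fourier_fourierInv_eq]
  exact h.iteratedFDeriv_zero n

lemma IsFlat.fourier_toSchwartz {g : Vec d → ℂ} (h : IsFlat g) (ξ : Vec d) :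
    (𝓕 (𝓕⁻ h.toSchwartz : 𝓢(Vec d, ℂ)) : 𝓢(Vec d, ℂ)) ξ = g ξ := by
  rw [FourierTransform.fourier_fourierInv_eq]
  rfl

open Classical in
/-- The Fourier multiplier operator with symbol `m` on `𝓢₀`. -/
def multS0 (m : Vec d → ℂ) (φ : 𝓢(Vec d, ℂ)) : 𝓢(Vec d, ℂ) :=
  if h : IsPowerSymbol m ∧ MemS0 φ then 𝓕⁻ (h.2.isFlat.symbol_mul h.1).toSchwartz else 0

lemma memS0_multS0 {m : Vec d → ℂ} (hm : IsPowerSymbol m) {φ : 𝓢(Vec d, ℂ)} (h : MemS0 φ) :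
    MemS0 (multS0 m φ) := by
  rw [multS0, dif_pos ⟨hm, h⟩]
  exact IsFlat.memS0 _

lemma fourier_multS0 {m : Vec d → ℂ} (hm : IsPowerSymbol m) {φ : 𝓢(Vec d, ℂ)} (h : MemS0 φ)
    (ξ : Vec d) : (𝓕 (multS0 m φ) : 𝓢(Vec d, ℂ)) ξ = m ξ * (𝓕 φ : 𝓢(Vec d, ℂ)) ξ := by
  rw [multS0, dif_pos ⟨hm, h⟩]
  exact IsFlat.fourier_toSchwartz _ ξ

lemma schwartz_ext_fourier {φ ψ : 𝓢(Vec d, ℂ)}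
    (h : ∀ ξ, (𝓕 φ : 𝓢(Vec d, ℂ)) ξ = (𝓕 ψ : 𝓢(Vec d, ℂ)) ξ) : φ = ψ := by
  have : (𝓕 φ : 𝓢(Vec d, ℂ)) = 𝓕 ψ := SchwartzMap.ext h
  rw [← FourierTransform.fourierInv_fourier_eq (F := 𝓢(Vec d, ℂ)) φ, this,
    FourierTransform.fourierInv_fourier_eq]

/-- Identities between symbols with negative powers of `‖ξ‖` fail at the origin, where these take
conventional values. Continuity of the transforms makes that single point irrelevant. -/
lemma schwartz_ext_fourier_ne [NeZero d] {φ ψ : 𝓢(Vec d, ℂ)}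
    (h : ∀ ξ, ξ ≠ 0 → (𝓕 φ : 𝓢(Vec d, ℂ)) ξ = (𝓕 ψ : 𝓢(Vec d, ℂ)) ξ) : φ = ψ := by
  refine schwartz_ext_fourier fun ξ => ?_
  have h1 : Set.EqOn (𝓕 φ : 𝓢(Vec d, ℂ)) (𝓕 ψ : 𝓢(Vec d, ℂ)) {0}ᶜ := fun ξ hξ => h ξ hξ
  have : Nontrivial (Vec d) := by
    have : Nonempty (Fin d) := ⟨⟨0, Nat.pos_of_ne_zero (NeZero.ne d)⟩⟩
    infer_instance
  exact congrFun (Continuous.ext_on (dense_compl_singleton (0 : Vec d)) (SchwartzMap.continuous _)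
    (SchwartzMap.continuous _) h1) ξ

/-- `Λ^s` on `𝓢₀`. -/
def lapS0 (s : ℝ) (φ : 𝓢(Vec d, ℂ)) : 𝓢(Vec d, ℂ) :=
  multS0 (fun ξ => (((2 * Real.pi * ‖ξ‖) ^ s : ℝ) : ℂ)) φ

/-- The Riesz transform with symbol `i ξ_l / |ξ|` on `𝓢₀`. -/
def rieszS0 (l : Fin d) (φ : 𝓢(Vec d, ℂ)) : 𝓢(Vec d, ℂ) :=
  multS0 (fun ξ => Complex.I * ((ξ l / ‖ξ‖ : ℝ) : ℂ)) φ

/-- The partial derivative of a Schwartz function. -/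
def pdS (l : Fin d) (φ : 𝓢(Vec d, ℂ)) : 𝓢(Vec d, ℂ) :=
  LineDeriv.lineDerivOp (EuclideanSpace.single l (1 : ℝ) : Vec d) φ

lemma pdS_apply (l : Fin d) (φ : 𝓢(Vec d, ℂ)) (x : Vec d) : pdS l φ x = pd l φ x :=
  SchwartzMap.lineDerivOp_apply_eq_fderiv _ _ _

lemma coe_pdS (l : Fin d) (φ : 𝓢(Vec d, ℂ)) : (pdS l φ : Vec d → ℂ) = pd l φ :=
  funext fun x => pdS_apply l φ x

lemma fourier_pdS (l : Fin d) (φ : 𝓢(Vec d, ℂ)) (ξ : Vec d) :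
    (𝓕 (pdS l φ) : 𝓢(Vec d, ℂ)) ξ = 2 * Real.pi * Complex.I * (ξ l : ℂ) * (𝓕 φ : 𝓢(Vec d, ℂ)) ξ := by
  rw [pdS, SchwartzMap.fourier_lineDerivOp_eq, smul_apply,
    SchwartzMap.smulLeftCLM_apply_apply (by fun_prop)]
  simp [EuclideanSpace.inner_single_right]
  ring

lemma pdS_eq_multS0 (l : Fin d) {φ : 𝓢(Vec d, ℂ)} (h : MemS0 φ) :
    pdS l φ = multS0 (fun ξ => 2 * Real.pi * Complex.I * (ξ l : ℂ)) φ :=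
  schwartz_ext_fourier fun ξ => by rw [fourier_pdS, fourier_multS0 (isPowerSymbol_deriv l) h]

lemma MemS0.pdS (l : Fin d) {φ : 𝓢(Vec d, ℂ)} (h : MemS0 φ) : MemS0 (pdS l φ) := by
  rw [pdS_eq_multS0 l h]
  exact memS0_multS0 (isPowerSymbol_deriv l) h

lemma MemS0.lapS0 (s : ℝ) {φ : 𝓢(Vec d, ℂ)} (h : MemS0 φ) : MemS0 (lapS0 s φ) :=
  memS0_multS0 (isPowerSymbol_rpow s) h

lemma MemS0.rieszS0 (l : Fin d) {φ : 𝓢(Vec d, ℂ)} (h : MemS0 φ) : MemS0 (rieszS0 l φ) :=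
  memS0_multS0 (isPowerSymbol_riesz l) h

lemma fourier_lapS0 (s : ℝ) {φ : 𝓢(Vec d, ℂ)} (h : MemS0 φ) (ξ : Vec d) :
    (𝓕 (lapS0 s φ) : 𝓢(Vec d, ℂ)) ξ =
      (((2 * Real.pi * ‖ξ‖) ^ s : ℝ) : ℂ) * (𝓕 φ : 𝓢(Vec d, ℂ)) ξ :=
  fourier_multS0 (isPowerSymbol_rpow s) h ξ

lemma fourier_rieszS0 (l : Fin d) {φ : 𝓢(Vec d, ℂ)} (h : MemS0 φ) (ξ : Vec d) :
    (𝓕 (rieszS0 l φ) : 𝓢(Vec d, ℂ)) ξ =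
      Complex.I * ((ξ l / ‖ξ‖ : ℝ) : ℂ) * (𝓕 φ : 𝓢(Vec d, ℂ)) ξ :=
  fourier_multS0 (isPowerSymbol_riesz l) h ξ

lemma fracLap_eq_lapS0 (s : ℝ) {φ : 𝓢(Vec d, ℂ)} (h : MemS0 φ) :
    fracLap s φ = lapS0 s φ := by
  have : (fun ξ : Vec d => (((2 * Real.pi * ‖ξ‖) ^ s : ℝ) : ℂ) * 𝓕 (φ : Vec d → ℂ) ξ) =
      (𝓕 (lapS0 s φ) : 𝓢(Vec d, ℂ)) := by
    funext ξ
    rw [fourier_lapS0 s h, SchwartzMap.fourier_coe]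
  rw [fracLap, this, ← SchwartzMap.fourierInv_coe, FourierTransform.fourierInv_fourier_eq]

lemma MemS0.add {φ ψ : 𝓢(Vec d, ℂ)} (h : MemS0 φ) (h' : MemS0 ψ) : MemS0 (φ + ψ) := by
  intro n
  have h1 : (𝓕 (φ + ψ) : 𝓢(Vec d, ℂ)) = 𝓕 φ + 𝓕 ψ := FourierTransform.fourier_add φ ψ
  have h2 := iteratedFDeriv_add_apply (𝕜 := ℝ) (x := (0 : Vec d)) (i := n)
    (f := (𝓕 φ : 𝓢(Vec d, ℂ))) (g := (𝓕 ψ : 𝓢(Vec d, ℂ)))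
    (SchwartzMap.contDiffAt _ n) (SchwartzMap.contDiffAt _ n)
  rw [h n, h' n, add_zero] at h2
  rw [h1]
  exact h2

lemma MemS0.smul (c : ℂ) {φ : 𝓢(Vec d, ℂ)} (h : MemS0 φ) : MemS0 (c • φ) := by
  intro n
  have h1 : (𝓕 (c • φ) : 𝓢(Vec d, ℂ)) = c • 𝓕 φ := FourierTransform.fourier_smul c φ
  have h2 := (((c • (1 : ℂ →L[ℝ] ℂ)))).iteratedFDeriv_comp_left (x := (0 : Vec d)) (i := n) (n := n)
    (f := (𝓕 φ : 𝓢(Vec d, ℂ))) (SchwartzMap.contDiffAt _ n) le_rfl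
  rw [h n] at h2
  rw [h1]
  refine Eq.trans ?_ (h2.trans ?_)
  · rfl
  · ext; simp

end Multipliers

/-! ### Frequency cutoffs and removal of low frequencies -/

section Cutoff

variable {d : ℕ}

lemma norm_fourierInv_le (f : Vec d → ℂ) (x : Vec d) : ‖𝓕⁻ f x‖ ≤ ∫ ξ, ‖f ξ‖ := by
  rw [Real.fourierInv_eq_fourier_neg]
  exact VectorFourier.norm_fourierIntegral_le_integral_norm _ _ _ _ _

/-- `L^r` norms are controlled by the `L^1` norm and a uniform bound. -/
lemma eLpNorm_le_of_bound {g : Vec d → ℂ} (hg : Integrable g) {B : ℝ} (hB : ∀ x, ‖g x‖ ≤ B)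
    {r : ℝ} (hr : 1 ≤ r) :
    eLpNorm g (ENNReal.ofReal r) volume ≤
      ENNReal.ofReal (B ^ (1 - 1 / r) * (∫ x, ‖g x‖) ^ (1 / r)) := by
  have hr0 : 0 < r := by linarith
  have hB0 : 0 ≤ B := (norm_nonneg _).trans (hB 0)
  rw [eLpNorm_eq_lintegral_rpow_enorm_toReal (by simpa using hr0) ENNReal.ofReal_ne_top,
    ENNReal.toReal_ofReal hr0.le]
  have h1 : ∀ x, ‖g x‖ₑ ^ r ≤ ENNReal.ofReal (B ^ (r - 1)) * ‖g x‖ₑ := fun x => by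
    rw [← ofReal_norm, ENNReal.ofReal_rpow_of_nonneg (norm_nonneg _) hr0.le,
      ← ENNReal.ofReal_mul (by positivity)]
    refine ENNReal.ofReal_le_ofReal ?_
    calc ‖g x‖ ^ r = ‖g x‖ ^ (r - 1 + 1) := by ring_nf
      _ = ‖g x‖ ^ (r - 1) * ‖g x‖ := by
        rw [Real.rpow_add_of_nonneg (norm_nonneg _) (by linarith) (by norm_num), Real.rpow_one]
      _ ≤ _ := by gcongr; exact hB x
  calc (∫⁻ x, ‖g x‖ₑ ^ r) ^ (1 / r)
      ≤ (∫⁻ x, ENNReal.ofReal (B ^ (r - 1)) * ‖g x‖ₑ) ^ (1 / r) := by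
        gcongr with x; exact h1 x
    _ = (ENNReal.ofReal (B ^ (r - 1) * ∫ x, ‖g x‖)) ^ (1 / r) := by
        rw [lintegral_const_mul' _ _ ENNReal.ofReal_ne_top, ← ofReal_integral_norm_eq_lintegral_enorm hg,
          ENNReal.ofReal_mul (by positivity)]
    _ = _ := by
        have h0 : 0 ≤ ∫ x, ‖g x‖ := integral_nonneg fun _ => norm_nonneg _
        rw [ENNReal.ofReal_rpow_of_nonneg (by positivity) (by positivity),
          Real.mul_rpow (by positivity) h0, ← Real.rpow_mul hB0]
        congr 3
        field_simp

lemma memLp_of_bound {g : Vec d → ℂ} (hg : Integrable g) {B : ℝ} (hB : ∀ x, ‖g x‖ ≤ B)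
    {r : ℝ} (hr : 1 ≤ r) : MemLp g (ENNReal.ofReal r) volume :=
  ⟨hg.aestronglyMeasurable, (eLpNorm_le_of_bound hg hB hr).trans_lt ENNReal.ofReal_lt_top⟩

lemma integrable_schwartz_convolution_le (f g : 𝓢(Vec d, ℂ)) :
    ∫ x, ‖(SchwartzMap.convolution (ContinuousLinearMap.mul ℂ ℂ) f g) x‖ ≤
      (∫ x, ‖f x‖) * ∫ x, ‖g x‖ := by
  have h1 := integral_convolution (ContinuousLinearMap.mul ℝ ℝ) (μ := volume) (ν := volume)
    (f.integrable (μ := volume)).norm (g.integrable (μ := volume)).norm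
  rw [ContinuousLinearMap.mul_apply'] at h1
  rw [← h1]
  refine integral_mono (SchwartzMap.integrable _).norm
    ((f.integrable.norm).integrable_convolution _ (g.integrable.norm)) fun x => ?_
  rw [SchwartzMap.convolution_apply]
  simp only [convolution]
  refine (norm_integral_le_integral_norm _).trans (le_of_eq ?_)
  simp

/-- Dilation by a positive factor. -/
def dilE (c : ℝ) (hc : 0 < c) : Vec d ≃L[ℝ] Vec d :=
  ContinuousLinearEquiv.smulLeft (Units.mk0 c hc.ne')

/-- The dilation `M(c ·)` of a Schwartz function. -/
def dil (c : ℝ) (hc : 0 < c) (M : 𝓢(Vec d, ℂ)) : 𝓢(Vec d, ℂ) :=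
  SchwartzMap.compCLMOfContinuousLinearEquiv ℂ (dilE c hc) M

lemma dil_apply (c : ℝ) (hc : 0 < c) (M : 𝓢(Vec d, ℂ)) (ξ : Vec d) : dil c hc M ξ = M (c • ξ) := rfl

/-- The Fourier multiplier with symbol `M(c ·)`. -/
def bandPass (M : 𝓢(Vec d, ℂ)) (c : ℝ) (hc : 0 < c) (φ : 𝓢(Vec d, ℂ)) : 𝓢(Vec d, ℂ) :=
  SchwartzMap.convolution (ContinuousLinearMap.mul ℂ ℂ) (𝓕⁻ (dil c hc M)) φ

lemma fourier_bandPass (M : 𝓢(Vec d, ℂ)) (c : ℝ) (hc : 0 < c) (φ : 𝓢(Vec d, ℂ)) (ξ : Vec d) :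
    (𝓕 (bandPass M c hc φ) : 𝓢(Vec d, ℂ)) ξ = M (c • ξ) * (𝓕 φ : 𝓢(Vec d, ℂ)) ξ := by
  rw [bandPass, SchwartzMap.fourier_convolution, FourierTransform.fourier_fourierInv_eq]
  rfl

/-- Dilating a multiplier dilates its kernel with the `L^1` normalization, so all the operators
`bandPass M c` share one `L^1` bound, independent of `c`. -/
lemma integral_norm_fourierInv_dil (M : 𝓢(Vec d, ℂ)) (c : ℝ) (hc : 0 < c) :
    ∫ x, ‖(𝓕⁻ (dil c hc M) : 𝓢(Vec d, ℂ)) x‖ = ∫ x, ‖(𝓕⁻ M : 𝓢(Vec d, ℂ)) x‖ := by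
  have h1 : ∀ x, (𝓕⁻ (dil c hc M) : 𝓢(Vec d, ℂ)) x =
      ((c ^ d)⁻¹ : ℝ) • (𝓕⁻ M : 𝓢(Vec d, ℂ)) (c⁻¹ • x) := fun x => by
    rw [SchwartzMap.fourierInv_coe, SchwartzMap.fourierInv_coe, Real.fourierInv_eq, Real.fourierInv_eq]
    have := Measure.integral_comp_smul_of_nonneg (volume : Measure (Vec d))
      (fun v => Real.fourierChar (inner ℝ v (c⁻¹ • x)) • M v) c (hR := hc.le)
    rw [finrank_euclideanSpace_fin] at this
    rw [← this]
    refine integral_congr_ae (Eventually.of_forall fun v => ?_)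
    simp only [inner_smul_left, inner_smul_right, dil_apply]
    rw [show c⁻¹ * ((starRingEnd ℝ) c * inner ℝ v x) = inner ℝ v x by
      simp [hc.ne']]
  simp_rw [h1, norm_smul]
  rw [integral_const_mul]
  have := Measure.integral_comp_inv_smul_of_nonneg (volume : Measure (Vec d))
    (fun v => ‖(𝓕⁻ M : 𝓢(Vec d, ℂ)) v‖) hc.le
  rw [this, finrank_euclideanSpace_fin, smul_eq_mul, Real.norm_of_nonneg (by positivity),
    ← mul_assoc, inv_mul_cancel₀ (by positivity), one_mul]

lemma integral_norm_bandPass_le (M : 𝓢(Vec d, ℂ)) (c : ℝ) (hc : 0 < c) (φ : 𝓢(Vec d, ℂ)) :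
    ∫ x, ‖bandPass M c hc φ x‖ ≤ (∫ x, ‖(𝓕⁻ M : 𝓢(Vec d, ℂ)) x‖) * ∫ x, ‖φ x‖ := by
  rw [← integral_norm_fourierInv_dil M c hc]
  exact integrable_schwartz_convolution_le _ _

lemma norm_bandPass_le (M : 𝓢(Vec d, ℂ)) (c : ℝ) (hc : 0 < c) (φ : 𝓢(Vec d, ℂ)) (x : Vec d) :
    ‖bandPass M c hc φ x‖ ≤ ∫ ξ, ‖M (c • ξ)‖ * ‖(𝓕 φ : 𝓢(Vec d, ℂ)) ξ‖ := by
  rw [← FourierTransform.fourierInv_fourier_eq (F := 𝓢(Vec d, ℂ)) (bandPass M c hc φ),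
    SchwartzMap.fourierInv_coe]
  refine (norm_fourierInv_le _ _).trans (le_of_eq ?_)
  congr 1
  funext ξ
  rw [fourier_bandPass, norm_mul]

/-- A smooth cutoff at the origin. -/
def bump (d : ℕ) : ContDiffBump (0 : Vec d) := ⟨1, 2, one_pos, one_lt_two⟩

/-- A smooth cutoff at the origin, as a Schwartz function. -/
def cutoff (d : ℕ) : 𝓢(Vec d, ℂ) :=
  HasCompactSupport.toSchwartzMap (f := fun x : Vec d => ((bump d x : ℝ) : ℂ))
    ((bump d).hasCompactSupport.comp_left (g := fun r : ℝ => (r : ℂ)) (by simp))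
    (Complex.ofRealCLM.contDiff.comp (bump d).contDiff)

lemma cutoff_apply (x : Vec d) : cutoff d x = ((bump d x : ℝ) : ℂ) := rfl

lemma cutoff_eq_one {x : Vec d} (h : ‖x‖ ≤ 1) : cutoff d x = 1 := by
  rw [cutoff_apply, (bump d).one_of_mem_closedBall (by simpa [bump] using h)]
  simp

lemma cutoff_eq_zero {x : Vec d} (h : 2 ≤ ‖x‖) : cutoff d x = 0 := by
  rw [cutoff_apply, (bump d).zero_of_le_dist (by simpa [bump] using h)]
  simp

lemma norm_cutoff_le (x : Vec d) : ‖cutoff d x‖ ≤ 1 := by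
  rw [cutoff_apply, Complex.norm_real, Real.norm_of_nonneg (bump d).nonneg]
  exact (bump d).le_one

lemma iteratedFDeriv_eq_zero_of_near {g : Vec d → ℂ} {δ : ℝ} (hδ : 0 < δ)
    (h : ∀ ξ, ‖ξ‖ < δ → g ξ = 0) (n : ℕ) : iteratedFDeriv ℝ n g 0 = 0 := by
  have h1 : g =ᶠ[𝓝 0] fun _ => 0 := by
    filter_upwards [Metric.ball_mem_nhds (0 : Vec d) hδ] with ξ hξ
    exact h ξ (by simpa using hξ)
  rw [(h1.iteratedFDeriv ℝ n).eq_of_nhds, iteratedFDeriv_fun_zero]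
  rfl

lemma memS0_of_near {φ : 𝓢(Vec d, ℂ)} {δ : ℝ} (hδ : 0 < δ)
    (h : ∀ ξ, ‖ξ‖ < δ → (𝓕 φ : 𝓢(Vec d, ℂ)) ξ = 0) : MemS0 φ :=
  fun n => iteratedFDeriv_eq_zero_of_near hδ h n

/-- The part of `φ` at frequencies of size at least `1 / c`. -/
def highPass (c : ℝ) (hc : 0 < c) (φ : 𝓢(Vec d, ℂ)) : 𝓢(Vec d, ℂ) := φ - bandPass (cutoff d) c hc φ

lemma fourier_highPass (c : ℝ) (hc : 0 < c) (φ : 𝓢(Vec d, ℂ)) (ξ : Vec d) :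
    (𝓕 (highPass c hc φ) : 𝓢(Vec d, ℂ)) ξ = (1 - cutoff d (c • ξ)) * (𝓕 φ : 𝓢(Vec d, ℂ)) ξ := by
  have h := FourierTransform.fourierCLM_apply (R := ℂ) (E := 𝓢(Vec d, ℂ)) (highPass c hc φ)
  rw [← h, highPass, map_sub, FourierTransform.fourierCLM_apply, FourierTransform.fourierCLM_apply,
    sub_apply, fourier_bandPass]
  ring

lemma memS0_highPass (c : ℝ) (hc : 0 < c) (φ : 𝓢(Vec d, ℂ)) : MemS0 (highPass c hc φ) := by
  refine memS0_of_near (inv_pos.2 hc) fun ξ hξ => ?_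
  rw [fourier_highPass, cutoff_eq_one, sub_self, zero_mul]
  rw [norm_smul, Real.norm_of_nonneg hc.le]
  rw [← mul_inv_cancel₀ hc.ne']
  exact mul_le_mul_of_nonneg_left hξ.le hc.le

instance [NeZero d] : Nontrivial (Vec d) := by
  have : Nonempty (Fin d) := ⟨⟨0, Nat.pos_of_ne_zero (NeZero.ne d)⟩⟩
  infer_instance

lemma ae_ne_zero [NeZero d] : ∀ᵐ ξ : Vec d, ξ ≠ 0 := Measure.ae_ne volume 0

/-- The supports shrink to the origin, a null set since `d ≠ 0`; dominated convergence. -/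
lemma tendsto_integral_cutoff [NeZero d] {h : Vec d → ℝ} (hh : Integrable h) {c : ℕ → ℝ}
    (hc : Tendsto c atTop atTop) :
    Tendsto (fun n => ∫ ξ, ‖cutoff d (c n • ξ)‖ * h ξ) atTop (𝓝 0) := by
  rw [← integral_zero (Vec d) ℝ]
  refine tendsto_integral_of_dominated_convergence (fun ξ => ‖h ξ‖) (fun n => ?_) hh.norm
    (fun n => Eventually.of_forall fun ξ => ?_) ?_
  · exact (((cutoff d).continuous.comp (continuous_const_smul (c n))).norm.aestronglyMeasurable).mul
      hh.aestronglyMeasurable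
  · rw [norm_mul, norm_norm]
    exact mul_le_of_le_one_left (norm_nonneg _) (norm_cutoff_le _)
  · filter_upwards [ae_ne_zero (d := d)] with ξ hξ
    have h0 := norm_pos_iff.2 hξ
    refine tendsto_const_nhds.congr' ?_
    filter_upwards [hc.eventually_ge_atTop (2 / ‖ξ‖), hc.eventually_ge_atTop 0] with n hn hn0
    rw [cutoff_eq_zero, norm_zero, zero_mul]
    rw [norm_smul, Real.norm_of_nonneg hn0]
    rwa [div_le_iff₀ h0] at hn

/-- `𝓢₀` approximates Schwartz functions in `L^r` for `r > 1`. -/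
lemma tendsto_eLpNorm_bandPass_cutoff [NeZero d] (φ : 𝓢(Vec d, ℂ)) {r : ℝ} (hr : 1 < r) {c : ℕ → ℝ}
    (hc0 : ∀ n, 0 < c n) (hc : Tendsto c atTop atTop) :
    Tendsto (fun n => eLpNorm (bandPass (cutoff d) (c n) (hc0 n) φ) (ENNReal.ofReal r) volume)
      atTop (𝓝 0) := by
  set A := (∫ x, ‖(𝓕⁻ (cutoff d) : 𝓢(Vec d, ℂ)) x‖) * ∫ x, ‖φ x‖ with hA
  set B : ℕ → ℝ := fun n => ∫ ξ, ‖cutoff d (c n • ξ)‖ * ‖(𝓕 φ : 𝓢(Vec d, ℂ)) ξ‖ with hB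
  have hB0 : Tendsto B atTop (𝓝 0) := tendsto_integral_cutoff (SchwartzMap.integrable _).norm hc
  -- Interpolation between a bounded `L^1` norm `A` and a sup norm `B n → 0`. The exponent `1 - 1/r`
  -- of `B n` is positive exactly because `r > 1`.
  have h1 : Tendsto (fun n => ENNReal.ofReal (B n ^ (1 - 1 / r) * A ^ (1 / r))) atTop (𝓝 0) := by
    have hpos : 0 < 1 - 1 / r := by
      rw [sub_pos, div_lt_one (by linarith)]; exact hr
    have := ((hB0.rpow_const (p := 1 - 1 / r) (Or.inr hpos.le)).mul_const (A ^ (1 / r)))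
    rw [Real.zero_rpow hpos.ne', zero_mul] at this
    simpa using ENNReal.tendsto_ofReal this
  refine tendsto_of_tendsto_of_tendsto_of_le_of_le tendsto_const_nhds h1 (fun _ => zero_le) fun n => ?_
  refine (eLpNorm_le_of_bound (SchwartzMap.integrable _)
    (fun x => norm_bandPass_le _ _ _ _ x) hr.le).trans (ENNReal.ofReal_le_ofReal ?_)
  have hBn : 0 ≤ B n := integral_nonneg fun _ => by positivity
  gcongr
  exact integral_norm_bandPass_le _ _ _ _

end Cutoff

/-! ### Integrability of `Λ^s φ` for `s > 0` -/

section FracLapL1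

variable {d : ℕ} [NeZero d]

lemma one_le_finrank_vec : 1 ≤ Module.finrank ℝ (Vec d) := by
  rw [finrank_euclideanSpace_fin]
  exact Nat.pos_of_ne_zero (NeZero.ne d)

lemma integrableOn_ball_rpow_norm {s : ℝ} (hs : -(d : ℝ) < s) (r : ℝ) :
    IntegrableOn (fun x : Vec d => ‖x‖ ^ s) (Metric.ball 0 r) := by
  refine integrableOn_ball_of_norm_le_rpow (C := 1) (α := -s) one_le_finrank_vec ?_ ?_ ?_
  · rw [finrank_euclideanSpace_fin]; linarith
  · refine Eventually.of_forall fun x => ?_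
    rw [neg_neg, one_mul, Real.norm_of_nonneg (by positivity)]
  · exact (measurable_norm.pow_const s).aestronglyMeasurable

lemma integrable_rpow_norm_mul_schwartz {s : ℝ} (hs : -(d : ℝ) < s) (φ : 𝓢(Vec d, ℂ)) :
    Integrable (fun ξ : Vec d => ‖ξ‖ ^ s * ‖φ ξ‖) := by
  have hm : AEStronglyMeasurable (fun ξ : Vec d => ‖ξ‖ ^ s * ‖φ ξ‖) volume :=
    (measurable_norm.pow_const s).aestronglyMeasurable.mul φ.continuous.norm.aestronglyMeasurable
  obtain ⟨C, hC⟩ : ∃ C, ∀ x, ‖φ x‖ ≤ C := ⟨_, fun x => φ.norm_le_seminorm ℝ x⟩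
  have h1 : IntegrableOn (fun ξ : Vec d => ‖ξ‖ ^ s * ‖φ ξ‖) (Metric.ball 0 1) := by
    refine Integrable.mono' ((integrableOn_ball_rpow_norm hs 1).mul_const C) hm.restrict
      (Eventually.of_forall fun x => ?_)
    rw [Real.norm_of_nonneg (by positivity)]
    gcongr
    exact hC x
  have h2 : IntegrableOn (fun ξ : Vec d => ‖ξ‖ ^ s * ‖φ ξ‖) (Metric.ball 0 1)ᶜ := by
    refine Integrable.mono' ((φ.integrable_pow_mul volume ⌈|s|⌉₊).integrableOn) hm.restrict ?_
    refine (ae_restrict_iff' Metric.isOpen_ball.measurableSet.compl).2 (Eventually.of_forall fun x hx => ?_)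
    rw [Real.norm_of_nonneg (by positivity)]
    have hx1 : 1 ≤ ‖x‖ := by simpa using hx
    gcongr
    rw [← Real.rpow_natCast]
    exact Real.rpow_le_rpow_of_exponent_le hx1 ((le_abs_self s).trans (Nat.le_ceil _))
  simpa using h1.union h2

lemma integrable_symbol_mul_schwartz {s : ℝ} (hs : -(d : ℝ) < s) (φ : 𝓢(Vec d, ℂ)) :
    Integrable (fun ξ : Vec d => (((2 * Real.pi * ‖ξ‖) ^ s : ℝ) : ℂ) * φ ξ) := by
  refine Integrable.mono' ((integrable_rpow_norm_mul_schwartz hs φ).const_mul ((2 * Real.pi) ^ s)) ?_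
    (Eventually.of_forall fun ξ => ?_)
  · refine AEStronglyMeasurable.mul ?_ φ.continuous.aestronglyMeasurable
    exact (Complex.measurable_ofReal.comp
      ((measurable_const.mul measurable_norm).pow_const s)).aestronglyMeasurable
  · rw [norm_mul, Complex.norm_real, Real.norm_of_nonneg (by positivity),
      Real.mul_rpow (by positivity) (norm_nonneg _), mul_assoc]

omit [NeZero d] in
lemma fracLap_bounded {s : ℝ} (φ : 𝓢(Vec d, ℂ)) :
    ∃ B, ∀ x, ‖fracLap s φ x‖ ≤ B := ⟨_, fun x => norm_fourierInv_le _ x⟩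

omit [NeZero d] in
lemma integrable_fourierChar_smul {h : Vec d → ℂ} (hh : Integrable h) (x : Vec d) :
    Integrable (fun ξ => Real.fourierChar (inner ℝ ξ x) • h ξ) := by
  have := (VectorFourier.fourierIntegral_convergent_iff (μ := (volume : Measure (Vec d)))
    (L := innerₗ (Vec d)) Real.continuous_fourierChar continuous_inner (f := h) (-x)).2 hh
  simpa using this

omit [NeZero d] in
lemma continuous_fourierInv {f : Vec d → ℂ} (hf : Integrable f) : Continuous (𝓕⁻ f) := by
  have h := VectorFourier.fourierIntegral_continuous (μ := (volume : Measure (Vec d)))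
    (L := innerₗ (Vec d)) (f := f) Real.continuous_fourierChar continuous_inner hf
  have h2 : (𝓕⁻ f : Vec d → ℂ) = fun x => VectorFourier.fourierIntegral Real.fourierChar volume (innerₗ (Vec d)) f (-x) := by
    funext x
    rw [Real.fourierInv_eq_fourier_neg]
    rfl
  rw [h2]
  exact h.comp continuous_neg

lemma continuous_fracLap {s : ℝ} (hs : -(d : ℝ) < s) (φ : 𝓢(Vec d, ℂ)) :
    Continuous (fracLap s φ) := by
  refine continuous_fourierInv ?_
  have := integrable_symbol_mul_schwartz hs (𝓕 φ)
  simpa only [SchwartzMap.fourier_coe] using this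

omit [NeZero d] in
lemma rpow_two_pi_norm_smul {c : ℝ} (hc : 0 < c) (s : ℝ) (ξ : Vec d) :
    (2 * Real.pi * ‖c • ξ‖) ^ s = c ^ s * (2 * Real.pi * ‖ξ‖) ^ s := by
  rw [norm_smul, Real.norm_of_nonneg hc.le,
    show 2 * Real.pi * (c * ‖ξ‖) = c * (2 * Real.pi * ‖ξ‖) by ring,
    Real.mul_rpow hc.le (by positivity)]

/-- The annular cutoff `ζ - ζ(2 ·)`. -/
def annulus (d : ℕ) : 𝓢(Vec d, ℂ) := cutoff d - dil 2 two_pos (cutoff d)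

omit [NeZero d] in
lemma isFlat_annulus : IsFlat (annulus d) := by
  refine isFlat_of_schwartz _ fun n => iteratedFDeriv_eq_zero_of_near (δ := 1 / 2) (by norm_num) ?_ n
  intro ξ hξ
  rw [annulus, sub_apply, dil_apply, cutoff_eq_one, cutoff_eq_one, sub_self]
  · rw [norm_smul, Real.norm_of_nonneg zero_le_two]; linarith
  · linarith

/-- `(2π|ξ|)^s (ζ(ξ) - ζ(2ξ))`. -/
def annulusPow (d : ℕ) [NeZero d] (s : ℝ) : 𝓢(Vec d, ℂ) :=
  ((isFlat_annulus (d := d)).symbol_mul (isPowerSymbol_rpow s)).toSchwartz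

/-- The two cutoffs differ by the annulus at frequencies of size `1 / c`, and there `(2π|ξ|)^s =
c^{-s} (2π|cξ|)^s`. Every dyadic piece is thus `c^{-s}` times a dilate of one fixed smooth
multiplier. -/
lemma highPass_two_mul_sub (φ : 𝓢(Vec d, ℂ)) {c : ℝ} (hc : 0 < c) (hc' : 0 < 2 * c) (s : ℝ) :
    lapS0 s (highPass (2 * c) hc' φ) - lapS0 s (highPass c hc φ) =
      ((c ^ (-s) : ℝ) : ℂ) • bandPass (annulusPow d s) c hc φ := by
  refine schwartz_ext_fourier fun ξ => ?_
  have h1 := FourierTransform.fourierCLM_apply (R := ℂ) (E := 𝓢(Vec d, ℂ))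
    (lapS0 s (highPass (2 * c) hc' φ) - lapS0 s (highPass c hc φ))
  have h2 := FourierTransform.fourierCLM_apply (R := ℂ) (E := 𝓢(Vec d, ℂ))
    (((c ^ (-s) : ℝ) : ℂ) • bandPass (annulusPow d s) c hc φ)
  rw [← h1, ← h2, map_sub, map_smul]
  simp only [FourierTransform.fourierCLM_apply, sub_apply, smul_apply, smul_eq_mul]
  rw [fourier_lapS0 s (memS0_highPass _ _ _), fourier_lapS0 s (memS0_highPass _ _ _),
    fourier_highPass, fourier_highPass, fourier_bandPass]
  have h3 : annulusPow d s (c • ξ) =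
      ((c ^ s * (2 * Real.pi * ‖ξ‖) ^ s : ℝ) : ℂ) * (cutoff d (c • ξ) - cutoff d ((2 * c) • ξ)) := by
    rw [← rpow_two_pi_norm_smul hc, mul_smul]
    rfl
  rw [h3, Real.rpow_neg hc.le]
  have : (c : ℝ) ^ s ≠ 0 := (Real.rpow_pos_of_pos hc s).ne'
  push_cast
  have h4 : ((c ^ s : ℝ) : ℂ) ≠ 0 := by exact_mod_cast this
  field_simp
  ring

lemma tendsto_lapS0_highPass {s : ℝ} (hs : -(d : ℝ) < s) (φ : 𝓢(Vec d, ℂ)) {c : ℕ → ℝ}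
    (hc0 : ∀ n, 0 < c n) (hc : Tendsto c atTop atTop) (x : Vec d) :
    Tendsto (fun n => lapS0 s (highPass (c n) (hc0 n) φ) x) atTop (𝓝 (fracLap s φ x)) := by
  rw [tendsto_iff_norm_sub_tendsto_zero]
  have h0 := integrable_symbol_mul_schwartz hs (𝓕 φ)
  have h1 := tendsto_integral_cutoff h0.norm hc
  refine squeeze_zero (fun _ => norm_nonneg _) (fun n => ?_) h1
  have h2 := integrable_symbol_mul_schwartz hs (𝓕 (highPass (c n) (hc0 n) φ))
  rw [← fracLap_eq_lapS0 s (memS0_highPass _ _ _), fracLap, fracLap, ← SchwartzMap.fourier_coe, ← SchwartzMap.fourier_coe]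
  rw [Real.fourierInv_eq, Real.fourierInv_eq, ← integral_sub]
  · refine (norm_integral_le_integral_norm _).trans (le_of_eq ?_)
    congr 1
    funext ξ
    rw [← smul_sub, Circle.norm_smul, fourier_highPass, ← norm_mul, ← norm_neg]
    congr 1
    ring
  · exact integrable_fourierChar_smul h2 x
  · exact integrable_fourierChar_smul h0 x

/-- `Λ^s` of a Schwartz function is integrable if `s > 0`. -/
lemma integrable_fracLap {s : ℝ} (hs : 0 < s) (φ : 𝓢(Vec d, ℂ)) : Integrable (fracLap s φ) := by
  have hsd : -(d : ℝ) < s := (neg_nonpos.2 (Nat.cast_nonneg d)).trans_lt hs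
  set c : ℕ → ℝ := fun n => 2 ^ n with hc
  have hc0 : ∀ n, 0 < c n := fun n => by positivity
  have hct : Tendsto c atTop atTop := tendsto_pow_atTop_atTop_of_one_lt one_lt_two
  set f : ℕ → 𝓢(Vec d, ℂ) := fun n => lapS0 s (highPass (c n) (hc0 n) φ) with hf
  set K := (∫ x, ‖(𝓕⁻ (annulusPow d s) : 𝓢(Vec d, ℂ)) x‖) * ∫ x, ‖φ x‖ with hK
  have hK0 : 0 ≤ K := by positivity
  -- The `n`-th dyadic piece has `L^1` norm at most `ρ ^ n * K`. The series converges because `s >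
  -- 0`.
  set ρ : ℝ := 2 ^ (-s) with hρ
  have hρ0 : 0 ≤ ρ := by positivity
  have hρ1 : ρ < 1 := Real.rpow_lt_one_of_one_lt_of_neg one_lt_two (by linarith)
  have hstep : ∀ n, ∫ x, ‖f (n + 1) x‖ ≤ (∫ x, ‖f n x‖) + ρ ^ n * K := fun n => by
    have h2 : f (n + 1) - f n = (((c n) ^ (-s) : ℝ) : ℂ) • bandPass (annulusPow d s) (c n) (hc0 n) φ := by
      rw [← highPass_two_mul_sub φ (hc0 n) (by have := hc0 n; positivity) s]
      simp only [hf, hc, pow_succ']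
    have h3 : (c n) ^ (-s) = ρ ^ n := by
      simp only [hc, hρ]
      rw [← Real.rpow_natCast, ← Real.rpow_natCast, ← Real.rpow_mul zero_le_two, ← Real.rpow_mul zero_le_two]
      ring_nf
    have h4 : ∀ x, ‖f (n + 1) x‖ ≤ ‖f n x‖ + ρ ^ n * ‖bandPass (annulusPow d s) (c n) (hc0 n) φ x‖ := fun x => by
      have h5 : f (n + 1) x = f n x + (f (n + 1) - f n) x := by rw [sub_apply]; ring
      rw [h5, h2, smul_apply, h3]
      refine (norm_add_le _ _).trans (le_of_eq ?_)
      rw [norm_smul, Complex.norm_real, Real.norm_of_nonneg (by positivity)]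
    refine (integral_mono (f n.succ).integrable.norm ((f n).integrable.norm.add
      (((SchwartzMap.integrable _).norm.const_mul (ρ ^ n)))) h4).trans ?_
    simp only [Pi.add_apply]
    rw [integral_add (f n).integrable.norm ((SchwartzMap.integrable _).norm.const_mul (ρ ^ n)), integral_const_mul]
    gcongr
    exact integral_norm_bandPass_le _ _ _ _
  have hbound : ∀ n, ∫ x, ‖f n x‖ ≤ (∫ x, ‖f 0 x‖) + (1 - ρ)⁻¹ * K := fun n => by
    have h1 : ∀ n, ∫ x, ‖f n x‖ ≤ (∫ x, ‖f 0 x‖) + (∑ i ∈ Finset.range n, ρ ^ i) * K := fun n => by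
      induction n with
      | zero => simp
      | succ n ih => rw [Finset.sum_range_succ, add_mul]; linarith [hstep n]
    refine (h1 n).trans ?_
    gcongr
    rw [← tsum_geometric_of_lt_one hρ0 hρ1]
    exact (summable_geometric_of_lt_one hρ0 hρ1).sum_le_tsum _ fun i _ => by positivity
  rw [← memLp_one_iff_integrable]
  refine ⟨(continuous_fracLap hsd φ).aestronglyMeasurable, ?_⟩
  -- Fatou's lemma: `f n` converges pointwise to `Λ^s φ` and is bounded in `L^1`.
  refine (Lp.eLpNorm_lim_le_liminf_eLpNorm (f := fun n => f n) (p := 1)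
    (fun n => (f n).continuous.aestronglyMeasurable) (fracLap s φ)
    (Eventually.of_forall fun x => tendsto_lapS0_highPass hsd φ hc0 hct x)).trans_lt ?_
  refine lt_of_le_of_lt (b := ENNReal.ofReal ((∫ x, ‖f 0 x‖) + (1 - ρ)⁻¹ * K)) ?_ ENNReal.ofReal_lt_top
  refine liminf_le_of_le (by isBoundedDefault) fun b hb => ?_
  obtain ⟨n, hn⟩ := hb.exists
  refine hn.trans ?_
  rw [eLpNorm_one_eq_lintegral_enorm, ← ofReal_integral_norm_eq_lintegral_enorm (f n).integrable]
  exact ENNReal.ofReal_le_ofReal (hbound n)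

end FracLapL1

/-! ### The Hardy-Littlewood maximal theorem -/

section Maximal

variable {d : ℕ} [NeZero d]

/-- The volume of a ball of radius `r`. -/
def ballVol (d : ℕ) (r : ℝ) : ℝ≥0∞ := volume (Metric.closedBall (0 : Vec d) r)

omit [NeZero d] in
lemma ballVol_eq {r : ℝ} (hr : 0 ≤ r) :
    ballVol d r = ENNReal.ofReal (r ^ d) * ballVol d 1 := by
  rw [ballVol, ballVol, Measure.addHaar_closedBall' _ _ hr, finrank_euclideanSpace_fin]

omit [NeZero d] in
lemma ballVol_pos {r : ℝ} (hr : 0 < r) : ballVol d r ≠ 0 :=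
  (Metric.measure_closedBall_pos _ _ hr).ne'

omit [NeZero d] in
lemma ballVol_ne_top (r : ℝ) : ballVol d r ≠ ⊤ := measure_closedBall_lt_top.ne

omit [NeZero d] in
lemma volume_closedBall_eq_ballVol (x : Vec d) (r : ℝ) :
    volume (Metric.closedBall x r) = ballVol d r :=
  Measure.addHaar_closedBall_center _ _ _

/-- The Hardy-Littlewood maximal function. -/
def maxFn (f : Vec d → ℝ≥0∞) (x : Vec d) : ℝ≥0∞ :=
  ⨆ r : {r : ℝ // 0 < r}, (ballVol d r)⁻¹ * ∫⁻ y in Metric.closedBall x r, f y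

omit [NeZero d] in
lemma lintegral_closedBall_le_maxFn (f : Vec d → ℝ≥0∞) (x : Vec d) {r : ℝ} (hr : 0 < r) :
    ∫⁻ y in Metric.closedBall x r, f y ≤ ballVol d r * maxFn f x := by
  have h := le_iSup (fun r : {r : ℝ // 0 < r} =>
    (ballVol d r)⁻¹ * ∫⁻ y in Metric.closedBall x r, f y) ⟨r, hr⟩
  calc ∫⁻ y in Metric.closedBall x r, f y
      = ballVol d r * ((ballVol d r)⁻¹ * ∫⁻ y in Metric.closedBall x r, f y) := by
        rw [← mul_assoc, ENNReal.mul_inv_cancel (ballVol_pos hr) (ballVol_ne_top r), one_mul]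
    _ ≤ _ := by gcongr; exact h

/-- The weak type `(1,1)` bound for the maximal function. -/
lemma volume_lt_maxFn_le (f : Vec d → ℝ≥0∞) {t : ℝ≥0∞} (ht : t ≠ 0) (ht' : t ≠ ⊤) :
    volume {x | t < maxFn f x} ≤ 5 ^ d * (t⁻¹ * ∫⁻ y, f y) := by
  rcases eq_or_ne (∫⁻ y, f y) ⊤ with hI | hI
  · rw [hI, ENNReal.mul_top (ENNReal.inv_ne_zero.2 ht'), ENNReal.mul_top (by simp)]
    exact le_top
  have h1 : ∀ x ∈ {x | t < maxFn f x}, ∃ r : ℝ, 0 < r ∧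
      t * ballVol d r < ∫⁻ y in Metric.closedBall x r, f y := fun x hx => by
    obtain ⟨⟨r, hr⟩, h⟩ := lt_iSup_iff.1 (show t < maxFn f x from hx)
    refine ⟨r, hr, ?_⟩
    rw [← ENNReal.div_eq_inv_mul] at h
    exact (ENNReal.lt_div_iff_mul_lt (Or.inl (ballVol_pos hr)) (Or.inl (ballVol_ne_top r))).1 h
  choose! r hr0 hr using h1
  -- The covering lemma needs bounded radii. They are bounded because `t` times the volume of each
  -- selected ball is below the finite integral of `f`.
  obtain ⟨R, hR⟩ : ∃ R : ℝ, ∀ x ∈ {x | t < maxFn f x}, r x ≤ R := by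
    have hc : t * ballVol d 1 ≠ 0 := mul_ne_zero ht (ballVol_pos one_pos)
    have hc' : t * ballVol d 1 ≠ ⊤ := ENNReal.mul_ne_top ht' (ballVol_ne_top 1)
    refine ⟨max 1 ((∫⁻ y, f y) / (t * ballVol d 1)).toReal, fun x hx => ?_⟩
    rcases le_total (r x) 1 with h | h
    · exact h.trans (le_max_left _ _)
    · refine le_trans ?_ (le_max_right _ _)
      have h2 : ENNReal.ofReal (r x ^ d) * (t * ballVol d 1) ≤ ∫⁻ y, f y := by
        have := (hr x hx).le.trans (setLIntegral_le_lintegral _ _)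
        rwa [ballVol_eq (hr0 x hx).le, mul_left_comm] at this
      rw [← ENNReal.le_div_iff_mul_le (Or.inl hc) (Or.inl hc')] at h2
      have h3 := (ENNReal.ofReal_le_iff_le_toReal (ENNReal.div_ne_top hI hc)).1 h2
      exact (le_self_pow₀ h (NeZero.ne d)).trans h3
  -- Vitali: disjoint balls whose fivefold enlargements cover; this is the origin of `5 ^ d`.
  obtain ⟨u, hu, hdisj, hcov⟩ := Vitali.exists_disjoint_subfamily_covering_enlargement_closedBall
    {x | t < maxFn f x} (fun x : Vec d => x) r R hR 5 (by norm_num)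
  have hcount : u.Countable := hdisj.countable_of_nonempty_interior fun x hx =>
    (Metric.nonempty_ball.2 (hr0 x (hu hx))).mono Metric.ball_subset_interior_closedBall
  have hsub : {x | t < maxFn f x} ⊆ ⋃ y ∈ u, Metric.closedBall y (5 * r y) := fun x hx => by
    obtain ⟨y, hy, h⟩ := hcov x hx
    exact Set.mem_biUnion hy (h (Metric.mem_closedBall_self (hr0 x hx).le))
  have : Countable u := hcount.to_subtype
  calc volume {x | t < maxFn f x}
      ≤ volume (⋃ y ∈ u, Metric.closedBall y (5 * r y)) := measure_mono hsub
    _ ≤ ∑' y : u, volume (Metric.closedBall (y : Vec d) (5 * r y)) := measure_biUnion_le _ hcount _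
    _ ≤ ∑' y : u, 5 ^ d * (t⁻¹ * ∫⁻ z in Metric.closedBall (y : Vec d) (r y), f z) := by
        refine ENNReal.tsum_le_tsum fun y => ?_
        have hy := hr0 y (hu y.2)
        rw [volume_closedBall_eq_ballVol, ballVol_eq (by positivity), mul_pow,
          ENNReal.ofReal_mul (by positivity), mul_assoc, ← ballVol_eq hy.le,
          ENNReal.ofReal_pow (by norm_num), ENNReal.ofReal_ofNat]
        gcongr
        rw [← ENNReal.div_eq_inv_mul, ENNReal.le_div_iff_mul_le (Or.inl ht) (Or.inl ht'), mul_comm]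
        exact (hr y (hu y.2)).le
    _ = 5 ^ d * (t⁻¹ * ∫⁻ z in ⋃ y ∈ u, Metric.closedBall y (r y), f z) := by
        rw [ENNReal.tsum_mul_left, ENNReal.tsum_mul_left,
          lintegral_biUnion hcount (fun _ _ => measurableSet_closedBall) hdisj]
    _ ≤ _ := by gcongr; exact Measure.restrict_le_self

-- The part of `f` not exceeding `t` has averages at most `t`, so only the truncation of `f` above
-- `t` matters at heights beyond `t`.
omit [NeZero d] in
lemma maxFn_le_add {f : Vec d → ℝ≥0∞} (hf : Measurable f) (t : ℝ≥0∞) (x : Vec d) :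
    maxFn f x ≤ maxFn ({y | t < f y}.indicator f) x + t := by
  refine iSup_le fun ⟨r, hr⟩ => ?_
  have hm : MeasurableSet {y | t < f y} := measurableSet_lt measurable_const hf
  have h1 : ∫⁻ y in Metric.closedBall x r, f y ≤
      (∫⁻ y in Metric.closedBall x r, {y | t < f y}.indicator f y) + t * ballVol d r := by
    rw [← volume_closedBall_eq_ballVol x r, ← setLIntegral_const, ← lintegral_add_left (hf.indicator hm)]
    refine lintegral_mono fun y => ?_
    by_cases h : y ∈ {y | t < f y}
    · simp [h]
    · simp only [Set.indicator_of_notMem h, zero_add]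
      simpa using h
  calc (ballVol d r)⁻¹ * ∫⁻ y in Metric.closedBall x r, f y
      ≤ (ballVol d r)⁻¹ * ((∫⁻ y in Metric.closedBall x r, {y | t < f y}.indicator f y) + t * ballVol d r) := by
        gcongr
    _ = (ballVol d r)⁻¹ * (∫⁻ y in Metric.closedBall x r, {y | t < f y}.indicator f y) + t := by
        rw [mul_add, mul_comm t, ← mul_assoc (ballVol d r)⁻¹, ENNReal.inv_mul_cancel (ballVol_pos hr) (ballVol_ne_top r), one_mul]
    _ ≤ _ := by
        gcongr
        exact le_iSup (fun r : {r : ℝ // 0 < r} =>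
          (ballVol d r)⁻¹ * ∫⁻ y in Metric.closedBall x r, {y | t < f y}.indicator f y) ⟨r, hr⟩

/-- Half of the height `t` is spent on the bounded part of `f`; the weak bound at height `t / 2` is
applied to the rest. This is the truncation in Marcinkiewicz interpolation. -/
lemma volume_lt_maxFn_le_truncated {f : Vec d → ℝ≥0∞} (hf : Measurable f) {t : ℝ} (ht : 0 < t) :
    volume {x | ENNReal.ofReal t < maxFn f x} ≤
      5 ^ d * ((ENNReal.ofReal (t / 2))⁻¹ * ∫⁻ y, {y | ENNReal.ofReal (t / 2) < f y}.indicator f y) := by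
  refine (measure_mono fun x hx => ?_).trans
    (volume_lt_maxFn_le _ (by simpa using ht) ENNReal.ofReal_ne_top)
  have h1 := (show ENNReal.ofReal t < maxFn f x from hx).trans_le (maxFn_le_add hf (ENNReal.ofReal (t / 2)) x)
  rw [show t = t / 2 + t / 2 by ring, ENNReal.ofReal_add (by positivity) (by positivity)] at h1
  simp only [add_halves] at h1
  exact lt_of_add_lt_add_right h1

/-- The inner integral left by Tonelli in the layer-cake formula: `∫_0^{2a} t^{p-2} dt = (2a)^{p-1}
/ (p-1)`, finite because `p > 1`. -/
lemma lintegral_Ioi_rpow_indicator_le {p : ℝ} (hp : 1 < p) (a : ℝ≥0∞) :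
    ∫⁻ t in Set.Ioi (0 : ℝ), (if ENNReal.ofReal (t / 2) < a then 1 else 0) *
      ENNReal.ofReal (t ^ (p - 2)) * a ≤ ENNReal.ofReal (2 ^ (p - 1) / (p - 1)) * a ^ p := by
  rcases eq_or_ne a ⊤ with rfl | ha
  · rw [ENNReal.top_rpow_of_pos (by linarith), ENNReal.mul_top]
    · exact le_top
    · have : 0 < 2 ^ (p - 1) / (p - 1) := div_pos (by positivity) (by linarith)
      simpa using this
  rw [lintegral_mul_const' _ _ ha]
  lift a to ℝ≥0 using ha
  have h1 : ∀ t ∈ Set.Ioi (0 : ℝ), (if ENNReal.ofReal (t / 2) < (a : ℝ≥0∞) then (1 : ℝ≥0∞) else 0) *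
      ENNReal.ofReal (t ^ (p - 2)) ≤
      (Set.Ioc (0 : ℝ) (2 * a)).indicator (fun t => ENNReal.ofReal (t ^ (p - 2))) t := fun t ht => by
    split_ifs with h
    · have : t ∈ Set.Ioc (0 : ℝ) (2 * a) := by
        refine ⟨ht, ?_⟩
        rw [← ENNReal.ofReal_coe_nnreal] at h
        have := (ENNReal.ofReal_lt_ofReal_iff_of_nonneg (by have : (0 : ℝ) < t := ht; positivity)).1 h
        linarith
      simp [this]
    · simp
  have h2 : ∫⁻ t in Set.Ioi (0 : ℝ), (if ENNReal.ofReal (t / 2) < (a : ℝ≥0∞) then (1 : ℝ≥0∞) else 0) *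
      ENNReal.ofReal (t ^ (p - 2)) ≤ ENNReal.ofReal ((2 * a) ^ (p - 1) / (p - 1)) := by
    refine (setLIntegral_mono' measurableSet_Ioi h1).trans ?_
    rw [lintegral_indicator measurableSet_Ioc, Measure.restrict_restrict measurableSet_Ioc,
      Set.inter_eq_left.2 Set.Ioc_subset_Ioi_self]
    have hi : IntervalIntegrable (fun t : ℝ => t ^ (p - 2)) volume 0 (2 * a) :=
      intervalIntegral.intervalIntegrable_rpow' (by linarith)
    rw [← ofReal_integral_eq_lintegral_ofReal ((intervalIntegrable_iff_integrableOn_Ioc_of_le (by positivity)).1 hi)]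
    · rw [← intervalIntegral.integral_of_le (by positivity), integral_rpow (Or.inl (by linarith)),
        show p - 2 + 1 = p - 1 by ring, Real.zero_rpow (by linarith), sub_zero]
    · refine (ae_restrict_iff' measurableSet_Ioc).2 (Eventually.of_forall fun t ht => ?_)
      have := ht.1.le
      positivity
  refine (mul_le_mul_left h2 _).trans (le_of_eq ?_)
  have h3 : (a : ℝ≥0∞) ^ p = ENNReal.ofReal ((a : ℝ) ^ p) := by
    rw [← ENNReal.ofReal_rpow_of_nonneg a.coe_nonneg (by linarith), ENNReal.ofReal_coe_nnreal]
  conv_lhs => rw [← ENNReal.ofReal_coe_nnreal (p := a)]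
  have hp1 : 0 < p - 1 := by linarith
  rw [h3, ← ENNReal.ofReal_mul (by positivity), ← ENNReal.ofReal_mul (by positivity),
    Real.mul_rpow zero_le_two a.coe_nonneg]
  congr 1
  have : (a : ℝ) ^ p = (a : ℝ) ^ (p - 1) * a := by
    conv_lhs => rw [show p = p - 1 + 1 by ring]
    rw [Real.rpow_add_of_nonneg a.coe_nonneg (by linarith) zero_le_one, Real.rpow_one]
  rw [this]
  ring

/-- The maximal function is bounded on `L^p` for `p > 1`. -/
lemma lintegral_maxFn_rpow_le {p : ℝ} (hp : 1 < p) : ∃ C : ℝ≥0∞, C ≠ ⊤ ∧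
    ∀ f : Vec d → ℝ≥0∞, Measurable f → ∫⁻ x, maxFn f x ^ p ≤ C * ∫⁻ x, f x ^ p := by
  refine ⟨ENNReal.ofReal p * (5 ^ d * 2 * ENNReal.ofReal (2 ^ (p - 1) / (p - 1))), by finiteness, fun f hf => ?_⟩
  have hp0 : 0 < p := by linarith
  -- Measurability of the maximal function is bypassed: its integral is a supremum over simple
  -- functions `φ ≤ (maxFn f) ^ p`, and the layer-cake formula is applied to `g = φ ^ (1 / p)`,
  -- which is measurable and lies below `maxFn f`.
  rw [lintegral_eq_nnreal]
  refine iSup₂_le fun φ hφ => ?_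
  rw [← SimpleFunc.lintegral_eq_lintegral]
  set g : Vec d → ℝ := fun x => ((φ x : ℝ)) ^ (1 / p) with hg
  have hgm : Measurable g := (measurable_coe_nnreal_real.comp φ.measurable).pow_const _
  have h1 : ∫⁻ x, (φ.map ((↑) : ℝ≥0 → ℝ≥0∞)) x = ∫⁻ x, ENNReal.ofReal (g x ^ p) := by
    refine lintegral_congr fun x => ?_
    rw [hg, SimpleFunc.map_apply]
    simp only
    rw [← Real.rpow_mul (φ x).coe_nonneg, one_div, inv_mul_cancel₀ hp0.ne', Real.rpow_one, ENNReal.ofReal_coe_nnreal]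
  have h2 : ∀ x, ENNReal.ofReal (g x) ≤ maxFn f x := fun x => by
    have := ENNReal.rpow_le_rpow (hφ x) (show 0 ≤ 1 / p by positivity)
    rw [← ENNReal.rpow_mul, mul_one_div_cancel hp0.ne', ENNReal.rpow_one] at this
    refine le_trans (le_of_eq ?_) this
    simp only [hg]
    rw [← ENNReal.ofReal_rpow_of_nonneg (φ x).coe_nonneg (by positivity), ENNReal.ofReal_coe_nnreal]
  rw [h1, lintegral_rpow_eq_lintegral_meas_lt_mul volume
    (Eventually.of_forall fun x => by simp only [hg]; positivity) hgm.aemeasurable hp0, mul_assoc]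
  gcongr
  have h3 : ∀ t ∈ Set.Ioi (0 : ℝ), volume {x | t < g x} * ENNReal.ofReal (t ^ (p - 1)) ≤
      5 ^ d * 2 * ∫⁻ y, (if ENNReal.ofReal (t / 2) < f y then 1 else 0) * ENNReal.ofReal (t ^ (p - 2)) * f y := by
    intro t ht
    have ht0 : (0 : ℝ) < t := ht
    have h4 : volume {x | t < g x} ≤ volume {x | ENNReal.ofReal t < maxFn f x} :=
      measure_mono fun x hx => lt_of_lt_of_le
        ((ENNReal.ofReal_lt_ofReal_iff_of_nonneg ht0.le).2 hx) (h2 x)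
    have h5 : ∫⁻ y, {y | ENNReal.ofReal (t / 2) < f y}.indicator f y =
        ∫⁻ y, (if ENNReal.ofReal (t / 2) < f y then 1 else 0) * f y := by
      refine lintegral_congr fun y => ?_
      by_cases h : ENNReal.ofReal (t / 2) < f y <;> simp [h]
    have h6 : (ENNReal.ofReal (t / 2))⁻¹ * ENNReal.ofReal (t ^ (p - 1)) = 2 * ENNReal.ofReal (t ^ (p - 2)) := by
      rw [← ENNReal.ofReal_inv_of_pos (by positivity), ← ENNReal.ofReal_mul (by positivity),
        ← ENNReal.ofReal_ofNat, ← ENNReal.ofReal_mul (by positivity)]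
      congr 1
      rw [show p - 1 = p - 2 + 1 by ring, Real.rpow_add ht0, Real.rpow_one]
      field_simp
    calc volume {x | t < g x} * ENNReal.ofReal (t ^ (p - 1))
        ≤ 5 ^ d * ((ENNReal.ofReal (t / 2))⁻¹ *
            ∫⁻ y, {y | ENNReal.ofReal (t / 2) < f y}.indicator f y) * ENNReal.ofReal (t ^ (p - 1)) := by
          gcongr
          exact h4.trans (volume_lt_maxFn_le_truncated hf ht0)
      _ = 5 ^ d * 2 * (ENNReal.ofReal (t ^ (p - 2)) * ∫⁻ y, (if ENNReal.ofReal (t / 2) < f y then 1 else 0) * f y) := by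
          rw [h5, mul_assoc (5 ^ d : ℝ≥0∞) 2, ← mul_assoc (2 : ℝ≥0∞), ← h6]
          ring
      _ = _ := by
          rw [← lintegral_const_mul' _ _ ENNReal.ofReal_ne_top]
          congr 2
          funext y
          ring
  refine (setLIntegral_mono' measurableSet_Ioi h3).trans ?_
  rw [lintegral_const_mul' _ _ (by finiteness), mul_assoc (5 ^ d * 2 : ℝ≥0∞)]
  gcongr
  have hmeas : Measurable (Function.uncurry fun (t : ℝ) (y : Vec d) =>
      (if ENNReal.ofReal (t / 2) < f y then (1 : ℝ≥0∞) else 0) * ENNReal.ofReal (t ^ (p - 2)) * f y) := by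
    refine ((Measurable.ite (measurableSet_lt ?_ ?_) measurable_const measurable_const).mul ?_).mul ?_
    · exact ENNReal.measurable_ofReal.comp (measurable_fst.div_const 2)
    · exact hf.comp measurable_snd
    · exact ENNReal.measurable_ofReal.comp (measurable_fst.pow_const _)
    · exact hf.comp measurable_snd
  rw [lintegral_lintegral_swap hmeas.aemeasurable, ← lintegral_const_mul' _ _ (by finiteness)]
  exact lintegral_mono fun y => lintegral_Ioi_rpow_indicator_le hp (f y)

end Maximal

/-! ### Riesz potentials and the Hardy-Littlewood-Sobolev inequality -/

section HLS

variable {d : ℕ} [NeZero d]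

/-- The Riesz potential, up to its constant. -/
def rieszPot (γ : ℝ) (f : Vec d → ℝ≥0∞) (x : Vec d) : ℝ≥0∞ :=
  ∫⁻ y, ENNReal.ofReal (‖x - y‖ ^ (γ - d)) * f y

lemma setLIntegral_Ioi_rpow {a R : ℝ} (ha : a < 0) (hR : 0 < R) :
    ∫⁻ r in Set.Ioi R, ENNReal.ofReal (r ^ (a - 1)) = ENNReal.ofReal (R ^ a / (-a)) := by
  rw [← ofReal_integral_eq_lintegral_ofReal (integrableOn_Ioi_rpow_of_lt (by linarith) hR)]
  · rw [integral_Ioi_rpow_of_lt (by linarith) hR, sub_add_cancel, neg_div, div_neg]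
  · refine (ae_restrict_iff' measurableSet_Ioi).2 (Eventually.of_forall fun t ht => ?_)
    have := hR.trans ht
    positivity

lemma setLIntegral_Ioc_rpow {a R : ℝ} (ha : 0 < a) (hR : 0 < R) :
    ∫⁻ r in Set.Ioc 0 R, ENNReal.ofReal (r ^ (a - 1)) = ENNReal.ofReal (R ^ a / a) := by
  have hi : IntervalIntegrable (fun t : ℝ => t ^ (a - 1)) volume 0 R :=
    intervalIntegral.intervalIntegrable_rpow' (by linarith)
  rw [← ofReal_integral_eq_lintegral_ofReal ((intervalIntegrable_iff_integrableOn_Ioc_of_le hR.le).1 hi)]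
  · rw [← intervalIntegral.integral_of_le hR.le, integral_rpow (Or.inl (by linarith)),
      sub_add_cancel, Real.zero_rpow ha.ne', sub_zero]
  · refine (ae_restrict_iff' measurableSet_Ioc).2 (Eventually.of_forall fun t ht => ?_)
    have := ht.1
    positivity

-- Since `|x-y|^{γ-d} = (d-γ) ∫_{|x-y|}^∞ r^{γ-d-1} dr`, Tonelli writes the potential as a
-- superposition of integrals over balls centred at `x`.
omit [NeZero d] in
lemma rieszPot_le_lintegral_balls {γ : ℝ} (hγd : γ < d) {f : Vec d → ℝ≥0∞} (hf : Measurable f)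
    (x : Vec d) : rieszPot γ f x ≤ ENNReal.ofReal (d - γ) * ∫⁻ r in Set.Ioi (0 : ℝ),
      ENNReal.ofReal (r ^ (γ - d - 1)) * ∫⁻ y in Metric.closedBall x r, f y := by
  have h1 : ∀ y, ENNReal.ofReal (‖x - y‖ ^ (γ - d)) * f y ≤
      ENNReal.ofReal (d - γ) * ∫⁻ r in Set.Ioi (0 : ℝ), ENNReal.ofReal (r ^ (γ - d - 1)) *
        (Metric.closedBall x r).indicator f y := fun y => by
    rcases eq_or_ne x y with rfl | hxy
    -- On the diagonal the real power `0 ^ (γ - d)` is `0` by convention, as the exponent is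
    -- nonzero.
    · rw [sub_self, norm_zero, Real.zero_rpow (by linarith), ENNReal.ofReal_zero, zero_mul]
      exact zero_le
    have hR : 0 < ‖x - y‖ := norm_pos_iff.2 (sub_ne_zero.2 hxy)
    calc ENNReal.ofReal (‖x - y‖ ^ (γ - d)) * f y
        = ENNReal.ofReal (d - γ) * (∫⁻ r in Set.Ioi ‖x - y‖, ENNReal.ofReal (r ^ (γ - d - 1))) * f y := by
          rw [setLIntegral_Ioi_rpow (by linarith) hR, ← ENNReal.ofReal_mul (by linarith)]
          congr 2
          rw [neg_sub, mul_div_cancel₀ _ (by linarith)]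
      _ = ENNReal.ofReal (d - γ) * ∫⁻ r in Set.Ioi ‖x - y‖, ENNReal.ofReal (r ^ (γ - d - 1)) * f y := by
          rw [mul_assoc, lintegral_mul_const]
          fun_prop
      _ ≤ ENNReal.ofReal (d - γ) * ∫⁻ r in Set.Ioi ‖x - y‖, ENNReal.ofReal (r ^ (γ - d - 1)) *
            (Metric.closedBall x r).indicator f y := by
          gcongr 1
          refine setLIntegral_mono' measurableSet_Ioi fun r hr => ?_
          rw [Set.indicator_of_mem]
          rw [Metric.mem_closedBall, dist_comm, dist_eq_norm]
          exact le_of_lt hr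
      _ ≤ _ := by
          gcongr 1
          exact lintegral_mono_set (Set.Ioi_subset_Ioi hR.le)
  refine (lintegral_mono h1).trans (le_of_eq ?_)
  rw [lintegral_const_mul' _ _ ENNReal.ofReal_ne_top]
  congr 1
  rw [lintegral_lintegral_swap]
  · refine lintegral_congr fun r => ?_
    rw [lintegral_const_mul' _ _ ENNReal.ofReal_ne_top, lintegral_indicator measurableSet_closedBall]
  · have hset : MeasurableSet {z : Vec d × ℝ | dist z.1 x ≤ z.2} :=
      measurableSet_le (by fun_prop) (by fun_prop)
    have : Measurable ({z : Vec d × ℝ | dist z.1 x ≤ z.2}.indicator fun z => f z.1) :=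
      (hf.comp measurable_fst).indicator hset
    have h2 : (Function.uncurry fun (y : Vec d) (r : ℝ) => ENNReal.ofReal (r ^ (γ - d - 1)) *
        (Metric.closedBall x r).indicator f y) = fun z : Vec d × ℝ => ENNReal.ofReal (z.2 ^ (γ - d - 1)) *
        {z : Vec d × ℝ | dist z.1 x ≤ z.2}.indicator (fun z => f z.1) z := by
      funext ⟨y, r⟩
      simp [Function.uncurry, Set.indicator]
    rw [h2]
    refine Measurable.aemeasurable (Measurable.mul ?_ this)
    exact ENNReal.measurable_ofReal.comp (measurable_snd.pow_const _)

omit [NeZero d] in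
lemma lintegral_closedBall_le_Lp {p : ℝ} (hp : 1 < p) {f : Vec d → ℝ≥0∞} (hf : Measurable f)
    (x : Vec d) {r : ℝ} (hr : 0 < r) :
    ∫⁻ y in Metric.closedBall x r, f y ≤ (∫⁻ y, f y ^ p) ^ (1 / p) *
      (ENNReal.ofReal (r ^ (d - d / p)) * ballVol d 1 ^ (1 - 1 / p)) := by
  have hpq := Real.HolderConjugate.conjExponent hp
  have h1 := ENNReal.lintegral_mul_le_Lp_mul_Lq (volume.restrict (Metric.closedBall x r)) hpq
    hf.aemeasurable (g := fun _ => 1) aemeasurable_const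
  have h2 : 1 / Real.conjExponent p = 1 - 1 / p := by
    have := hpq.inv_add_inv_eq_one
    rw [one_div, one_div]; linarith
  simp only [Pi.mul_apply, mul_one, ENNReal.one_rpow, lintegral_one, Measure.restrict_apply_univ, h2,
    volume_closedBall_eq_ballVol] at h1
  refine h1.trans ?_
  have h3 : 0 ≤ 1 - 1 / p := by
    rw [sub_nonneg, div_le_one (by linarith)]; exact hp.le
  gcongr
  · exact Measure.restrict_le_self
  · rw [ballVol_eq hr.le, ENNReal.mul_rpow_of_nonneg _ _ h3, ENNReal.ofReal_rpow_of_nonneg (by positivity) h3,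
      ← Real.rpow_natCast, ← Real.rpow_mul hr.le]
    rw [show (d : ℝ) * (1 - 1 / p) = d - d / p by ring]

omit [NeZero d] in
/-- Hedberg's inequality before optimization. -/
lemma rieszPot_le_add {γ p : ℝ} (hγ : 0 < γ) (hγd : γ < d) (hp : 1 < p) (hp' : γ < d / p)
    {f : Vec d → ℝ≥0∞} (hf : Measurable f) (x : Vec d) {R : ℝ} (hR : 0 < R) :
    rieszPot γ f x ≤
      ENNReal.ofReal (d - γ) * (ENNReal.ofReal (R ^ γ / γ) * (ballVol d 1 * maxFn f x)) +
      ENNReal.ofReal (d - γ) * (ENNReal.ofReal (R ^ (γ - d / p) / (d / p - γ)) *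
        ((∫⁻ y, f y ^ p) ^ (1 / p) * ballVol d 1 ^ (1 - 1 / p))) := by
  refine (rieszPot_le_lintegral_balls hγd hf x).trans ?_
  rw [← mul_add]
  gcongr
  -- Balls of radius at most `R` are estimated by the maximal function, where `γ > 0` gives
  -- convergence at `0`; larger balls by Hölder's inequality, where `γ < d / p` gives convergence at
  -- infinity.
  rw [← Set.Ioc_union_Ioi_eq_Ioi hR.le]
  refine (lintegral_union_le _ _ _).trans ?_
  gcongr
  · rw [← setLIntegral_Ioc_rpow hγ hR, ← lintegral_mul_const _ (by fun_prop)]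
    refine setLIntegral_mono' measurableSet_Ioc fun r hr => ?_
    have hr0 : 0 < r := hr.1
    calc ENNReal.ofReal (r ^ (γ - d - 1)) * ∫⁻ y in Metric.closedBall x r, f y
        ≤ ENNReal.ofReal (r ^ (γ - d - 1)) * (ENNReal.ofReal (r ^ d) * ballVol d 1 * maxFn f x) := by
          gcongr
          rw [← ballVol_eq hr0.le]
          exact lintegral_closedBall_le_maxFn f x hr0
      _ = _ := by
          rw [mul_assoc, ← mul_assoc, ← ENNReal.ofReal_mul (by positivity), ← Real.rpow_natCast,
            ← Real.rpow_add hr0]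
          ring_nf
  · rw [show d / p - γ = -(γ - d / p) by ring, ← setLIntegral_Ioi_rpow (by linarith) hR, ← lintegral_mul_const _ (by fun_prop)]
    refine setLIntegral_mono' measurableSet_Ioi fun r hr => ?_
    have hr0 : 0 < r := hR.trans hr
    refine (mul_le_mul_right (lintegral_closedBall_le_Lp hp hf x hr0) _).trans (le_of_eq ?_)
    rw [mul_left_comm, ← mul_assoc (ENNReal.ofReal _) (ENNReal.ofReal _), ← ENNReal.ofReal_mul (by positivity),
      ← Real.rpow_add hr0, mul_left_comm]
    ring_nf

omit [NeZero d] in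
lemma rieszPot_eq_zero_of_maxFn {γ : ℝ} (hγd : γ < d)
    {f : Vec d → ℝ≥0∞} (hf : Measurable f) {x : Vec d} (h : maxFn f x = 0) : rieszPot γ f x = 0 := by
  refine le_antisymm ((rieszPot_le_lintegral_balls hγd hf x).trans ?_) zero_le
  have : ∀ r ∈ Set.Ioi (0 : ℝ), ENNReal.ofReal (r ^ (γ - d - 1)) * ∫⁻ y in Metric.closedBall x r, f y ≤ 0 :=
    fun r hr => by
      have := lintegral_closedBall_le_maxFn f x hr
      rw [h, mul_zero] at this
      rw [le_antisymm this zero_le, mul_zero]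
  refine (mul_le_mul_right (setLIntegral_mono' measurableSet_Ioi this) _).trans ?_
  simp

omit [NeZero d] in
/-- Hedberg's inequality. -/
lemma rieszPot_le_mul {γ p : ℝ} (hγ : 0 < γ) (hγd : γ < d) (hp : 1 < p) (hp' : γ < d / p) :
    ∃ K : ℝ≥0∞, K ≠ 0 ∧ K ≠ ⊤ ∧ ∀ f : Vec d → ℝ≥0∞, Measurable f → (∫⁻ y, f y ^ p) ≠ 0 →
      (∫⁻ y, f y ^ p) ≠ ⊤ → ∀ x, rieszPot γ f x ≤
        K * (maxFn f x ^ (1 - γ * p / d) * ((∫⁻ y, f y ^ p) ^ (1 / p)) ^ (γ * p / d)) := by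
  have hd0 : (0 : ℝ) < d := by linarith
  have hθ : 0 < 1 - γ * p / d := by
    rw [sub_pos, div_lt_one hd0]
    rwa [lt_div_iff₀ (by linarith)] at hp'
  set K1 : ℝ≥0∞ := ENNReal.ofReal (d - γ) * ENNReal.ofReal (1 / γ) * ballVol d 1 with hK1
  set K2 : ℝ≥0∞ := ENNReal.ofReal (d - γ) * ENNReal.ofReal (1 / (d / p - γ)) * ballVol d 1 ^ (1 - 1 / p) with hK2
  have h1p : 0 ≤ 1 - 1 / p := by
    rw [sub_nonneg, div_le_one (by linarith)]; exact hp.le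
  have hK1t : K1 ≠ ⊤ := ENNReal.mul_ne_top (by finiteness) (ballVol_ne_top _)
  have hK2t : K2 ≠ ⊤ := ENNReal.mul_ne_top (by finiteness) (ENNReal.rpow_ne_top_of_nonneg h1p (ballVol_ne_top _))
  -- The summand `1` makes the constant nonzero, so that the bound is infinite where the maximal
  -- function is.
  refine ⟨K1 + K2 + 1, by simp, by finiteness, fun f hf h0 ht x => ?_⟩
  set N := (∫⁻ y, f y ^ p) ^ (1 / p) with hN
  have hN0 : N ≠ 0 := by exact (ENNReal.rpow_pos (pos_iff_ne_zero.2 h0) ht).ne'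
  have hNt : N ≠ ⊤ := ENNReal.rpow_ne_top_of_nonneg (by positivity) ht
  rcases eq_or_ne (maxFn f x) 0 with hM0 | hM0
  · rw [rieszPot_eq_zero_of_maxFn hγd hf hM0]; exact zero_le
  rcases eq_or_ne (maxFn f x) ⊤ with hMt | hMt
  · rw [hMt, ENNReal.top_rpow_of_pos hθ, ENNReal.top_mul, ENNReal.mul_top (by simp)]
    · exact le_top
    · exact (ENNReal.rpow_pos (pos_iff_ne_zero.2 hN0) hNt).ne'
  obtain ⟨m, hm⟩ : ∃ m : ℝ≥0, maxFn f x = m := ⟨_, (ENNReal.coe_toNNReal hMt).symm⟩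
  obtain ⟨n, hn⟩ : ∃ n : ℝ≥0, N = n := ⟨_, (ENNReal.coe_toNNReal hNt).symm⟩
  have hm0 : (0 : ℝ) < m := by
    rw [hm] at hM0; exact_mod_cast pos_iff_ne_zero.2 (by simpa using hM0)
  have hn0 : (0 : ℝ) < n := by
    rw [hn] at hN0; exact_mod_cast pos_iff_ne_zero.2 (by simpa using hN0)
  have hq0 : (0 : ℝ) < n / m := by positivity
  -- The radius that balances the two terms: `R^{d/p} = N / Mf(x)` means `R^γ Mf(x) = R^{γ-d/p} N`.
  set R : ℝ := ((n : ℝ) / m) ^ (p / d) with hRdef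
  have hR : 0 < R := by positivity
  have hR1 : R ^ γ = ((n : ℝ) / m) ^ (γ * p / d) := by
    rw [hRdef, ← Real.rpow_mul hq0.le]; ring_nf
  have hR2 : R ^ (γ - d / p) = ((n : ℝ) / m) ^ (γ * p / d - 1) := by
    rw [hRdef, ← Real.rpow_mul hq0.le]
    congr 1
    field_simp
  have e1 : ENNReal.ofReal (R ^ γ) * maxFn f x = maxFn f x ^ (1 - γ * p / d) * N ^ (γ * p / d) := by
    rw [hm, hn, ← ENNReal.ofReal_coe_nnreal (p := m), ← ENNReal.ofReal_coe_nnreal (p := n),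
      ENNReal.ofReal_rpow_of_pos hm0, ENNReal.ofReal_rpow_of_pos hn0, ← ENNReal.ofReal_mul (by positivity),
      ← ENNReal.ofReal_mul (by positivity), hR1, Real.div_rpow hn0.le hm0.le, Real.rpow_sub hm0, Real.rpow_one]
    congr 1
    ring
  have e2 : ENNReal.ofReal (R ^ (γ - d / p)) * N = maxFn f x ^ (1 - γ * p / d) * N ^ (γ * p / d) := by
    rw [hm, hn, ← ENNReal.ofReal_coe_nnreal (p := m), ← ENNReal.ofReal_coe_nnreal (p := n),
      ENNReal.ofReal_rpow_of_pos hm0, ENNReal.ofReal_rpow_of_pos hn0, ← ENNReal.ofReal_mul (by positivity),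
      ← ENNReal.ofReal_mul (by positivity), hR2, Real.rpow_sub_one hq0.ne', Real.div_rpow hn0.le hm0.le, Real.rpow_sub hm0, Real.rpow_one]
    congr 1
    field_simp
  refine (rieszPot_le_add hγ hγd hp hp' hf x hR).trans ?_
  rw [← hN]
  calc _ = K1 * (ENNReal.ofReal (R ^ γ) * maxFn f x) + K2 * (ENNReal.ofReal (R ^ (γ - d / p)) * N) := by
        rw [hK1, hK2, div_eq_mul_one_div (R ^ γ), div_eq_mul_one_div (R ^ (γ - d / p)),
          ENNReal.ofReal_mul (by positivity), ENNReal.ofReal_mul (by positivity)]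
        ring
    _ = (K1 + K2) * (maxFn f x ^ (1 - γ * p / d) * N ^ (γ * p / d)) := by
        rw [e1, e2, add_mul]
    _ ≤ _ := mul_le_mul_left le_self_add _

/-- The Hardy-Littlewood-Sobolev inequality. -/
lemma lintegral_rieszPot_rpow_le {γ p q : ℝ} (hγ : 0 < γ) (hγd : γ < d) (hp : 1 < p)
    (hp' : γ < d / p) (hq : 1 / q = 1 / p - γ / d) : ∃ C : ℝ≥0∞, C ≠ ⊤ ∧
    ∀ f : Vec d → ℝ≥0∞, Measurable f →
      ∫⁻ x, rieszPot γ f x ^ q ≤ C * (∫⁻ x, f x ^ p) ^ (q / p) := by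
  obtain ⟨K, hK0, hKt, hK⟩ := rieszPot_le_mul (d := d) hγ hγd hp hp'
  obtain ⟨C, hC, hM⟩ := lintegral_maxFn_rpow_le (d := d) hp
  have hd0 : (0 : ℝ) < d := by linarith
  have hp0 : 0 < p := by linarith
  have hγp : γ * p < d := by rwa [lt_div_iff₀ hp0] at hp'
  have hq1 : 0 < 1 / q := by
    rw [hq, sub_pos, div_lt_div_iff₀ hd0 hp0]; linarith
  have hq0 : 0 < q := one_div_pos.1 hq1
  have hqe : q * (d - γ * p) = p * d := by
    field_simp at hq
    linarith
  -- The relation between `p` and `q` makes the `q`-th power of Hedberg's bound contain exactly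
  -- `(maxFn f) ^ p`, so the maximal theorem on `L^p` applies.
  have ex1 : (1 - γ * p / d) * q = p := by
    field_simp
    linarith
  have ex2 : 1 / p * (γ * p / d * q) + 1 = q / p := by
    field_simp
    linarith
  refine ⟨K ^ q * C + 1, by finiteness, fun f hf => ?_⟩
  rcases eq_or_ne (∫⁻ y, f y ^ p) ⊤ with ht | ht
  · rw [ht, ENNReal.top_rpow_of_pos (by positivity), ENNReal.mul_top (by simp)]
    exact le_top
  rcases eq_or_ne (∫⁻ y, f y ^ p) 0 with h0 | h0
  · rw [lintegral_eq_zero_iff (hf.pow_const p)] at h0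
    have h1 : ∀ x, rieszPot γ f x = 0 := fun x => by
      rw [rieszPot, lintegral_eq_zero_iff' ?_]
      · filter_upwards [h0] with y hy
        have : f y = 0 := by simpa [hp0, hp0.le, not_lt.2 hp0.le] using hy
        simp [this]
      · exact Measurable.aemeasurable (Measurable.mul (ENNReal.measurable_ofReal.comp
          ((measurable_const.sub measurable_id).norm.pow_const _)) hf)
    simp [h1, ENNReal.zero_rpow_of_pos hq0]
  calc ∫⁻ x, rieszPot γ f x ^ q
      ≤ ∫⁻ x, K ^ q * (maxFn f x ^ p * ((∫⁻ y, f y ^ p) ^ (1 / p * (γ * p / d * q)))) := by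
        refine lintegral_mono fun x => ?_
        refine (ENNReal.rpow_le_rpow (hK f hf h0 ht x) hq0.le).trans (le_of_eq ?_)
        rw [ENNReal.mul_rpow_of_nonneg _ _ hq0.le, ENNReal.mul_rpow_of_nonneg _ _ hq0.le,
          ← ENNReal.rpow_mul, ← ENNReal.rpow_mul, ← ENNReal.rpow_mul, ex1]
    _ = K ^ q * ((∫⁻ x, maxFn f x ^ p) * ((∫⁻ y, f y ^ p) ^ (1 / p * (γ * p / d * q)))) := by
        rw [lintegral_const_mul' _ _ (by finiteness), lintegral_mul_const' _ _
          (ENNReal.rpow_ne_top_of_nonneg (by positivity) ht)]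
    _ ≤ K ^ q * ((C * ∫⁻ x, f x ^ p) * ((∫⁻ y, f y ^ p) ^ (1 / p * (γ * p / d * q)))) := by
        gcongr
        exact hM f hf
    _ = K ^ q * C * (∫⁻ x, f x ^ p) ^ (q / p) := by
        rw [← ex2, ENNReal.rpow_add _ _ h0 ht, ENNReal.rpow_one]
        ring
    _ ≤ _ := by gcongr; exact le_self_add

end HLS

/-! ### Gamma integrals in the time variable -/

section Subordination

lemma integrableOn_rpow_mul_exp {a r : ℝ} (ha : 0 < a) (hr : 0 < r) :
    IntegrableOn (fun t : ℝ => t ^ (a - 1) * Real.exp (-(r * t))) (Set.Ioi 0) := by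
  have := integrableOn_rpow_mul_exp_neg_mul_rpow (p := 1) (s := a - 1) (b := r) (by linarith)
    one_pos hr
  simpa using this

/-- The substitution `t ↦ t⁻¹` carries these integrands to those of the Gamma function. -/
lemma integrableOn_rpow_mul_exp_inv {a r : ℝ} (ha : 0 < a) (hr : 0 < r) :
    IntegrableOn (fun t : ℝ => t ^ (-a - 1) * Real.exp (-(r / t))) (Set.Ioi 0) := by
  refine ((integrableOn_Ioi_comp_rpow_iff' _ (p := -1) (by norm_num)).2
    (integrableOn_rpow_mul_exp ha hr)).congr_fun (fun t ht => ?_) measurableSet_Ioi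
  have ht0 : 0 < t := ht
  simp only [smul_eq_mul]
  rw [Real.rpow_neg_one, Real.inv_rpow ht0.le, ← Real.rpow_neg ht0.le, ← mul_assoc,
    ← Real.rpow_add ht0, div_eq_mul_inv]
  ring_nf

lemma integral_rpow_mul_exp_inv {a r : ℝ} (ha : 0 < a) (hr : 0 < r) :
    ∫ t in Set.Ioi (0 : ℝ), t ^ (-a - 1) * Real.exp (-(r / t)) = r ^ (-a) * Real.Gamma a := by
  have h1 := integral_comp_rpow_Ioi (fun t : ℝ => t ^ (a - 1) * Real.exp (-(r * t))) (p := -1) (by norm_num)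
  rw [Real.integral_rpow_mul_exp_neg_mul_Ioi ha hr, one_div, Real.inv_rpow hr.le, ← Real.rpow_neg hr.le] at h1
  rw [← h1]
  refine setIntegral_congr_fun measurableSet_Ioi fun t ht => ?_
  have ht0 : 0 < t := ht
  simp only [smul_eq_mul, abs_neg, abs_one, one_mul]
  rw [Real.rpow_neg_one, Real.inv_rpow ht0.le, ← Real.rpow_neg ht0.le, ← mul_assoc,
    ← Real.rpow_add ht0, div_eq_mul_inv]
  ring_nf

end Subordination

/-! ### Gaussian moments and the Fourier transform -/

section Gaussian

variable {d : ℕ}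

/-- The Kronecker symbol. -/
def kron (j k : Fin d) : ℝ := if j = k then 1 else 0

lemma abs_kron_le (j k : Fin d) : |kron j k| ≤ 1 := by
  unfold kron; split_ifs <;> simp

lemma abs_coord_le (x : Vec d) (l : Fin d) : |x l| ≤ ‖x‖ := by
  simpa using PiLp.norm_apply_le x l

lemma integrable_pow_mul_gaussian {b : ℝ} (hb : 0 < b) (n : ℕ) :
    Integrable (fun x : Vec d => ‖x‖ ^ n * Real.exp (-b * ‖x‖ ^ 2)) := by
  have h0 : Integrable (fun x : Vec d => Real.exp (-(b / 2) * ‖x‖ ^ 2)) := by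
    have := (GaussianFourier.integrable_cexp_neg_mul_sq_norm_add (V := Vec d) (b := ((b / 2 : ℝ) : ℂ))
      (by rw [Complex.ofReal_re]; positivity) 0 0).norm
    refine this.congr (Eventually.of_forall fun x => ?_)
    simp only [Complex.norm_exp]
    congr 1
    have : (-((b / 2 : ℝ) : ℂ) * (‖x‖ : ℂ) ^ 2 + 0 * (inner ℝ (0 : Vec d) x : ℝ)) =
      ((-(b / 2) * ‖x‖ ^ 2 : ℝ) : ℂ) := by push_cast; ring
    rw [this, Complex.ofReal_re]
  obtain ⟨C, hC⟩ : ∃ C : ℝ, ∀ r : ℝ, 0 ≤ r → r ^ n * Real.exp (-(b / 2) * r ^ 2) ≤ C := by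
    refine ⟨1 + (n.factorial : ℝ) / (b / 2) ^ n, fun r hr => ?_⟩
    rcases le_total r 1 with h | h
    · have h1 : r ^ n ≤ 1 := pow_le_one₀ hr h
      have h2 : Real.exp (-(b / 2) * r ^ 2) ≤ 1 := Real.exp_le_one_iff.2 (by nlinarith [sq_nonneg r])
      have h3 : 0 ≤ (n.factorial : ℝ) / (b / 2) ^ n := by positivity
      nlinarith [mul_le_one₀ h1 (Real.exp_pos _).le h2]
    · have h1 : (b / 2 * r ^ 2) ^ n / n.factorial ≤ Real.exp (b / 2 * r ^ 2) :=
        Real.pow_div_factorial_le_exp _ (by positivity) n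
      have h2 : r ^ n ≤ (r ^ 2) ^ n := by
        rw [← pow_mul]; exact pow_le_pow_right₀ h (by omega)
      have h3 : r ^ n ≤ (n.factorial : ℝ) / (b / 2) ^ n * Real.exp (b / 2 * r ^ 2) := by
        rw [div_le_iff₀ (by positivity), mul_pow] at h1
        rw [div_mul_eq_mul_div, le_div_iff₀ (by positivity)]
        nlinarith [mul_le_mul_of_nonneg_right h2 (show 0 ≤ (b / 2) ^ n by positivity)]
      calc r ^ n * Real.exp (-(b / 2) * r ^ 2)
          ≤ (n.factorial : ℝ) / (b / 2) ^ n * Real.exp (b / 2 * r ^ 2) * Real.exp (-(b / 2) * r ^ 2) := by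
            gcongr
        _ = (n.factorial : ℝ) / (b / 2) ^ n := by
            rw [mul_assoc, ← Real.exp_add]; simp
        _ ≤ _ := by linarith
  refine Integrable.mono' (h0.const_mul C) ?_ (Eventually.of_forall fun x => ?_)
  · exact Continuous.aestronglyMeasurable (by fun_prop)
  · rw [Real.norm_of_nonneg (by positivity)]
    calc ‖x‖ ^ n * Real.exp (-b * ‖x‖ ^ 2)
        = ‖x‖ ^ n * Real.exp (-(b / 2) * ‖x‖ ^ 2) * Real.exp (-(b / 2) * ‖x‖ ^ 2) := by
          rw [mul_assoc, ← Real.exp_add]; ring_nf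
      _ ≤ _ := by gcongr; exact hC _ (norm_nonneg x)

lemma innerSL_single (x : Vec d) (l : Fin d) :
    innerSL ℝ x (EuclideanSpace.single l (1 : ℝ)) = x l := by
  rw [innerSL_apply_apply]
  simp [EuclideanSpace.inner_single_right]

/-- Multiplication by a coordinate corresponds to differentiation on the Fourier side. -/
lemma fourier_coord_mul {f : Vec d → ℂ} (hf : Integrable f)
    (hf' : Integrable fun x => ‖x‖ * ‖f x‖) {K : ℂ} {c : ℝ} {P : Vec d → ℝ}
    {P' : Vec d → Vec d →L[ℝ] ℝ} (hP : ∀ w, HasFDerivAt P (P' w) w)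
    (h : 𝓕 f = fun w => K * ((P w * Real.exp (-c * ‖w‖ ^ 2) : ℝ) : ℂ)) (l : Fin d) :
    𝓕 (fun x => (x l : ℂ) * f x) = fun w => Complex.I / (2 * Real.pi) * K *
      (((P' w (EuclideanSpace.single l 1) - 2 * c * w l * P w) * Real.exp (-c * ‖w‖ ^ 2) : ℝ) : ℂ) := by
  funext w
  -- The derivative of `𝓕 f` is computed in two ways, under the integral sign and from the explicit
  -- form `K P(w) exp(-c|w|²)`. That form is reproduced with a new `P`, so the lemma can be
  -- iterated.
  have h1 := Real.hasFDerivAt_fourier hf hf' w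
  have h2 : HasFDerivAt (fun w : Vec d => P w * Real.exp (-c * ‖w‖ ^ 2)) _ w :=
    (hP w).mul ((((hasStrictFDerivAt_norm_sq w).hasFDerivAt).const_mul (-c)).exp)
  have h3 := (Complex.ofRealCLM.hasFDerivAt.comp w h2).const_mul K
  have h4 : (fun w => K * ((P w * Real.exp (-c * ‖w‖ ^ 2) : ℝ) : ℂ)) = 𝓕 f := h.symm
  have h5 := h1.unique (h4 ▸ h3)
  have h6 := congrArg (fun L : Vec d →L[ℝ] ℂ => L (EuclideanSpace.single l 1)) h5
  have h7 : 𝓕 (VectorFourier.fourierSMulRight (innerSL ℝ) f) w (EuclideanSpace.single l 1) =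
      -(2 * Real.pi * Complex.I) * 𝓕 (fun x => (x l : ℂ) * f x) w := by
    rw [Real.fourier_continuousLinearMap_apply, Real.fourier_eq, Real.fourier_eq, ← integral_const_mul]
    · refine integral_congr_ae (Eventually.of_forall fun x => ?_)
      simp [VectorFourier.fourierSMulRight, Circle.smul_def]
      erw [innerSL_single x l]
      ring
    · refine Integrable.mono' (hf'.const_mul (2 * Real.pi)) ?_ (Eventually.of_forall fun x => ?_)
      · exact AEStronglyMeasurable.fourierSMulRight (L := innerSL (E := Vec d) ℝ) hf.aestronglyMeasurable
      · refine (VectorFourier.norm_fourierSMulRight_le _ _ _).trans ?_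
        have : ‖innerSL (E := Vec d) ℝ‖ ≤ 1 := norm_innerSL_le _
        nlinarith [mul_le_mul_of_nonneg_right this (show 0 ≤ 2 * Real.pi * ‖x‖ * ‖f x‖ by positivity)]
  rw [h7] at h6
  have hpi : (Real.pi : ℂ) ≠ 0 := by exact_mod_cast Real.pi_ne_zero
  have h8 : 𝓕 (fun x => (x l : ℂ) * f x) w = Complex.I / (2 * Real.pi) *
      (-(2 * Real.pi * Complex.I) * 𝓕 (fun x => (x l : ℂ) * f x) w) := by
    field_simp
    rw [Complex.I_sq]
    ring
  rw [h8, h6]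
  simp [innerSL_single]
  ring

end Gaussian

/-! ### The Stokes kernel as a time integral of Gaussians, and its size -/

section HeatKernel

variable {d : ℕ}

/-- The symmetric expression `δ_{jk} x_l + δ_{jl} x_k + δ_{kl} x_j`. -/
def kronSum (j k l : Fin d) (x : Vec d) : ℝ := kron j k * x l + kron j l * x k + kron k l * x j

lemma abs_kron_mul_le (j k l : Fin d) (x : Vec d) : |kron j k * x l| ≤ ‖x‖ := by
  rw [abs_mul]
  nlinarith [abs_kron_le j k, abs_coord_le x l, abs_nonneg (x l), norm_nonneg x, abs_nonneg (kron j k)]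

lemma abs_kronSum_le (j k l : Fin d) (x : Vec d) : |kronSum j k l x| ≤ 3 * ‖x‖ := by
  unfold kronSum
  have h1 := abs_kron_mul_le j k l x
  have h2 := abs_kron_mul_le j l k x
  have h3 := abs_kron_mul_le k l j x
  have := abs_add_three (kron j k * x l) (kron j l * x k) (kron k l * x j)
  linarith

lemma abs_coord_mul_coord_mul_coord_le (j k l : Fin d) (x : Vec d) : |x j * x k * x l| ≤ ‖x‖ ^ 3 := by
  rw [abs_mul, abs_mul, pow_three']
  gcongr <;> exact abs_coord_le _ _

/-- The coefficient of `t^{α-2-d/2}` in `heatStokes`. -/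
def heatCoef (α : ℝ) (j k l : Fin d) (x : Vec d) : ℝ :=
  kronSum j k l x / (4 * Real.Gamma (α + 1)) - kron j k * x l / (2 * Real.Gamma α)

/-- The density in `t` of the Stokes kernel: with the heat kernel `g_t` it is
`t^{α-1}/Γ(α) δ_{jk} D_l g_t + t^α/Γ(α+1) D_j D_k D_l g_t`. -/
def heatStokes (α : ℝ) (j k l : Fin d) (t : ℝ) (x : Vec d) : ℝ :=
  (4 * Real.pi) ^ (-((d : ℝ) / 2)) *
    (heatCoef α j k l x * (t ^ (-((d : ℝ) / 2 + 1 - α) - 1) * Real.exp (-(‖x‖ ^ 2 / 4 / t))) -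
      x j * x k * x l / (8 * Real.Gamma (α + 1)) *
        (t ^ (-((d : ℝ) / 2 + 2 - α) - 1) * Real.exp (-(‖x‖ ^ 2 / 4 / t))))

/-- Gamma integrals with `r = ‖x‖² / 4` produce the powers `‖x‖^{-(d+2-2α)}` and `‖x‖^{-(d+4-2α)}`,
and `Γ(a+1) = aΓ(a)` brings the coefficients to those of `U_α` after differentiating the quotient.
The upper bound on `α` keeps `a = d/2 + 1 - α` positive. -/
lemma integral_heatStokes {α : ℝ} (hα : 0 < α) (hα' : α < ((d : ℝ) + 1) / 2) (j k l : Fin d)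
    {x : Vec d} (hx : x ≠ 0) :
    ∫ t in Set.Ioi 0, heatStokes α j k l t x = stokesKernel d α j k l x := by
  have hr : 0 < ‖x‖ ^ 2 / 4 := by have := norm_pos_iff.2 hx; positivity
  have hn := norm_pos_iff.2 hx
  have ha : 0 < (d : ℝ) / 2 + 1 - α := by linarith
  have ha' : 0 < (d : ℝ) / 2 + 2 - α := by linarith
  unfold heatStokes
  rw [integral_const_mul, integral_sub ((integrableOn_rpow_mul_exp_inv ha hr).const_mul _)
    ((integrableOn_rpow_mul_exp_inv ha' hr).const_mul _), integral_const_mul, integral_const_mul,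
    integral_rpow_mul_exp_inv ha hr, integral_rpow_mul_exp_inv ha' hr]
  have hd1 : pd l (fun y : Vec d => y j * y k / ‖y‖ ^ ((d : ℝ) + 2 - 2 * α)) x =
      (kron k l * x j + kron j l * x k) * ‖x‖ ^ (-((d : ℝ) + 2 - 2 * α)) -
        x j * x k * (((d : ℝ) + 2 - 2 * α) * ‖x‖ ^ (-((d : ℝ) + 2 - 2 * α)) * (x l / ‖x‖ ^ 2)) := by
    have e1 : (fun y : Vec d => y j * y k / ‖y‖ ^ ((d : ℝ) + 2 - 2 * α)) =
        fun y => (coordL j y * coordL k y) * (‖y‖ ^ 2) ^ (-((d : ℝ) + 2 - 2 * α) / 2) := by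
      funext y
      rw [div_eq_mul_inv, ← Real.rpow_neg (norm_nonneg y), ← Real.rpow_natCast, ← Real.rpow_mul (norm_nonneg y)]
      simp only [coordL_apply]
      congr 2
      push_cast; ring
    have h2 : HasFDerivAt (fun y : Vec d => (‖y‖ ^ 2) ^ (-((d : ℝ) + 2 - 2 * α) / 2)) _ x :=
      (hasStrictFDerivAt_norm_sq x).hasFDerivAt.rpow_const (p := -((d : ℝ) + 2 - 2 * α) / 2)
        (Or.inl (by positivity))
    have h3 := ((coordL j).hasFDerivAt (x := x).mul (coordL k).hasFDerivAt).mul h2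
    unfold pd
    rw [e1]
    erw [h3.fderiv]
    have e2 : (‖x‖ ^ 2) ^ (-((d : ℝ) + 2 - 2 * α) / 2 - 1) =
        ‖x‖ ^ (-((d : ℝ) + 2 - 2 * α)) / ‖x‖ ^ 2 := by
      rw [Real.rpow_sub_one (by positivity), ← Real.rpow_natCast ‖x‖ 2, ← Real.rpow_mul hn.le]
      congr 2
      push_cast; ring
    have e3 : (‖x‖ ^ 2) ^ (-((d : ℝ) + 2 - 2 * α) / 2) = ‖x‖ ^ (-((d : ℝ) + 2 - 2 * α)) := by
      rw [← Real.rpow_natCast ‖x‖ 2, ← Real.rpow_mul hn.le]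
      congr 1
      push_cast; ring
    simp only [add_apply, smul_apply, smul_eq_mul, coordL_apply,
      innerSL_single, e2, e3, nsmul_eq_mul, Pi.mul_apply, kron]
    rw [show ((EuclideanSpace.single l (1 : ℝ) : Vec d) k) = if k = l then 1 else 0 by simp,
      show ((EuclideanSpace.single l (1 : ℝ) : Vec d) j) = if j = l then 1 else 0 by simp]
    push_cast
    ring
  rw [stokesKernel, hd1, heatCoef, kronSum]
  rw [show (if j = k then (1 : ℝ) else 0) = kron j k from rfl]
  have hG : 0 < Real.Gamma α := Real.Gamma_pos_of_pos hα
  rw [Real.Gamma_add_one hα.ne', show 1 + α = α + 1 by ring, Real.Gamma_add_one hα.ne',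
    show (d : ℝ) / 2 + 2 - α = ((d : ℝ) / 2 + 1 - α) + 1 by ring, Real.Gamma_add_one ha.ne',
    show 1 + (d : ℝ) / 2 - α = (d : ℝ) / 2 + 1 - α by ring, neg_add, ← sub_eq_add_neg (-((d : ℝ) / 2 + 1 - α)),
    Real.rpow_sub_one hr.ne']
  have e4 : (‖x‖ ^ 2 / 4) ^ (-((d : ℝ) / 2 + 1 - α)) =
      ‖x‖ ^ (-((d : ℝ) + 2 - 2 * α)) * (4 * 4 ^ ((d : ℝ) / 2) / 2 ^ (2 * α)) := by
    rw [div_eq_mul_inv, Real.mul_rpow (by positivity) (by positivity), Real.inv_rpow (by positivity),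
      ← Real.rpow_neg (by positivity), ← Real.rpow_natCast ‖x‖ 2, ← Real.rpow_mul hn.le]
    congr 1
    · congr 1; push_cast; ring
    · rw [Real.rpow_mul (by norm_num), show (2 : ℝ) ^ (2 : ℝ) = 4 by norm_num,
        show - -((d : ℝ) / 2 + 1 - α) = (1 + (d : ℝ) / 2) - α by ring, Real.rpow_sub (by norm_num),
        Real.rpow_add (by norm_num), Real.rpow_one]
  rw [e4, Real.mul_rpow (by norm_num) Real.pi_pos.le, Real.rpow_neg (by norm_num), Real.rpow_neg Real.pi_pos.le,
    Real.rpow_neg hn.le]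
  have h5 : (0 : ℝ) < 4 ^ ((d : ℝ) / 2) := by positivity
  have h6 : (0 : ℝ) < 2 ^ (2 * α) := by positivity
  have h7 : (0 : ℝ) < Real.pi ^ ((d : ℝ) / 2) := by positivity
  have h8 : 0 < ‖x‖ ^ ((d : ℝ) + 2 - 2 * α) := by positivity
  -- With powers and Gamma values as free positive variables, a rational identity remains.
  generalize (4 : ℝ) ^ ((d : ℝ) / 2) = z5 at *
  generalize (2 : ℝ) ^ (2 * α) = z6 at *
  generalize Real.pi ^ ((d : ℝ) / 2) = z7 at *
  generalize ‖x‖ ^ ((d : ℝ) + 2 - 2 * α) = z8 at *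
  generalize Real.Gamma α = z9 at *
  generalize Real.Gamma ((d : ℝ) / 2 + 1 - α) = z10 at *
  generalize ‖x‖ = z11 at *
  field_simp
  ring

/-- Dominating function of the density `heatStokes`. -/
lemma norm_heatStokes_le {α : ℝ} (hα : 0 < α) : ∃ C : ℝ, 0 ≤ C ∧ ∀ (j k l : Fin d) (x : Vec d) (t : ℝ), 0 < t →
    ‖heatStokes α j k l t x‖ ≤ C * (‖x‖ *
      (t ^ (-((d : ℝ) / 2 + 1 - α) - 1) * Real.exp (-(‖x‖ ^ 2 / 4 / t))) +
      ‖x‖ ^ 3 * (t ^ (-((d : ℝ) / 2 + 2 - α) - 1) * Real.exp (-(‖x‖ ^ 2 / 4 / t)))) := by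
  have hG : 0 < Real.Gamma α := Real.Gamma_pos_of_pos hα
  have hG' : 0 < Real.Gamma (α + 1) := Real.Gamma_pos_of_pos (by linarith)
  set C1 := 3 / (4 * Real.Gamma (α + 1)) + 1 / (2 * Real.Gamma α)
  set C2 := 1 / (8 * Real.Gamma (α + 1))
  have hC1 : 0 ≤ C1 := by positivity
  have hC2 : 0 ≤ C2 := by positivity
  set K := (4 * Real.pi) ^ (-((d : ℝ) / 2)) with hK
  have hK0 : 0 ≤ K := by positivity
  refine ⟨K * (C1 + C2), by positivity, fun j k l x t ht => ?_⟩
  have h1 : |heatCoef α j k l x| ≤ C1 * ‖x‖ := by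
    unfold heatCoef
    refine (abs_sub _ _).trans ?_
    rw [abs_div, abs_div, abs_of_pos (show 0 < 4 * Real.Gamma (α + 1) by positivity),
      abs_of_pos (show 0 < 2 * Real.Gamma α by positivity)]
    have e1 : |kronSum j k l x| / (4 * Real.Gamma (α + 1)) ≤ (3 * ‖x‖) / (4 * Real.Gamma (α + 1)) := by
      gcongr; exact abs_kronSum_le j k l x
    have e2 : |kron j k * x l| / (2 * Real.Gamma α) ≤ ‖x‖ / (2 * Real.Gamma α) := by
      gcongr; exact abs_kron_mul_le j k l x
    refine (add_le_add e1 e2).trans (le_of_eq ?_)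
    simp only [C1]; ring
  have h2 : |x j * x k * x l / (8 * Real.Gamma (α + 1))| ≤ C2 * ‖x‖ ^ 3 := by
    rw [abs_div, abs_of_pos (show 0 < 8 * Real.Gamma (α + 1) by positivity)]
    simp only [C2]
    rw [div_mul_eq_mul_div, one_mul]
    gcongr
    exact abs_coord_mul_coord_mul_coord_le j k l x
  unfold heatStokes
  set A := t ^ (-((d : ℝ) / 2 + 1 - α) - 1) * Real.exp (-(‖x‖ ^ 2 / 4 / t))
  set B := t ^ (-((d : ℝ) / 2 + 2 - α) - 1) * Real.exp (-(‖x‖ ^ 2 / 4 / t))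
  have hA : 0 ≤ A := by positivity
  have hB : 0 ≤ B := by positivity
  rw [Real.norm_eq_abs, abs_mul, abs_of_nonneg hK0, mul_assoc K]
  refine mul_le_mul_of_nonneg_left ?_ hK0
  refine (abs_sub _ _).trans ?_
  rw [abs_mul _ A, abs_mul _ B, abs_of_nonneg hA, abs_of_nonneg hB]
  have := mul_le_mul_of_nonneg_right h1 hA
  have := mul_le_mul_of_nonneg_right h2 hB
  have : 0 ≤ C2 * (‖x‖ * A) := by positivity
  have : 0 ≤ C1 * (‖x‖ ^ 3 * B) := by positivity
  linarith

lemma measurable_heatStokes (α : ℝ) (j k l : Fin d) :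
    Measurable fun p : ℝ × Vec d => heatStokes α j k l p.1 p.2 := by
  have h : ∀ i : Fin d, Measurable fun p : ℝ × Vec d => p.2 i := fun i =>
    (coordL i).measurable.comp measurable_snd
  unfold heatStokes heatCoef kronSum
  have h1 := h j
  have h2 := h k
  have h3 := h l
  fun_prop

/-- `∫ |heatStokes| dt ≤ C |x|^{2α-1-d}`. -/
lemma integrableOn_heatStokes {α : ℝ} (hα : 0 < α) (hα' : α < ((d : ℝ) + 1) / 2) :
    ∃ C : ℝ, 0 ≤ C ∧ ∀ (j k l : Fin d) (x : Vec d), x ≠ 0 →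
      IntegrableOn (fun t => heatStokes α j k l t x) (Set.Ioi 0) ∧
      ∫ t in Set.Ioi 0, ‖heatStokes α j k l t x‖ ≤ C * ‖x‖ ^ (2 * α - 1 - d) := by
  obtain ⟨C, hC0, hC⟩ := norm_heatStokes_le (d := d) hα
  have ha : 0 < (d : ℝ) / 2 + 1 - α := by linarith
  have ha' : 0 < (d : ℝ) / 2 + 2 - α := by linarith
  set a := (d : ℝ) / 2 + 1 - α with ha_def
  set b := (d : ℝ) / 2 + 2 - α with hb_def
  have hGa : 0 < Real.Gamma a := Real.Gamma_pos_of_pos ha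
  have hGb : 0 < Real.Gamma b := Real.Gamma_pos_of_pos ha'
  refine ⟨C * (4 ^ a * Real.Gamma a + 4 ^ b * Real.Gamma b), by positivity, fun j k l x hx => ?_⟩
  have hn := norm_pos_iff.2 hx
  have hr : 0 < ‖x‖ ^ 2 / 4 := by positivity
  have hdom : IntegrableOn (fun t : ℝ => C * (‖x‖ * (t ^ (-a - 1) * Real.exp (-(‖x‖ ^ 2 / 4 / t))) +
      ‖x‖ ^ 3 * (t ^ (-b - 1) * Real.exp (-(‖x‖ ^ 2 / 4 / t))))) (Set.Ioi 0) :=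
    (((integrableOn_rpow_mul_exp_inv ha hr).const_mul _).add
      ((integrableOn_rpow_mul_exp_inv ha' hr).const_mul _)).const_mul C
  have hle : ∀ᵐ t ∂(volume.restrict (Set.Ioi (0 : ℝ))), ‖heatStokes α j k l t x‖ ≤
      C * (‖x‖ * (t ^ (-a - 1) * Real.exp (-(‖x‖ ^ 2 / 4 / t))) +
      ‖x‖ ^ 3 * (t ^ (-b - 1) * Real.exp (-(‖x‖ ^ 2 / 4 / t)))) :=
    (ae_restrict_mem measurableSet_Ioi).mono fun t ht => hC j k l x t ht
  have hint : IntegrableOn (fun t => heatStokes α j k l t x) (Set.Ioi 0) := by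
    refine Integrable.mono' hdom ?_ hle
    exact ((measurable_heatStokes α j k l).comp (measurable_id.prodMk measurable_const)).aestronglyMeasurable
  refine ⟨hint, (integral_mono_ae hint.norm hdom hle).trans (le_of_eq ?_)⟩
  rw [integral_const_mul, integral_add ((integrableOn_rpow_mul_exp_inv ha hr).const_mul _)
      ((integrableOn_rpow_mul_exp_inv ha' hr).const_mul _), integral_const_mul, integral_const_mul,
    integral_rpow_mul_exp_inv ha hr, integral_rpow_mul_exp_inv ha' hr]
  have key : ∀ c : ℝ, (‖x‖ ^ 2 / 4) ^ (-c) = ‖x‖ ^ (-(2 * c)) * 4 ^ c := fun c => by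
    rw [div_eq_mul_inv, Real.mul_rpow (by positivity) (by positivity), Real.inv_rpow (by positivity),
      ← Real.rpow_neg (by positivity), ← Real.rpow_natCast ‖x‖ 2, ← Real.rpow_mul hn.le, neg_neg]
    congr 2; push_cast; ring
  rw [key, key]
  have e1 : ‖x‖ ^ (2 * α - 1 - d) = ‖x‖ * ‖x‖ ^ (-(2 * a)) := by
    rw [← Real.rpow_one_add' hn.le (by rw [ha_def]; intro h; linarith)]
    congr 1; rw [ha_def]; ring
  have e2 : ‖x‖ ^ (2 * α - 1 - d) = ‖x‖ ^ 3 * ‖x‖ ^ (-(2 * b)) := by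
    rw [← Real.rpow_natCast ‖x‖ 3, ← Real.rpow_add hn]
    congr 1; rw [hb_def]; push_cast; ring
  rw [mul_assoc C, add_mul]
  congr 2
  · rw [e1]; ring
  · rw [e2]; ring

/-- The kernel is bounded by `C |x|^{2α-1-d}`. -/
lemma abs_stokesKernel_le {α : ℝ} (hα : 0 < α) (hα' : α < ((d : ℝ) + 1) / 2) :
    ∃ C : ℝ, 0 ≤ C ∧ ∀ (j k l : Fin d) (x : Vec d), x ≠ 0 →
      |stokesKernel d α j k l x| ≤ C * ‖x‖ ^ (2 * α - 1 - d) := by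
  obtain ⟨C, hC0, hC⟩ := integrableOn_heatStokes (d := d) hα hα'
  refine ⟨C, hC0, fun j k l x hx => ?_⟩
  rw [← integral_heatStokes hα hα' j k l hx]
  exact (norm_integral_le_integral_norm _).trans (hC j k l x hx).2

end HeatKernel

/-! ### The Fourier transform of the time density -/

section HeatSymbol

variable {d : ℕ}

lemma fourier_fun_add {f g : Vec d → ℂ} (hf : Integrable f) (hg : Integrable g) (w : Vec d) :
    𝓕 (fun x => f x + g x) w = 𝓕 f w + 𝓕 g w :=
  congrFun (VectorFourier.fourierIntegral_add (μ := (volume : Measure (Vec d))) (L := innerₗ (Vec d))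
    Real.continuous_fourierChar continuous_inner hf hg) w

lemma fourier_fun_const_mul (c : ℂ) (f : Vec d → ℂ) (w : Vec d) :
    𝓕 (fun x => c * f x) w = c * 𝓕 f w :=
  congrFun (VectorFourier.fourierIntegral_const_smul Real.fourierChar (volume : Measure (Vec d))
    (innerₗ (Vec d)) f c) w

/-- The Fourier transform of `heatStokes`. -/
def heatSymbol (α : ℝ) (j k l : Fin d) (t : ℝ) (ξ : Vec d) : ℝ :=
  2 * Real.pi * kron j k * ξ l / Real.Gamma α * (t ^ (α - 1) * Real.exp (-(4 * Real.pi ^ 2 * ‖ξ‖ ^ 2 * t))) -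
    8 * Real.pi ^ 3 * (ξ j * ξ k * ξ l) / Real.Gamma (α + 1) *
      (t ^ (α + 1 - 1) * Real.exp (-(4 * Real.pi ^ 2 * ‖ξ‖ ^ 2 * t)))

/-- The factor `1` on the right is the constant polynomial `P` from which `fourier_coord_mul`
starts. -/
lemma fourier_gaussian_real {b : ℝ} (hb : 0 < b) :
    𝓕 (fun x : Vec d => ((Real.exp (-b * ‖x‖ ^ 2) : ℝ) : ℂ)) = fun w =>
      (((Real.pi / b) ^ ((d : ℝ) / 2) : ℝ) : ℂ) * ((1 * Real.exp (-(Real.pi ^ 2 / b) * ‖w‖ ^ 2) : ℝ) : ℂ) := by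
  funext w
  have h := fourier_gaussian_innerProductSpace (V := Vec d) (b := (b : ℂ)) (by simpa using hb) w
  have e1 : (fun x : Vec d => ((Real.exp (-b * ‖x‖ ^ 2) : ℝ) : ℂ)) =
      fun v => Complex.exp (-(b : ℂ) * (‖v‖ : ℂ) ^ 2) := by
    funext x; push_cast; rfl
  rw [e1, h, Complex.ofReal_cpow (by positivity)]
  simp only [finrank_euclideanSpace, Fintype.card_fin]
  push_cast
  rw [one_mul]
  congr 2
  ring

lemma hasFDerivAt_coord (l : Fin d) (w : Vec d) : HasFDerivAt (fun w : Vec d => w l) (coordL l) w :=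
  (coordL l).hasFDerivAt

lemma coordL_single (j l : Fin d) : coordL j (EuclideanSpace.single l (1 : ℝ)) = kron j l := by
  simp [coordL_apply, kron]

lemma fourier_gaussian_coord {b : ℝ} (hb : 0 < b) (l : Fin d) :
    𝓕 (fun x : Vec d => (x l : ℂ) * ((Real.exp (-b * ‖x‖ ^ 2) : ℝ) : ℂ)) = fun w =>
      Complex.I / (2 * Real.pi) * (((Real.pi / b) ^ ((d : ℝ) / 2) : ℝ) : ℂ) *
        ((-2 * (Real.pi ^ 2 / b) * w l * Real.exp (-(Real.pi ^ 2 / b) * ‖w‖ ^ 2) : ℝ) : ℂ) := by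
  have h1 : Integrable fun x : Vec d => ((Real.exp (-b * ‖x‖ ^ 2) : ℝ) : ℂ) := by
    simpa using (integrable_pow_mul_gaussian (d := d) hb 0).ofReal (𝕜 := ℂ)
  have h2 : Integrable fun x : Vec d => ‖x‖ * ‖((Real.exp (-b * ‖x‖ ^ 2) : ℝ) : ℂ)‖ := by
    refine (integrable_pow_mul_gaussian (d := d) hb 1).congr (Eventually.of_forall fun x => ?_)
    simp only [Complex.norm_real, pow_one, Real.norm_eq_abs, abs_of_pos (Real.exp_pos _)]
  rw [fourier_coord_mul h1 h2 (P := fun _ => 1) (P' := fun _ => 0) (fun w => hasFDerivAt_const _ _)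
    (fourier_gaussian_real hb) l]
  funext w
  congr 2
  simp only [zero_apply]
  ring

lemma fourier_gaussian_coord_coord {b : ℝ} (hb : 0 < b) (k l : Fin d) :
    𝓕 (fun x : Vec d => (x k : ℂ) * ((x l : ℂ) * ((Real.exp (-b * ‖x‖ ^ 2) : ℝ) : ℂ))) = fun w =>
      Complex.I / (2 * Real.pi) * (Complex.I / (2 * Real.pi) * (((Real.pi / b) ^ ((d : ℝ) / 2) : ℝ) : ℂ)) *
        (((4 * (Real.pi ^ 2 / b) ^ 2 * (w k * w l) - 2 * (Real.pi ^ 2 / b) * kron l k) *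
          Real.exp (-(Real.pi ^ 2 / b) * ‖w‖ ^ 2) : ℝ) : ℂ) := by
  have hb1 : ∀ x : Vec d, ‖(x l : ℂ) * ((Real.exp (-b * ‖x‖ ^ 2) : ℝ) : ℂ)‖ ≤
      ‖x‖ * Real.exp (-b * ‖x‖ ^ 2) := fun x => by
    rw [norm_mul, Complex.norm_real, Complex.norm_real, Real.norm_eq_abs, Real.norm_eq_abs,
      abs_of_pos (Real.exp_pos _)]
    gcongr; exact abs_coord_le x l
  have h1 : Integrable fun x : Vec d => (x l : ℂ) * ((Real.exp (-b * ‖x‖ ^ 2) : ℝ) : ℂ) := by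
    refine Integrable.mono' (integrable_pow_mul_gaussian (d := d) hb 1)
      (by fun_prop) (Eventually.of_forall fun x => ?_)
    simpa using hb1 x
  have h2 : Integrable fun x : Vec d => ‖x‖ * ‖(x l : ℂ) * ((Real.exp (-b * ‖x‖ ^ 2) : ℝ) : ℂ)‖ := by
    refine Integrable.mono' (integrable_pow_mul_gaussian (d := d) hb 2)
      (by fun_prop) (Eventually.of_forall fun x => ?_)
    rw [Real.norm_of_nonneg (by positivity)]
    exact (mul_le_mul_of_nonneg_left (hb1 x) (norm_nonneg x)).trans (le_of_eq (by ring))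
  rw [fourier_coord_mul h1 h2 (P := fun w => -2 * (Real.pi ^ 2 / b) * w l)
    (P' := fun _ => (-2 * (Real.pi ^ 2 / b)) • coordL l) (fun w => (hasFDerivAt_coord l w).const_mul _)
    (fourier_gaussian_coord hb l) k]
  funext w
  congr 2
  simp only [smul_apply, coordL_single, smul_eq_mul]
  ring

lemma fourier_gaussian_coord_coord_coord {b : ℝ} (hb : 0 < b) (j k l : Fin d) :
    𝓕 (fun x : Vec d => (x j : ℂ) * ((x k : ℂ) * ((x l : ℂ) * ((Real.exp (-b * ‖x‖ ^ 2) : ℝ) : ℂ)))) = fun w =>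
      Complex.I / (2 * Real.pi) * (Complex.I / (2 * Real.pi) *
        (Complex.I / (2 * Real.pi) * (((Real.pi / b) ^ ((d : ℝ) / 2) : ℝ) : ℂ))) *
        (((4 * (Real.pi ^ 2 / b) ^ 2 * kronSum j k l w - 8 * (Real.pi ^ 2 / b) ^ 3 * (w j * w k * w l)) *
          Real.exp (-(Real.pi ^ 2 / b) * ‖w‖ ^ 2) : ℝ) : ℂ) := by
  have hb1 : ∀ x : Vec d, ‖(x k : ℂ) * ((x l : ℂ) * ((Real.exp (-b * ‖x‖ ^ 2) : ℝ) : ℂ))‖ ≤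
      ‖x‖ ^ 2 * Real.exp (-b * ‖x‖ ^ 2) := fun x => by
    rw [norm_mul, norm_mul, Complex.norm_real, Complex.norm_real, Complex.norm_real, Real.norm_eq_abs,
      Real.norm_eq_abs, Real.norm_eq_abs,
      abs_of_pos (Real.exp_pos _), sq, mul_assoc]
    gcongr <;> exact abs_coord_le x _
  have h1 : Integrable fun x : Vec d => (x k : ℂ) * ((x l : ℂ) * ((Real.exp (-b * ‖x‖ ^ 2) : ℝ) : ℂ)) :=
    Integrable.mono' (integrable_pow_mul_gaussian (d := d) hb 2)
      (by fun_prop) (Eventually.of_forall hb1)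
  have h2 : Integrable fun x : Vec d =>
      ‖x‖ * ‖(x k : ℂ) * ((x l : ℂ) * ((Real.exp (-b * ‖x‖ ^ 2) : ℝ) : ℂ))‖ := by
    refine Integrable.mono' (integrable_pow_mul_gaussian (d := d) hb 3)
      (by fun_prop) (Eventually.of_forall fun x => ?_)
    rw [Real.norm_of_nonneg (by positivity), pow_succ' _ 2, mul_assoc]
    gcongr; exact hb1 x
  rw [fourier_coord_mul h1 h2
    (P := fun w => 4 * (Real.pi ^ 2 / b) ^ 2 * (w k * w l) - 2 * (Real.pi ^ 2 / b) * kron l k)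
    (P' := fun w => (4 * (Real.pi ^ 2 / b) ^ 2) • (w k • coordL l + w l • coordL k))
    (fun w => (((hasFDerivAt_coord k w).mul (hasFDerivAt_coord l w)).const_mul _).sub_const _)
    (fourier_gaussian_coord_coord hb k l) j]
  funext w
  congr 2
  have hs : ∀ a b : Fin d, kron a b = kron b a := fun a b => by simp [kron, eq_comm]
  simp only [smul_apply, add_apply, coordL_single, smul_eq_mul, kronSum, hs k j, hs l j, hs l k]
  ring

lemma integrable_coord_gaussian {b : ℝ} (hb : 0 < b) (l : Fin d) :
    Integrable fun x : Vec d => (x l : ℂ) * ((Real.exp (-b * ‖x‖ ^ 2) : ℝ) : ℂ) := by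
  refine Integrable.mono' (integrable_pow_mul_gaussian (d := d) hb 1)
    (by fun_prop) (Eventually.of_forall fun x => ?_)
  rw [norm_mul, Complex.norm_real, Complex.norm_real, Real.norm_eq_abs, Real.norm_eq_abs,
    abs_of_pos (Real.exp_pos _), pow_one]
  gcongr; exact abs_coord_le x l

lemma integrable_coord_coord_coord_gaussian {b : ℝ} (hb : 0 < b) (j k l : Fin d) :
    Integrable fun x : Vec d => (x j : ℂ) * ((x k : ℂ) * ((x l : ℂ) * ((Real.exp (-b * ‖x‖ ^ 2) : ℝ) : ℂ))) := by
  refine Integrable.mono' (integrable_pow_mul_gaussian (d := d) hb 3)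
    (by fun_prop) (Eventually.of_forall fun x => ?_)
  simp only [norm_mul, Complex.norm_real, Real.norm_eq_abs, abs_of_pos (Real.exp_pos _)]
  rw [pow_three', mul_assoc, mul_assoc]
  gcongr <;> exact abs_coord_le x _

/-- `heatStokes` as a combination of Gaussian moments. -/
lemma heatStokes_eq (α : ℝ) (j k l : Fin d) {t : ℝ} (ht : 0 < t) :
    (fun x => ((heatStokes α j k l t x : ℝ) : ℂ)) = fun x : Vec d =>
      (((4 * Real.pi) ^ (-((d : ℝ) / 2)) * t ^ (α - (d : ℝ) / 2) : ℝ) : ℂ) *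
      (((((kron j k * (1 / (4 * Real.Gamma (α + 1)) - 1 / (2 * Real.Gamma α)) / t ^ 2 : ℝ) : ℂ) *
        ((x l : ℂ) * ((Real.exp (-(1 / (4 * t)) * ‖x‖ ^ 2) : ℝ) : ℂ)) +
      ((kron j l * (1 / (4 * Real.Gamma (α + 1))) / t ^ 2 : ℝ) : ℂ) *
        ((x k : ℂ) * ((Real.exp (-(1 / (4 * t)) * ‖x‖ ^ 2) : ℝ) : ℂ))) +
      ((kron k l * (1 / (4 * Real.Gamma (α + 1))) / t ^ 2 : ℝ) : ℂ) *
        ((x j : ℂ) * ((Real.exp (-(1 / (4 * t)) * ‖x‖ ^ 2) : ℝ) : ℂ))) +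
      ((-(1 / (8 * Real.Gamma (α + 1))) / t ^ 3 : ℝ) : ℂ) *
        ((x j : ℂ) * ((x k : ℂ) * ((x l : ℂ) * ((Real.exp (-(1 / (4 * t)) * ‖x‖ ^ 2) : ℝ) : ℂ))))) := by
  funext x
  unfold heatStokes heatCoef kronSum
  have e1 : t ^ (-((d : ℝ) / 2 + 1 - α) - 1) = t ^ (α - (d : ℝ) / 2) / t ^ 2 := by
    rw [← Real.rpow_natCast t 2, ← Real.rpow_sub ht]; congr 1; push_cast; ring
  have e2 : t ^ (-((d : ℝ) / 2 + 2 - α) - 1) = t ^ (α - (d : ℝ) / 2) / t ^ 3 := by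
    rw [← Real.rpow_natCast t 3, ← Real.rpow_sub ht]; congr 1; push_cast; ring
  have e3 : -(‖x‖ ^ 2 / 4 / t) = -(1 / (4 * t)) * ‖x‖ ^ 2 := by field_simp
  rw [e1, e2, e3]
  norm_cast
  ring

lemma integrable_heatStokes (α : ℝ) (j k l : Fin d) {t : ℝ} (ht : 0 < t) :
    Integrable fun x : Vec d => ((heatStokes α j k l t x : ℝ) : ℂ) := by
  have hb : 0 < 1 / (4 * t) := by positivity
  rw [heatStokes_eq α j k l ht]
  exact (((((integrable_coord_gaussian hb l).const_mul _).add
    ((integrable_coord_gaussian hb k).const_mul _)).add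
    ((integrable_coord_gaussian hb j).const_mul _)).add
    ((integrable_coord_coord_coord_gaussian hb j k l).const_mul _)).const_mul _

/-- Here the Gaussian has parameter `b = 1 / (4t)`. The `kronSum` terms of the third moment cancel
against those of the first moments, leaving the transforms of `δ_{jk} D_l g_t` and `D_j D_k D_l
g_t`; the powers of `4π` and the factors `t^{d/2}` cancel with the Gaussian normalization. -/
lemma fourier_heatStokes {α : ℝ} (hα : 0 < α) (j k l : Fin d) {t : ℝ} (ht : 0 < t) (ξ : Vec d) :
    𝓕 (fun x : Vec d => ((heatStokes α j k l t x : ℝ) : ℂ)) ξ =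
      Complex.I * ((heatSymbol α j k l t ξ : ℝ) : ℂ) := by
  have hb : 0 < 1 / (4 * t) := by positivity
  rw [heatStokes_eq α j k l ht, fourier_fun_const_mul, fourier_fun_add, fourier_fun_add, fourier_fun_add,
    fourier_fun_const_mul, fourier_fun_const_mul, fourier_fun_const_mul, fourier_fun_const_mul,
    fourier_gaussian_coord hb, fourier_gaussian_coord hb, fourier_gaussian_coord hb,
    fourier_gaussian_coord_coord_coord hb]
  · have e1 : t ^ (α - 1) = t ^ α / t := Real.rpow_sub_one ht.ne' α
    have e2 : t ^ (α + 1 - 1) = t ^ α := by congr 1; ring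
    have e3 : -(Real.pi ^ 2 / (1 / (4 * t))) * ‖ξ‖ ^ 2 = -(4 * Real.pi ^ 2 * ‖ξ‖ ^ 2 * t) := by
      field_simp
    have e4 : (4 * Real.pi) ^ (-((d : ℝ) / 2)) * t ^ (α - (d : ℝ) / 2) *
        (Real.pi / (1 / (4 * t))) ^ ((d : ℝ) / 2) = t ^ α := by
      rw [show Real.pi / (1 / (4 * t)) = (4 * Real.pi) * t by field_simp,
        Real.mul_rpow (by positivity) ht.le, Real.rpow_neg (by positivity), Real.rpow_sub ht]
      have : 0 < (4 * Real.pi) ^ ((d : ℝ) / 2) := by positivity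
      have : 0 < t ^ ((d : ℝ) / 2) := by positivity
      field_simp
    have e5 : (((Real.pi / (1 / (4 * t))) ^ ((d : ℝ) / 2) : ℝ) : ℂ) *
        ((4 * Real.pi) ^ (-((d : ℝ) / 2)) * t ^ (α - (d : ℝ) / 2) : ℝ) = ((t ^ α : ℝ) : ℂ) := by
      rw [← e4]; push_cast; ring
    unfold heatSymbol kronSum
    rw [e1, e2]
    have hG := (Real.Gamma_pos_of_pos hα).ne'
    have hpi := Real.pi_ne_zero
    beta_reduce
    rw [Real.Gamma_add_one hα.ne', e3]
    generalize (Real.pi / (1 / (4 * t))) ^ ((d : ℝ) / 2) = Z at *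
    generalize (4 * Real.pi) ^ (-((d : ℝ) / 2)) * t ^ (α - (d : ℝ) / 2) = X at *
    rw [← e4]
    generalize Real.exp (-(4 * Real.pi ^ 2 * ‖ξ‖ ^ 2 * t)) = E at *
    generalize Real.Gamma α = G at *
    have hG' : (G : ℂ) ≠ 0 := by exact_mod_cast hG
    have hpi' : (Real.pi : ℂ) ≠ 0 := by exact_mod_cast hpi
    have ht' : (t : ℂ) ≠ 0 := by exact_mod_cast ht.ne'
    have hα' : (α : ℂ) ≠ 0 := by exact_mod_cast hα.ne'
    push_cast
    field_simp
    rw [Complex.I_sq]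
    ring
  · exact (integrable_coord_gaussian hb l).const_mul _
  · exact (integrable_coord_gaussian hb k).const_mul _
  · exact ((integrable_coord_gaussian hb l).const_mul _).add ((integrable_coord_gaussian hb k).const_mul _)
  · exact (integrable_coord_gaussian hb j).const_mul _
  · exact (((integrable_coord_gaussian hb l).const_mul _).add
      ((integrable_coord_gaussian hb k).const_mul _)).add ((integrable_coord_gaussian hb j).const_mul _)
  · exact (integrable_coord_coord_coord_gaussian hb j k l).const_mul _

end HeatSymbol

/-! ### The Fourier symbol of the Stokes kernel, by Fubini in time -/

section Subordinate

variable {d : ℕ} [NeZero d]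

/-- The Fourier symbol of the Stokes kernel, up to the factor `i`. -/
def stokesSymbol (α : ℝ) (j k l : Fin d) (ξ : Vec d) : ℝ :=
  (2 * Real.pi * ‖ξ‖) ^ (-(2 * α)) * (2 * Real.pi * ξ l) * (kron j k - ξ j * ξ k / ‖ξ‖ ^ 2)

omit [NeZero d] in
lemma rpow_heat_rate {ξ : Vec d} (α : ℝ) :
    (4 * Real.pi ^ 2 * ‖ξ‖ ^ 2) ^ (-α) = (2 * Real.pi * ‖ξ‖) ^ (-(2 * α)) := by
  rw [show -(2 * α) = 2 * (-α) by ring, Real.rpow_mul (by positivity)]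
  congr 1
  rw [show (2 : ℝ) = ((2 : ℕ) : ℝ) by norm_num, Real.rpow_natCast]
  push_cast; ring

-- With `r = 4π²‖ξ‖²` the two Gamma integrals give `r^{-α}` and `r^{-α-1}`; the extra `r⁻¹` turns
-- the cubic term into the correction `ξ_j ξ_k / ‖ξ‖²` of the projection.
omit [NeZero d] in
lemma integral_heatSymbol {α : ℝ} (hα : 0 < α) (j k l : Fin d) {ξ : Vec d} (hξ : ξ ≠ 0) :
    ∫ t in Set.Ioi 0, heatSymbol α j k l t ξ = stokesSymbol α j k l ξ := by
  have hn := norm_pos_iff.2 hξ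
  have hr : 0 < 4 * Real.pi ^ 2 * ‖ξ‖ ^ 2 := by positivity
  have hG : 0 < Real.Gamma α := Real.Gamma_pos_of_pos hα
  unfold heatSymbol
  rw [integral_sub ((integrableOn_rpow_mul_exp hα hr).const_mul _)
    ((integrableOn_rpow_mul_exp (by linarith : 0 < α + 1) hr).const_mul _), integral_const_mul,
    integral_const_mul, Real.integral_rpow_mul_exp_neg_mul_Ioi hα hr,
    Real.integral_rpow_mul_exp_neg_mul_Ioi (by linarith : 0 < α + 1) hr, one_div,
    Real.inv_rpow hr.le, Real.inv_rpow hr.le, ← Real.rpow_neg hr.le, ← Real.rpow_neg hr.le, neg_add,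
    ← sub_eq_add_neg, Real.rpow_sub_one hr.ne', rpow_heat_rate, Real.Gamma_add_one hα.ne']
  unfold stokesSymbol
  field_simp
  ring

omit [NeZero d] in
lemma measurable_heatSymbol (α : ℝ) (j k l : Fin d) :
    Measurable fun p : ℝ × Vec d => heatSymbol α j k l p.1 p.2 := by
  have h : ∀ i : Fin d, Measurable fun p : ℝ × Vec d => p.2 i := fun i =>
    (coordL i).measurable.comp measurable_snd
  unfold heatSymbol
  have h1 := h j
  have h2 := h k
  have h3 := h l
  fun_prop

omit [NeZero d] in
/-- `∫ |heatSymbol| dt ≤ C |ξ|^{1-2α}`. -/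
lemma integrableOn_heatSymbol {α : ℝ} (hα : 0 < α) :
    ∃ C : ℝ, 0 ≤ C ∧ ∀ (j k l : Fin d) (ξ : Vec d), ξ ≠ 0 →
      IntegrableOn (fun t => heatSymbol α j k l t ξ) (Set.Ioi 0) ∧
      ∫ t in Set.Ioi 0, ‖heatSymbol α j k l t ξ‖ ≤ C * ‖ξ‖ ^ (1 - 2 * α) := by
  have hα1 : 0 < α + 1 := by linarith
  have hG : 0 < Real.Gamma α := Real.Gamma_pos_of_pos hα
  have hG' : 0 < Real.Gamma (α + 1) := Real.Gamma_pos_of_pos hα1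
  refine ⟨(2 * Real.pi) ^ (-(2 * α)) * (4 * Real.pi), by positivity, fun j k l ξ hξ => ?_⟩
  have hn := norm_pos_iff.2 hξ
  have hr : 0 < 4 * Real.pi ^ 2 * ‖ξ‖ ^ 2 := by positivity
  set r := 4 * Real.pi ^ 2 * ‖ξ‖ ^ 2 with hr_def
  have hdom : IntegrableOn (fun t : ℝ =>
      2 * Real.pi * ‖ξ‖ / Real.Gamma α * (t ^ (α - 1) * Real.exp (-(r * t))) +
      8 * Real.pi ^ 3 * ‖ξ‖ ^ 3 / Real.Gamma (α + 1) * (t ^ (α + 1 - 1) * Real.exp (-(r * t)))) (Set.Ioi 0) :=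
    ((integrableOn_rpow_mul_exp hα hr).const_mul _).add ((integrableOn_rpow_mul_exp hα1 hr).const_mul _)
  have hle : ∀ᵐ t ∂(volume.restrict (Set.Ioi (0 : ℝ))), ‖heatSymbol α j k l t ξ‖ ≤
      2 * Real.pi * ‖ξ‖ / Real.Gamma α * (t ^ (α - 1) * Real.exp (-(r * t))) +
      8 * Real.pi ^ 3 * ‖ξ‖ ^ 3 / Real.Gamma (α + 1) * (t ^ (α + 1 - 1) * Real.exp (-(r * t))) := by
    refine (ae_restrict_mem measurableSet_Ioi).mono fun t ht => ?_
    have ht0 : 0 < t := ht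
    unfold heatSymbol
    rw [← hr_def]
    set A := t ^ (α - 1) * Real.exp (-(r * t))
    set B := t ^ (α + 1 - 1) * Real.exp (-(r * t))
    have hA : 0 ≤ A := by positivity
    have hB : 0 ≤ B := by positivity
    refine (abs_sub _ _).trans (add_le_add ?_ ?_)
    · rw [abs_mul _ A, abs_of_nonneg hA, abs_div, abs_of_pos hG, mul_assoc (2 * Real.pi), abs_mul,
        abs_of_pos Real.two_pi_pos]
      gcongr
      exact abs_kron_mul_le j k l ξ
    · rw [abs_mul _ B, abs_of_nonneg hB, abs_div, abs_of_pos hG', abs_mul,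
        abs_of_pos (show 0 < 8 * Real.pi ^ 3 by positivity)]
      gcongr
      exact abs_coord_mul_coord_mul_coord_le j k l ξ
  have hint : IntegrableOn (fun t => heatSymbol α j k l t ξ) (Set.Ioi 0) :=
    Integrable.mono' hdom
      ((measurable_heatSymbol α j k l).comp (measurable_id.prodMk measurable_const)).aestronglyMeasurable hle
  refine ⟨hint, (integral_mono_ae hint.norm hdom hle).trans (le_of_eq ?_)⟩
  rw [integral_add ((integrableOn_rpow_mul_exp hα hr).const_mul _)
      ((integrableOn_rpow_mul_exp hα1 hr).const_mul _), integral_const_mul, integral_const_mul,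
    Real.integral_rpow_mul_exp_neg_mul_Ioi hα hr,
    Real.integral_rpow_mul_exp_neg_mul_Ioi hα1 hr, one_div,
    Real.inv_rpow hr.le, Real.inv_rpow hr.le, ← Real.rpow_neg hr.le, ← Real.rpow_neg hr.le, neg_add,
    ← sub_eq_add_neg, Real.rpow_sub_one hr.ne', hr_def, rpow_heat_rate,
    Real.mul_rpow Real.two_pi_pos.le (norm_nonneg ξ), Real.rpow_sub hn, Real.rpow_one,
    Real.rpow_neg (norm_nonneg ξ)]
  have : 0 < ‖ξ‖ ^ (2 * α) := by positivity
  field_simp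
  ring

/-- Fubini for a family of multipliers dominated by a power of the norm. -/
lemma integrable_subordinate {m : ℝ → Vec d → ℝ} (hm : Measurable fun p : ℝ × Vec d => m p.1 p.2)
    {s C : ℝ} (hC : ∀ x : Vec d, x ≠ 0 → IntegrableOn (fun t => m t x) (Set.Ioi 0) ∧
      ∫ t in Set.Ioi 0, ‖m t x‖ ≤ C * ‖x‖ ^ s)
    {g : Vec d → ℂ} (hg : AEStronglyMeasurable g) (hint : Integrable fun x => ‖x‖ ^ s * ‖g x‖) :
    Integrable (fun p : ℝ × Vec d => (m p.1 p.2 : ℂ) * g p.2) ((volume.restrict (Set.Ioi 0)).prod volume) := by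
  have hmeas : AEStronglyMeasurable (fun p : ℝ × Vec d => (m p.1 p.2 : ℂ) * g p.2)
      ((volume.restrict (Set.Ioi 0)).prod volume) :=
    (Complex.measurable_ofReal.comp hm).aestronglyMeasurable.mul hg.comp_snd
  rw [integrable_prod_iff' hmeas]
  constructor
  · filter_upwards [ae_ne_zero (d := d)] with x hx
    exact (hC x hx).1.ofReal.mul_const _
  · refine Integrable.mono' (hint.const_mul C) hmeas.norm.prod_swap.integral_prod_right' ?_
    filter_upwards [ae_ne_zero (d := d)] with x hx
    rw [Real.norm_of_nonneg (integral_nonneg fun t => norm_nonneg _)]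
    simp only [norm_mul, Complex.norm_real]
    rw [integral_mul_const, ← mul_assoc]
    exact mul_le_mul_of_nonneg_right (hC x hx).2 (norm_nonneg _)

lemma integral_subordinate {m : ℝ → Vec d → ℝ} (hm : Measurable fun p : ℝ × Vec d => m p.1 p.2)
    {s C : ℝ} (hC : ∀ x : Vec d, x ≠ 0 → IntegrableOn (fun t => m t x) (Set.Ioi 0) ∧
      ∫ t in Set.Ioi 0, ‖m t x‖ ≤ C * ‖x‖ ^ s)
    {M : Vec d → ℝ} (hM : ∀ x : Vec d, x ≠ 0 → ∫ t in Set.Ioi 0, m t x = M x)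
    {g : Vec d → ℂ} (hg : AEStronglyMeasurable g) (hint : Integrable fun x => ‖x‖ ^ s * ‖g x‖) :
    ∫ x, (M x : ℂ) * g x = ∫ t in Set.Ioi 0, ∫ x, (m t x : ℂ) * g x := by
  rw [integral_integral_swap (integrable_subordinate hm hC hg hint)]
  refine integral_congr_ae ?_
  filter_upwards [ae_ne_zero (d := d)] with x hx
  rw [integral_mul_const, ← hM x hx, integral_complex_ofReal]

lemma integrable_rpow_norm_mul_of_bound {s : ℝ} (hs : -(d : ℝ) < s) (hs0 : s ≤ 0) {f : Vec d → ℂ}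
    (hf : Integrable f) {B : ℝ} (hB : ∀ x, ‖f x‖ ≤ B) : Integrable fun x => ‖x‖ ^ s * ‖f x‖ := by
  have h1 := (integrableOn_ball_rpow_norm hs 1)
  rw [← integrable_indicator_iff measurableSet_ball] at h1
  refine Integrable.mono' ((h1.mul_const B).add hf.norm) ?_ (Eventually.of_forall fun x => ?_)
  · have : Measurable fun x : Vec d => ‖x‖ ^ s := by fun_prop
    exact this.aestronglyMeasurable.mul hf.aestronglyMeasurable.norm
  · rw [Real.norm_of_nonneg (by positivity)]
    simp only [Pi.add_apply]
    have hB0 : 0 ≤ B := (norm_nonneg _).trans (hB x)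
    by_cases hx : x ∈ Metric.ball (0 : Vec d) 1
    · rw [Set.indicator_of_mem hx]
      have := mul_le_mul_of_nonneg_left (hB x) (show 0 ≤ ‖x‖ ^ s by positivity)
      linarith [norm_nonneg (f x)]
    · rw [Set.indicator_of_notMem hx, zero_mul, zero_add]
      have hx' : 1 ≤ ‖x‖ := by simpa using hx
      exact mul_le_of_le_one_left (norm_nonneg _) (Real.rpow_le_one_of_one_le_of_nonpos hx' hs0)

-- The multiplication formula for the Fourier transform, applied to `A` and to `h` modulated by the
-- character of `x`.
omit [NeZero d] in
lemma integral_mul_fourierInv_sub {A h : Vec d → ℂ} (hA : Integrable A) (hh : Integrable h) (x : Vec d) :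
    ∫ z, A z * 𝓕⁻ h (x - z) = ∫ ξ, 𝓕 A ξ * (Real.fourierChar (inner ℝ ξ x) • h ξ) := by
  have h1 := VectorFourier.integral_fourierIntegral_smul_eq_flip (L := innerₗ (Vec d)) (μ := (volume : Measure (Vec d)))
    (ν := (volume : Measure (Vec d)))
    Real.continuous_fourierChar continuous_inner hA (integrable_fourierChar_smul hh x)
  refine Eq.trans ?_ h1.symm
  refine integral_congr_ae (Eventually.of_forall fun z => ?_)
  simp only [smul_eq_mul]
  congr 1
  rw [Real.fourierInv_eq, VectorFourier.fourierIntegral]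
  refine integral_congr_ae (Eventually.of_forall fun ξ => ?_)
  simp only [smul_smul]
  congr 1
  rw [← AddChar.map_add_eq_mul]
  congr 1
  simp [inner_sub_right]
  ring

/-- Both sides are integrals over `t`, and for each fixed `t` the identity concerns an integrable
Gaussian expression. Integrability of `‖ξ‖^{1-2α} h` justifies Fubini on the frequency side; on the
other side integrability and boundedness of `𝓕⁻ h` do. It plays the role of the distributional
Fourier transform of `U_α`. -/
lemma integral_stokesKernel_mul_fourierInv {α : ℝ} (hα : 1 / 2 < α) (hα' : α < ((d : ℝ) + 1) / 2) (j k l : Fin d)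
    {h : Vec d → ℂ} (hh : Integrable h) (hh' : Integrable fun ξ => ‖ξ‖ ^ (1 - 2 * α) * ‖h ξ‖)
    (hf : Integrable (𝓕⁻ h)) (x : Vec d) :
    ∫ z, (stokesKernel d α j k l z : ℂ) * 𝓕⁻ h (x - z) =
      𝓕⁻ (fun ξ => Complex.I * (stokesSymbol α j k l ξ : ℂ) * h ξ) x := by
  have hα0 : 0 < α := by linarith
  obtain ⟨C, -, hC⟩ := integrableOn_heatStokes (d := d) hα0 hα'
  obtain ⟨C', -, hC'⟩ := integrableOn_heatSymbol (d := d) hα0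
  have hfx : Integrable fun z => 𝓕⁻ h (x - z) := hf.comp_sub_left x
  have e1 := integral_subordinate (measurable_heatStokes α j k l) (hC j k l)
    (fun x hx => integral_heatStokes hα0 hα' j k l hx) hfx.aestronglyMeasurable
    (integrable_rpow_norm_mul_of_bound (s := 2 * α - 1 - d) (by linarith) (by linarith) hfx
      (fun z => norm_fourierInv_le h (x - z)))
  have e2 := integral_subordinate (measurable_heatSymbol α j k l) (hC' j k l)
    (fun x hx => integral_heatSymbol hα0 j k l hx) (integrable_fourierChar_smul hh x).aestronglyMeasurable
    (by simpa only [Circle.norm_smul] using hh')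
  rw [e1, Real.fourierInv_eq]
  have e3 : ∀ t ∈ Set.Ioi (0 : ℝ), ∫ z, (heatStokes α j k l t z : ℂ) * 𝓕⁻ h (x - z) =
      Complex.I * ∫ ξ, (heatSymbol α j k l t ξ : ℂ) * (Real.fourierChar (inner ℝ ξ x) • h ξ) := by
    intro t ht
    rw [integral_mul_fourierInv_sub (integrable_heatStokes α j k l ht) hh, ← integral_const_mul]
    simp only [fourier_heatStokes hα0 j k l ht, mul_assoc]
  rw [setIntegral_congr_fun measurableSet_Ioi e3, integral_const_mul, ← e2, ← integral_const_mul]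
  refine integral_congr_ae (Eventually.of_forall fun ξ => ?_)
  simp only [Circle.smul_def, smul_eq_mul]
  ring

end Subordinate

/-! ### Convolution with the Stokes kernel on `L^p` -/

section KernelConvolution

variable {d : ℕ} [NeZero d]

/-- The standing assumptions on the exponents. -/
structure Exponents (d : ℕ) (α p q : ℝ) : Prop where
  half_lt : 1 / 2 < α
  lt_half : α < ((d : ℝ) + 1) / 2
  one_lt : 1 < p
  lt_div : p < d / (2 * α - 1)
  eq : 1 / q = 1 / p - (2 * α - 1) / d

namespace Exponents

variable {α p q : ℝ}

omit [NeZero d] in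
lemma order_lt (e : Exponents d α p q) : 2 * α - 1 < d := by linarith [e.lt_half]

omit [NeZero d] in
lemma order_lt_div (e : Exponents d α p q) : 2 * α - 1 < d / p := by
  have h1 : 0 < 2 * α - 1 := by linarith [e.half_lt]
  have h2 : 0 < p := by linarith [e.one_lt]
  have := (lt_div_iff₀ h1).1 e.lt_div
  rw [lt_div_iff₀ h2]
  linarith

lemma one_lt_right (e : Exponents d α p q) : 1 < q := by
  have h1 : 0 < 2 * α - 1 := by linarith [e.half_lt]
  have h2 : 0 < p := by linarith [e.one_lt]
  have hd : (0 : ℝ) < d := by exact_mod_cast Nat.pos_of_neZero d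
  have h3 : 0 < 1 / q := by
    rw [e.eq, sub_pos, div_lt_div_iff₀ hd h2]
    have := (lt_div_iff₀ h2).1 e.order_lt_div
    linarith
  have h4 : 1 / q < 1 := by
    rw [e.eq]
    have : 1 / p < 1 := by rw [div_lt_one h2]; exact e.one_lt
    have : 0 < (2 * α - 1) / d := by positivity
    linarith
  have h5 : 0 < q := by simpa using h3
  rwa [div_lt_one h5] at h4

end Exponents

omit [NeZero d] in
lemma measurable_rieszPot (γ : ℝ) {f : Vec d → ℝ≥0∞} (hf : Measurable f) : Measurable (rieszPot γ f) :=
  Measurable.lintegral_prod_right' (f := fun p : Vec d × Vec d => ENNReal.ofReal (‖p.1 - p.2‖ ^ (γ - d)) * f p.2)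
    (by fun_prop)

omit [NeZero d] in
lemma rieszPot_congr (γ : ℝ) {f g : Vec d → ℝ≥0∞} (h : f =ᵐ[volume] g) : rieszPot γ f = rieszPot γ g := by
  funext x
  refine lintegral_congr_ae ?_
  filter_upwards [h] with y hy
  rw [hy]

omit [NeZero d] in
lemma rieszPot_enorm_eq_mk (γ : ℝ) {G : Vec d → ℝ} (hG : AEStronglyMeasurable G) :
    rieszPot γ (fun x => ‖G x‖ₑ) = rieszPot γ (fun x => ‖hG.mk G x‖ₑ) :=
  rieszPot_congr γ (hG.ae_eq_mk.mono fun x hx => by beta_reduce; rw [hx])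

omit [NeZero d] in
lemma measurable_rieszPot_enorm (γ : ℝ) {G : Vec d → ℝ} (hG : AEStronglyMeasurable G) :
    Measurable (rieszPot γ fun x => ‖G x‖ₑ) := by
  rw [rieszPot_enorm_eq_mk γ hG]
  exact measurable_rieszPot γ hG.stronglyMeasurable_mk.measurable.enorm

variable {α p q : ℝ}

lemma eLpNorm_rieszPot_le (e : Exponents d α p q) : ∃ C : ℝ≥0, ∀ G : Vec d → ℝ, AEStronglyMeasurable G →
    eLpNorm (rieszPot (2 * α - 1) fun x => ‖G x‖ₑ) (ENNReal.ofReal q) volume ≤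
      C * eLpNorm G (ENNReal.ofReal p) volume := by
  obtain ⟨C, hCt, hC⟩ := lintegral_rieszPot_rpow_le (d := d) (by linarith [e.half_lt]) e.order_lt e.one_lt
    e.order_lt_div e.eq
  have hp0 : 0 < p := by linarith [e.one_lt]
  have hq0 : 0 < q := by linarith [e.one_lt_right]
  lift C to ℝ≥0 using hCt
  refine ⟨C ^ (1 / q), fun G hG => ?_⟩
  rw [eLpNorm_eq_lintegral_rpow_enorm_toReal (by simpa using hq0) ENNReal.ofReal_ne_top,
    eLpNorm_eq_lintegral_rpow_enorm_toReal (by simpa using hp0) ENNReal.ofReal_ne_top,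
    ENNReal.toReal_ofReal hp0.le, ENNReal.toReal_ofReal hq0.le, rieszPot_enorm_eq_mk _ hG]
  simp only [enorm_eq_self]
  have h1 := hC _ hG.stronglyMeasurable_mk.measurable.enorm
  have h2 : ∫⁻ x, ‖hG.mk G x‖ₑ ^ p = ∫⁻ x, ‖G x‖ₑ ^ p :=
    lintegral_congr_ae (hG.ae_eq_mk.mono fun x hx => by beta_reduce; rw [hx])
  rw [h2] at h1
  refine (ENNReal.rpow_le_rpow h1 (by positivity)).trans (le_of_eq ?_)
  rw [ENNReal.mul_rpow_of_nonneg _ _ (by positivity), ← ENNReal.rpow_mul,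
    ENNReal.coe_rpow_of_nonneg _ (by positivity)]
  congr 2
  field_simp

omit [NeZero d] in
lemma measurable_stokesKernel (α : ℝ) (j k l : Fin d) : Measurable (stokesKernel d α j k l) := by
  have h := (coordL (d := d) l).measurable
  have h' : Measurable fun x : Vec d => x l := h
  unfold stokesKernel pd
  have := measurable_fderiv_apply_const ℝ (fun y : Vec d => y j * y k / ‖y‖ ^ ((d : ℝ) + 2 - 2 * α))
    (EuclideanSpace.single l 1)
  fun_prop

-- Each time slice is an odd function of `x`. Oddness produces the sign when the convolution is
-- transposed onto a test function.
omit [NeZero d] in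
lemma stokesKernel_neg {α : ℝ} (hα : 0 < α) (hα' : α < ((d : ℝ) + 1) / 2) (j k l : Fin d) {x : Vec d}
    (hx : x ≠ 0) : stokesKernel d α j k l (-x) = -stokesKernel d α j k l x := by
  rw [← integral_heatStokes hα hα' j k l hx, ← integral_heatStokes hα hα' j k l (neg_ne_zero.2 hx),
    ← integral_neg]
  congr 1
  funext t
  simp only [heatStokes, heatCoef, kronSum, norm_neg, PiLp.neg_apply]
  ring

lemma lintegral_stokesKernel_le (e : Exponents d α p q) : ∃ C : ℝ≥0, ∀ (j k l : Fin d) (G : Vec d → ℝ) (x : Vec d),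
    ∫⁻ y, ‖stokesKernel d α j k l (x - y)‖ₑ * ‖G y‖ₑ ≤ C * rieszPot (2 * α - 1) (fun x => ‖G x‖ₑ) x := by
  obtain ⟨C, hC0, hC⟩ := abs_stokesKernel_le (d := d) (by linarith [e.half_lt] : 0 < α) e.lt_half
  refine ⟨C.toNNReal, fun j k l G x => ?_⟩
  rw [rieszPot, ← lintegral_const_mul' _ _ ENNReal.coe_ne_top]
  refine lintegral_mono_ae ?_
  filter_upwards [Measure.ae_ne volume x] with y hy
  rw [← mul_assoc]
  gcongr
  rw [← ofReal_norm, Real.norm_eq_abs]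
  refine (ENNReal.ofReal_le_ofReal (hC j k l (x - y) (sub_ne_zero.2 hy.symm))).trans (le_of_eq ?_)
  rw [ENNReal.ofReal_mul hC0]
  rfl

lemma rieszPot_lt_top_ae (e : Exponents d α p q) {G : Vec d → ℝ} (hG : MemLp G (ENNReal.ofReal p)) :
    ∀ᵐ x, rieszPot (2 * α - 1) (fun x => ‖G x‖ₑ) x < ⊤ := by
  obtain ⟨C, hC⟩ := eLpNorm_rieszPot_le e
  have hq0 : 0 < q := by linarith [e.one_lt_right]
  have h1 : eLpNorm (rieszPot (2 * α - 1) fun x => ‖G x‖ₑ) (ENNReal.ofReal q) volume < ⊤ :=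
    (hC G hG.1).trans_lt (ENNReal.mul_lt_top ENNReal.coe_lt_top hG.2)
  have h2 := lintegral_rpow_enorm_lt_top_of_eLpNorm_lt_top (by simpa using hq0) ENNReal.ofReal_ne_top h1
  rw [ENNReal.toReal_ofReal hq0.le] at h2
  simp only [enorm_eq_self] at h2
  filter_upwards [ae_lt_top ((measurable_rieszPot_enorm _ hG.1).pow_const q) h2.ne] with x hx
  exact (ENNReal.rpow_lt_top_iff_of_pos hq0).1 hx

omit [NeZero d] in
lemma lintegral_convolution_swap (K G : Vec d → ℝ) (x : Vec d) :
    ∫⁻ t, ‖K t * G (x - t)‖ₑ = ∫⁻ y, ‖K (x - y)‖ₑ * ‖G y‖ₑ := by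
  rw [← lintegral_sub_left_eq_self (fun y => ‖K (x - y)‖ₑ * ‖G y‖ₑ) x]
  simp

lemma convolutionExistsAt_stokesKernel (e : Exponents d α p q) {G : Vec d → ℝ} (hG : MemLp G (ENNReal.ofReal p)) :
    ∀ᵐ x, ∀ j k l, ConvolutionExistsAt (stokesKernel d α j k l) G x (ContinuousLinearMap.mul ℝ ℝ) volume := by
  obtain ⟨C, hC⟩ := lintegral_stokesKernel_le e
  filter_upwards [rieszPot_lt_top_ae e hG] with x hx j k l
  refine ⟨(measurable_stokesKernel α j k l).aestronglyMeasurable.convolution_integrand_snd _ hG.1 x, ?_⟩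
  rw [hasFiniteIntegral_iff_enorm]
  simp only [ContinuousLinearMap.mul_apply']
  rw [lintegral_convolution_swap]
  exact (hC j k l G x).trans_lt (ENNReal.mul_lt_top ENNReal.coe_lt_top hx)

lemma eLpNorm_stokesKernel_convolution_le (e : Exponents d α p q) : ∃ C : ℝ≥0, ∀ (j k l : Fin d) (G : Vec d → ℝ),
    AEStronglyMeasurable G →
    AEStronglyMeasurable (stokesKernel d α j k l ⋆[ContinuousLinearMap.mul ℝ ℝ, volume] G) ∧
    eLpNorm (stokesKernel d α j k l ⋆[ContinuousLinearMap.mul ℝ ℝ, volume] G) (ENNReal.ofReal q) volume ≤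
      C * eLpNorm G (ENNReal.ofReal p) volume := by
  obtain ⟨C, hC⟩ := lintegral_stokesKernel_le e
  obtain ⟨C', hC'⟩ := eLpNorm_rieszPot_le e
  refine ⟨C * C', fun j k l G hG => ⟨?_, ?_⟩⟩
  · exact ((measurable_stokesKernel α j k l).aestronglyMeasurable.convolution_integrand
      (ContinuousLinearMap.mul ℝ ℝ) hG).integral_prod_right'
  · have h1 : ∀ x, ‖(stokesKernel d α j k l ⋆[ContinuousLinearMap.mul ℝ ℝ, volume] G) x‖ₑ ≤
        C * ‖rieszPot (2 * α - 1) (fun x => ‖G x‖ₑ) x‖ₑ := fun x => by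
      rw [enorm_eq_self]
      refine (enorm_integral_le_lintegral_enorm _).trans ?_
      simp only [ContinuousLinearMap.mul_apply']
      rw [lintegral_convolution_swap]
      exact hC j k l G x
    refine (eLpNorm_le_nnreal_smul_eLpNorm_of_ae_le_mul' (Eventually.of_forall h1) _).trans ?_
    rw [ENNReal.smul_def, smul_eq_mul, ENNReal.coe_mul, mul_assoc]
    gcongr
    exact hC' G hG

/-- The kernel is dominated by the Riesz kernel, so `|U| * |G|` is in `L^q`, while `f` lies in `L^1
∩ L^∞` and hence in the dual space. Hölder's inequality gives the absolute convergence behind every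
exchange of integrals below. -/
lemma integrable_stokesKernel_mul_mul (e : Exponents d α p q) (j k l : Fin d) {G : Vec d → ℝ}
    (hG : MemLp G (ENNReal.ofReal p)) {f : Vec d → ℂ} (hf : Integrable f) {B : ℝ} (hB : ∀ x, ‖f x‖ ≤ B) :
    Integrable (fun z : Vec d × Vec d => ((stokesKernel d α j k l (z.1 - z.2) : ℂ) * G z.2) * f z.1)
      (volume.prod volume) := by
  obtain ⟨C, hC⟩ := lintegral_stokesKernel_le e
  obtain ⟨C', hC'⟩ := eLpNorm_rieszPot_le e
  have hq := e.one_lt_right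
  have hq0 : 0 < q := by linarith
  have hm : AEStronglyMeasurable (fun z : Vec d × Vec d => ((stokesKernel d α j k l (z.1 - z.2) : ℂ) * G z.2) * f z.1)
      (volume.prod volume) := by
    refine (AEStronglyMeasurable.mul ?_ ?_).mul hf.1.comp_fst
    · exact (Complex.measurable_ofReal.comp ((measurable_stokesKernel α j k l).comp
        (measurable_fst.sub measurable_snd))).aestronglyMeasurable
    · exact (Complex.continuous_ofReal.comp_aestronglyMeasurable hG.1).comp_snd
  refine ⟨hm, ?_⟩
  rw [hasFiniteIntegral_iff_enorm, lintegral_prod _ hm.enorm]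
  have h1 : ∀ x, ∫⁻ y, ‖((stokesKernel d α j k l (x - y) : ℂ) * G y) * f x‖ₑ ≤
      C * (rieszPot (2 * α - 1) (fun x => ‖G x‖ₑ) x * ‖f x‖ₑ) := fun x => by
    simp only [enorm_mul]
    rw [lintegral_mul_const' _ _ enorm_ne_top, ← mul_assoc]
    gcongr
    refine le_trans (le_of_eq ?_) (hC j k l G x)
    refine lintegral_congr fun y => ?_
    congr 1 <;> simp [← ofReal_norm]
  refine (lintegral_mono h1).trans_lt ?_
  rw [lintegral_const_mul' _ _ ENNReal.coe_ne_top]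
  refine ENNReal.mul_lt_top ENNReal.coe_lt_top ?_
  have hpq := Real.HolderConjugate.conjExponent hq
  have hfr := memLp_of_bound hf hB hpq.symm.lt.le
  refine (ENNReal.lintegral_mul_le_Lp_mul_Lq volume hpq
    (measurable_rieszPot_enorm _ hG.1).aemeasurable hf.1.enorm).trans_lt ?_
  refine ENNReal.mul_lt_top ?_ ?_
  · have h2 := (hC' G hG.1).trans_lt (ENNReal.mul_lt_top ENNReal.coe_lt_top hG.2)
    rw [eLpNorm_eq_lintegral_rpow_enorm_toReal (by simpa using hq0) ENNReal.ofReal_ne_top,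
      ENNReal.toReal_ofReal hq0.le] at h2
    simpa only [enorm_eq_self] using h2
  · have h2 := hfr.2
    rw [eLpNorm_eq_lintegral_rpow_enorm_toReal (by simpa using hpq.symm.pos) ENNReal.ofReal_ne_top,
      ENNReal.toReal_ofReal hpq.symm.pos.le] at h2
    exact h2

lemma integral_stokesKernel_mul_mul (e : Exponents d α p q) (j k l : Fin d) {G : Vec d → ℝ} (f : Vec d → ℂ) (y : Vec d) :
    ∫ x, (stokesKernel d α j k l (x - y) : ℂ) * G y * f x =
      -((G y : ℂ) * ∫ z, (stokesKernel d α j k l z : ℂ) * f (y - z)) := by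
  have hα0 : 0 < α := by linarith [e.half_lt]
  rw [← mul_neg, ← integral_neg]
  calc ∫ x, (stokesKernel d α j k l (x - y) : ℂ) * G y * f x
      = ∫ x, (G y : ℂ) * ((stokesKernel d α j k l (x - y) : ℂ) * f x) := by
        congr 1; funext x; ring
    _ = (G y : ℂ) * ∫ x, (stokesKernel d α j k l (x - y) : ℂ) * f x := integral_const_mul _ _
    _ = (G y : ℂ) * ∫ z, (stokesKernel d α j k l (-z) : ℂ) * f (y - z) := by
        congr 1
        rw [← integral_sub_left_eq_self (fun x => (stokesKernel d α j k l (x - y) : ℂ) * f x) volume y]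
        simp
    _ = (G y : ℂ) * ∫ z, -((stokesKernel d α j k l z : ℂ) * f (y - z)) := by
        congr 1
        refine integral_congr_ae ?_
        filter_upwards [ae_ne_zero (d := d)] with z hz
        rw [stokesKernel_neg hα0 e.lt_half j k l hz]
        push_cast; ring

lemma integrable_stokesKernel_convolution_mul (e : Exponents d α p q) (j k l : Fin d) {G : Vec d → ℝ}
    (hG : MemLp G (ENNReal.ofReal p)) {f : Vec d → ℂ} (hf : Integrable f) {B : ℝ} (hB : ∀ x, ‖f x‖ ≤ B) :
    Integrable (fun x => ((stokesKernel d α j k l ⋆[ContinuousLinearMap.mul ℝ ℝ, volume] G) x : ℂ) * f x) := by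
  refine (integrable_stokesKernel_mul_mul e j k l hG hf hB).integral_prod_left.congr
    (Eventually.of_forall fun x => ?_)
  dsimp only
  rw [convolution_mul_swap, integral_mul_const, ← integral_complex_ofReal]
  simp

/-- The pairing of `U * G` with an integrable bounded function. -/
lemma integral_stokesKernel_convolution_mul (e : Exponents d α p q) (j k l : Fin d) {G : Vec d → ℝ}
    (hG : MemLp G (ENNReal.ofReal p)) {f : Vec d → ℂ} (hf : Integrable f) {B : ℝ} (hB : ∀ x, ‖f x‖ ≤ B) :
    ∫ x, ((stokesKernel d α j k l ⋆[ContinuousLinearMap.mul ℝ ℝ, volume] G) x : ℂ) * f x =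
      -∫ y, (G y : ℂ) * ∫ z, (stokesKernel d α j k l z : ℂ) * f (y - z) := by
  have hint := integrable_stokesKernel_mul_mul e j k l hG hf hB
  have h3 : ∀ x, ((stokesKernel d α j k l ⋆[ContinuousLinearMap.mul ℝ ℝ, volume] G) x : ℂ) * f x =
      ∫ y, ((stokesKernel d α j k l (x - y) : ℂ) * G y) * f x := fun x => by
    rw [convolution_mul_swap, integral_mul_const, ← integral_complex_ofReal]
    simp
  simp only [h3]
  rw [integral_integral_swap hint, ← integral_neg]
  refine integral_congr_ae (Eventually.of_forall fun y => ?_)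
  exact integral_stokesKernel_mul_mul e j k l f y

lemma integral_stokesKernel_convolution_mul_fourierInv (e : Exponents d α p q) (j k l : Fin d) {G : Vec d → ℝ}
    (hG : MemLp G (ENNReal.ofReal p)) {h : Vec d → ℂ} (hh : Integrable h)
    (hh' : Integrable fun ξ => ‖ξ‖ ^ (1 - 2 * α) * ‖h ξ‖) (hf : Integrable (𝓕⁻ h)) :
    ∫ x, ((stokesKernel d α j k l ⋆[ContinuousLinearMap.mul ℝ ℝ, volume] G) x : ℂ) * 𝓕⁻ h x =
      -∫ y, (G y : ℂ) * 𝓕⁻ (fun ξ => Complex.I * (stokesSymbol α j k l ξ : ℂ) * h ξ) y := by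
  rw [integral_stokesKernel_convolution_mul e j k l hG hf (fun x => norm_fourierInv_le h x)]
  simp only [integral_stokesKernel_mul_fourierInv e.half_lt e.lt_half j k l hh hh' hf]

lemma integrable_mul_fourierInv_stokesSymbol (e : Exponents d α p q) (j k l : Fin d) {G : Vec d → ℝ}
    (hG : MemLp G (ENNReal.ofReal p)) {h : Vec d → ℂ} (hh : Integrable h)
    (hh' : Integrable fun ξ => ‖ξ‖ ^ (1 - 2 * α) * ‖h ξ‖) (hf : Integrable (𝓕⁻ h)) :
    Integrable fun y => (G y : ℂ) * 𝓕⁻ (fun ξ => Complex.I * (stokesSymbol α j k l ξ : ℂ) * h ξ) y := by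
  refine (integrable_stokesKernel_mul_mul e j k l hG hf
    (fun x => norm_fourierInv_le h x)).integral_prod_right.neg.congr (Eventually.of_forall fun y => ?_)
  simp only [Pi.neg_apply]
  rw [integral_stokesKernel_mul_mul e j k l (𝓕⁻ h) y, neg_neg,
    integral_stokesKernel_mul_fourierInv e.half_lt e.lt_half j k l hh hh' hf]

end KernelConvolution

/-! ### `U_α * F` is a very weak solution, with its `L^q` bound -/

section Existence

variable {d : ℕ}

/-- Cut at height one: `‖u‖ ≤ ‖u‖ ^ q` where `‖u‖ > 1`, and the rest is bounded. -/
lemma memL1AddLinfty_of_memLp {q : ℝ} (hq : 1 ≤ q) {u : Vec d → Vec d} (hu : MemLp u (ENNReal.ofReal q)) :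
    MemL1AddLinfty u := by
  have hq0 : 0 < q := by linarith
  have hS : NullMeasurableSet {x | 1 < ‖u x‖} volume :=
    nullMeasurableSet_lt aemeasurable_const hu.1.norm.aemeasurable
  refine ⟨{x | 1 < ‖u x‖}.indicator u, {x | 1 < ‖u x‖}ᶜ.indicator u, ⟨hu.1.indicator₀ hS, ?_⟩,
    memLp_top_of_bound (hu.1.indicator₀ hS.compl) 1 (Eventually.of_forall fun x => ?_),
    Eventually.of_forall fun x => ?_⟩
  · rw [eLpNorm_one_eq_lintegral_enorm]
    have h1 := lintegral_rpow_enorm_lt_top_of_eLpNorm_lt_top (by simpa using hq0) ENNReal.ofReal_ne_top hu.2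
    rw [ENNReal.toReal_ofReal hq0.le] at h1
    refine (lintegral_mono fun x => ?_).trans_lt h1
    by_cases hx : x ∈ {x | 1 < ‖u x‖}
    · rw [Set.indicator_of_mem hx]
      have h2 : (1 : ℝ≥0∞) ≤ ‖u x‖ₑ := by
        rw [← ofReal_norm, ← ENNReal.ofReal_one]
        exact ENNReal.ofReal_le_ofReal (le_of_lt hx)
      calc ‖u x‖ₑ = ‖u x‖ₑ ^ (1 : ℝ) := (ENNReal.rpow_one _).symm
        _ ≤ _ := ENNReal.rpow_le_rpow_of_exponent_le h2 hq
    · rw [Set.indicator_of_notMem hx]; simp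
  · by_cases hx : 1 < ‖u x‖
    · rw [Set.indicator_of_notMem (by simpa using hx)]; simp
    · rw [Set.indicator_of_mem (by simpa using hx)]; simpa using hx
  · rw [Set.indicator_self_add_compl]

/-- A real compactly supported smooth function as a complex Schwartz function. -/
def toS (f : Vec d → ℝ) (hf : ContDiff ℝ ∞ f) (hc : HasCompactSupport f) : 𝓢(Vec d, ℂ) :=
  HasCompactSupport.toSchwartzMap (f := fun x => (f x : ℂ)) (hc.comp_left (g := ((↑) : ℝ → ℂ)) rfl)
    (Complex.ofRealCLM.contDiff.comp hf)

lemma toS_apply (f : Vec d → ℝ) (hf : ContDiff ℝ ∞ f) (hc : HasCompactSupport f) (x : Vec d) :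
    toS f hf hc x = (f x : ℂ) := rfl

lemma coe_toS (f : Vec d → ℝ) (hf : ContDiff ℝ ∞ f) (hc : HasCompactSupport f) :
    (toS f hf hc : Vec d → ℂ) = fun x => (f x : ℂ) := rfl

lemma pd_ofReal (f : Vec d → ℝ) (hf : Differentiable ℝ f) (l : Fin d) (x : Vec d) :
    pd l (fun y => (f y : ℂ)) x = ((pd l f x : ℝ) : ℂ) := by
  have h := Complex.ofRealCLM.hasFDerivAt.comp x (hf x).hasFDerivAt
  have h2 : (Complex.ofRealCLM ∘ f) = fun y => (f y : ℂ) := rfl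
  rw [h2] at h
  unfold pd
  rw [h.fderiv]
  rfl

lemma contDiff_coord {Φ : Vec d → Vec d} (h : ContDiff ℝ ∞ Φ) (j : Fin d) : ContDiff ℝ ∞ fun x => Φ x j :=
  (coordL j).contDiff.comp h

lemma hasCompactSupport_coord {Φ : Vec d → Vec d} (h : HasCompactSupport Φ) (j : Fin d) :
    HasCompactSupport fun x => Φ x j := h.comp_left (g := fun v : Vec d => v j) rfl

variable [NeZero d]

omit [NeZero d] in
lemma fourierInv_fun_add {f g : Vec d → ℂ} (hf : Integrable f) (hg : Integrable g) (x : Vec d) :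
    𝓕⁻ (fun ξ => f ξ + g ξ) x = 𝓕⁻ f x + 𝓕⁻ g x := by
  rw [Real.fourierInv_eq_fourier_neg, fourier_fun_add hf hg, ← Real.fourierInv_eq_fourier_neg,
    ← Real.fourierInv_eq_fourier_neg]

omit [NeZero d] in
lemma fourierInv_fun_sum {ι : Type*} (s : Finset ι) {f : ι → Vec d → ℂ} (hf : ∀ i ∈ s, Integrable (f i)) (x : Vec d) :
    𝓕⁻ (fun ξ => ∑ i ∈ s, f i ξ) x = ∑ i ∈ s, 𝓕⁻ (f i) x := by
  simp only [Real.fourierInv_eq]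
  rw [← integral_finsetSum s fun i hi => integrable_fourierChar_smul (hf i hi) x]
  simp [Finset.smul_sum]

omit [NeZero d] in
lemma abs_stokesSymbol_le (α : ℝ) (j k l : Fin d) {ξ : Vec d} (hξ : ξ ≠ 0) :
    |stokesSymbol α j k l ξ| ≤ (2 * Real.pi) ^ (-(2 * α)) * (4 * Real.pi) * ‖ξ‖ ^ (1 - 2 * α) := by
  have hn := norm_pos_iff.2 hξ
  unfold stokesSymbol
  have h1 : |kron j k - ξ j * ξ k / ‖ξ‖ ^ 2| ≤ 2 := by
    have h2 : |ξ j * ξ k / ‖ξ‖ ^ 2| ≤ 1 := by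
      rw [abs_div, abs_of_pos (show 0 < ‖ξ‖ ^ 2 by positivity), div_le_one (by positivity), abs_mul, sq]
      gcongr <;> exact abs_coord_le _ _
    linarith [abs_sub (kron j k) (ξ j * ξ k / ‖ξ‖ ^ 2), abs_kron_le j k]
  rw [abs_mul, abs_mul, abs_of_nonneg (show 0 ≤ (2 * Real.pi * ‖ξ‖) ^ (-(2 * α)) by positivity), abs_mul,
    abs_of_pos Real.two_pi_pos]
  calc (2 * Real.pi * ‖ξ‖) ^ (-(2 * α)) * (2 * Real.pi * |ξ l|) * |kron j k - ξ j * ξ k / ‖ξ‖ ^ 2|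
      ≤ (2 * Real.pi * ‖ξ‖) ^ (-(2 * α)) * (2 * Real.pi * ‖ξ‖) * 2 := by
        gcongr; exact abs_coord_le _ _
    _ = _ := by
        rw [Real.mul_rpow Real.two_pi_pos.le (norm_nonneg ξ), Real.rpow_sub hn, Real.rpow_one,
          Real.rpow_neg (norm_nonneg ξ)]
        have : 0 < ‖ξ‖ ^ (2 * α) := by positivity
        field_simp
        ring

omit [NeZero d] in
lemma measurable_stokesSymbol (α : ℝ) (j k l : Fin d) : Measurable (stokesSymbol (d := d) α j k l) := by
  have h : ∀ i : Fin d, Measurable fun p : Vec d => p i := fun i => (coordL i).measurable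
  have h1 := h j
  have h2 := h k
  have h3 := h l
  unfold stokesSymbol
  fun_prop

lemma integrable_stokesSymbol_mul (α : ℝ) (j k l : Fin d) {h : Vec d → ℂ} (hm : AEStronglyMeasurable h)
    (hh : Integrable fun ξ => ‖ξ‖ ^ (1 - 2 * α) * ‖h ξ‖) :
    Integrable fun ξ => Complex.I * (stokesSymbol α j k l ξ : ℂ) * h ξ := by
  refine Integrable.mono' (hh.const_mul ((2 * Real.pi) ^ (-(2 * α)) * (4 * Real.pi))) ?_ ?_
  · exact (((Complex.measurable_ofReal.comp (measurable_stokesSymbol α j k l)).const_mul _).aestronglyMeasurable).mul hm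
  · filter_upwards [ae_ne_zero (d := d)] with ξ hξ
    rw [norm_mul, norm_mul, Complex.norm_I, one_mul, Complex.norm_real, Real.norm_eq_abs, ← mul_assoc]
    gcongr
    exact abs_stokesSymbol_le α j k l hξ

/-- The Fourier side of the test expression `Λ^{2α} φ + D_j ψ`. -/
def testSymbol (α : ℝ) (j : Fin d) (φ ψ : 𝓢(Vec d, ℂ)) (ξ : Vec d) : ℂ :=
  (((2 * Real.pi * ‖ξ‖) ^ (2 * α) : ℝ) : ℂ) * 𝓕 φ ξ + 𝓕 (pdS j ψ) ξ

variable {α p q : ℝ}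

/-- These are the hypotheses under which the kernel may be moved onto the test expression. After
multiplication by `‖ξ‖^{1-2α}` the first term has weight `‖ξ‖`; the second is integrable near the
origin since `1 - 2α > -d`, which is `α < (d+1)/2`. -/
lemma integrable_testSymbol (e : Exponents d α p q) (j : Fin d) (φ ψ : 𝓢(Vec d, ℂ)) :
    Integrable (testSymbol α j φ ψ) ∧ Integrable (fun ξ => ‖ξ‖ ^ (1 - 2 * α) * ‖testSymbol α j φ ψ ξ‖) ∧
    𝓕⁻ (testSymbol α j φ ψ) = fun x => fracLap (2 * α) φ x + pd j ψ x := by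
  have hα := e.half_lt
  have hd0 : (0 : ℝ) < d := by exact_mod_cast Nat.pos_of_neZero d
  have h1 := integrable_symbol_mul_schwartz (s := 2 * α) (by linarith) (𝓕 φ)
  have h2 := (𝓕 (pdS j ψ) : 𝓢(Vec d, ℂ)).integrable (μ := volume)
  have hI : Integrable (testSymbol α j φ ψ) := h1.add h2
  refine ⟨hI, ?_, ?_⟩
  · have h3 := (integrable_rpow_norm_mul_schwartz (s := 1) (by linarith) (𝓕 φ)).const_mul ((2 * Real.pi) ^ (2 * α))
    have h4 := integrable_rpow_norm_mul_schwartz (s := 1 - 2 * α) (by linarith [e.lt_half]) (𝓕 (pdS j ψ))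
    refine Integrable.mono' (h3.add h4) ?_ ?_
    · exact (show Measurable fun ξ : Vec d => ‖ξ‖ ^ (1 - 2 * α) by fun_prop).aestronglyMeasurable.mul hI.1.norm
    · filter_upwards [ae_ne_zero (d := d)] with ξ hξ
      have hn := norm_pos_iff.2 hξ
      rw [Real.norm_of_nonneg (by positivity)]
      have h5 : ‖testSymbol α j φ ψ ξ‖ ≤ (2 * Real.pi * ‖ξ‖) ^ (2 * α) * ‖𝓕 φ ξ‖ + ‖𝓕 (pdS j ψ) ξ‖ := by
        refine (norm_add_le _ _).trans (le_of_eq ?_)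
        rw [norm_mul, Complex.norm_real, Real.norm_of_nonneg (by positivity)]
      refine (mul_le_mul_of_nonneg_left h5 (by positivity)).trans (le_of_eq ?_)
      simp only [Pi.add_apply]
      rw [Real.mul_rpow Real.two_pi_pos.le hn.le, mul_add, Real.rpow_sub hn, Real.rpow_one]
      have : 0 < ‖ξ‖ ^ (2 * α) := by positivity
      field_simp
  · funext x
    have := fourierInv_fun_add h1 h2 x
    refine this.trans ?_
    congr 1
    rw [← SchwartzMap.fourierInv_coe, FourierTransform.fourierInv_fourier_eq, pdS_apply]

lemma integrable_fourierInv_testSymbol (e : Exponents d α p q) (j : Fin d) (φ ψ : 𝓢(Vec d, ℂ)) :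
    Integrable (𝓕⁻ (testSymbol α j φ ψ)) := by
  rw [(integrable_testSymbol e j φ ψ).2.2]
  refine (integrable_fracLap (by linarith [e.half_lt]) φ).add ?_
  rw [← coe_pdS]
  exact SchwartzMap.integrable _

omit [NeZero d] in
/-- The symbol of the Stokes kernel inverts the system on divergence-free fields. -/
lemma sum_stokesSymbol_mul_testSymbol {k l : Fin d} {φ : Fin d → 𝓢(Vec d, ℂ)} {ψ : 𝓢(Vec d, ℂ)} {ξ : Vec d}
    (hξ : ξ ≠ 0) (hdiv : ∑ j, (ξ j : ℂ) * 𝓕 (φ j) ξ = 0) :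
    ∑ j, Complex.I * (stokesSymbol α j k l ξ : ℂ) * testSymbol α j (φ j) ψ ξ = 𝓕 (pdS l (φ k)) ξ := by
  have hn := norm_pos_iff.2 hξ
  have hn' : (‖ξ‖ : ℂ) ≠ 0 := by exact_mod_cast hn.ne'
  have hsq : ∑ j, (ξ j : ℂ) * ξ j = (‖ξ‖ : ℂ) ^ 2 := by
    have := EuclideanSpace.real_norm_sq_eq ξ
    rw [← Complex.ofReal_pow, this]
    push_cast
    simp [sq]
  have hk : ∀ f : Fin d → ℂ, ∑ j, (kron j k : ℂ) * f j = f k := fun f => by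
    simp [kron, apply_ite]
  have hA : (((2 * Real.pi * ‖ξ‖) ^ (-(2 * α)) : ℝ) : ℂ) * (((2 * Real.pi * ‖ξ‖) ^ (2 * α) : ℝ) : ℂ) = 1 := by
    rw [← Complex.ofReal_mul, ← Real.rpow_add (by positivity)]; simp
  -- Sorting into the projection of `Φ̂` and that of `ξ ψ̂`. In the sum over `j` the first loses its
  -- correction because `ξ · Φ̂ = 0`, and the second is `ξ_k - ξ_k |ξ|² / |ξ|² = 0`.
  have e1 : ∀ j, Complex.I * (stokesSymbol α j k l ξ : ℂ) * testSymbol α j (φ j) ψ ξ =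
      2 * Real.pi * Complex.I * ξ l * ((((2 * Real.pi * ‖ξ‖) ^ (-(2 * α)) : ℝ) : ℂ) *
        (((2 * Real.pi * ‖ξ‖) ^ (2 * α) : ℝ) : ℂ) *
        ((kron j k : ℂ) * 𝓕 (φ j) ξ - ξ k / (‖ξ‖ : ℂ) ^ 2 * (ξ j * 𝓕 (φ j) ξ)) +
        (((2 * Real.pi * ‖ξ‖) ^ (-(2 * α)) : ℝ) : ℂ) * (2 * Real.pi * Complex.I * 𝓕 ψ ξ) *
          ((kron j k : ℂ) * ξ j - ξ k / (‖ξ‖ : ℂ) ^ 2 * (ξ j * ξ j))) := fun j => by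
    unfold stokesSymbol testSymbol
    rw [fourier_pdS]
    push_cast
    ring
  simp only [e1, hA, one_mul]
  rw [← Finset.mul_sum, Finset.sum_add_distrib, Finset.sum_sub_distrib, hk (fun j => 𝓕 (φ j) ξ),
    ← Finset.mul_sum, hdiv, ← Finset.mul_sum, Finset.sum_sub_distrib, hk (fun j => (ξ j : ℂ)), ← Finset.mul_sum,
    hsq, fourier_pdS]
  field_simp
  ring

omit [NeZero d] in
lemma sum_coord_mul_fourier_eq_zero {φ : Fin d → 𝓢(Vec d, ℂ)} (h : ∀ x, ∑ j, pd j (φ j) x = 0) (ξ : Vec d) :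
    ∑ j, (ξ j : ℂ) * 𝓕 (φ j) ξ = 0 := by
  have h1 : ∑ j, pdS j (φ j) = 0 := by
    ext x
    simp only [sum_apply, pdS_apply]
    simpa using h x
  have h2 : 𝓕 (∑ j, pdS j (φ j)) ξ = 0 := by
    rw [h1]; simp
  have h3 : 𝓕 (∑ j, pdS j (φ j)) ξ = ∑ j, 𝓕 (pdS j (φ j)) ξ := by
    rw [FourierTransform.fourier_sum]
    simp
  rw [h3] at h2
  simp only [fourier_pdS] at h2
  have h4 : 2 * (Real.pi : ℂ) * Complex.I * ∑ j, (ξ j : ℂ) * 𝓕 (φ j) ξ = 0 := by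
    rw [Finset.mul_sum, ← h2]
    exact Finset.sum_congr rfl fun j _ => by ring
  simpa [Real.pi_ne_zero] using h4

omit [NeZero d] in
lemma memLp_coord {F : Vec d → Tens d} {r : ℝ≥0∞} (hF : MemLp F r) (i : Fin d × Fin d) :
    MemLp (fun y => F y i) r := hF.eval_piLp i

/-- Transposing the odd kernel gives minus the pairing of `F^{kl}` with the symbol applied to the
test expression. Summed over `j`, that symbol inverts the system and leaves `D_l Φ^k`. -/
lemma isVeryWeakSolution_kernelConv (e : Exponents d α p q) {F : Vec d → Tens d}
    (hF : MemLp F (ENNReal.ofReal p)) (hu : MemLp (kernelConv α F) (ENNReal.ofReal q)) :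
    IsVeryWeakSolution α F (kernelConv α F) := by
  refine ⟨memL1AddLinfty_of_memLp e.one_lt_right.le hu, fun Φ ψ hΦ hΦc hdiv hψ hψc => ?_⟩
  set φ : Fin d → 𝓢(Vec d, ℂ) := fun j => toS (fun x => Φ x j) (contDiff_coord hΦ j) (hasCompactSupport_coord hΦc j)
    with hφ
  set ψS : 𝓢(Vec d, ℂ) := toS ψ hψ hψc with hψS
  have hφd : ∀ j l x, pd l (φ j) x = ((pd l (fun y => Φ y j) x : ℝ) : ℂ) := fun j l x =>
    pd_ofReal _ ((contDiff_coord hΦ j).differentiable (by simp)) l x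
  have hψd : ∀ l x, pd l ψS x = ((pd l ψ x : ℝ) : ℂ) := fun l x =>
    pd_ofReal _ (hψ.differentiable (by simp)) l x
  have hdiv' := sum_coord_mul_fourier_eq_zero (φ := φ) (fun x => by
    simp only [hφd]
    exact_mod_cast hdiv x)
  have ht : ∀ j x, fracLap (2 * α) (fun y => (Φ y j : ℂ)) x + ((pd j ψ x : ℝ) : ℂ) =
      𝓕⁻ (testSymbol α j (φ j) ψS) x := fun j x => by
    rw [(integrable_testSymbol e j (φ j) ψS).2.2]
    beta_reduce
    rw [hψd]
    rfl
  have hcF : ∀ k l, MemLp (fun y => F y (k, l)) (ENNReal.ofReal p) := fun k l => memLp_coord hF (k, l)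
  have hI : ∀ j k l, Integrable fun x =>
      ((stokesKernel d α j k l ⋆[ContinuousLinearMap.mul ℝ ℝ, volume] fun y => F y (k, l)) x : ℂ) *
        𝓕⁻ (testSymbol α j (φ j) ψS) x := fun j k l =>
    integrable_stokesKernel_convolution_mul e j k l (hcF k l) (integrable_fourierInv_testSymbol e j (φ j) ψS)
      (fun x => norm_fourierInv_le _ x)
  have hJ : ∀ j k l, Integrable fun y => ((F y (k, l) : ℝ) : ℂ) *
      𝓕⁻ (fun ξ => Complex.I * (stokesSymbol α j k l ξ : ℂ) * testSymbol α j (φ j) ψS ξ) y := fun j k l =>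
    integrable_mul_fourierInv_stokesSymbol e j k l (hcF k l) (integrable_testSymbol e j (φ j) ψS).1
      (integrable_testSymbol e j (φ j) ψS).2.1 (integrable_fourierInv_testSymbol e j (φ j) ψS)
  have hS : ∀ k l y, ∑ j, 𝓕⁻ (fun ξ => Complex.I * (stokesSymbol α j k l ξ : ℂ) * testSymbol α j (φ j) ψS ξ) y =
      ((pd l (fun y => Φ y k) y : ℝ) : ℂ) := fun k l y => by
    rw [← fourierInv_fun_sum Finset.univ (fun j _ => integrable_stokesSymbol_mul α j k l
      (integrable_testSymbol e j (φ j) ψS).1.1 (integrable_testSymbol e j (φ j) ψS).2.1), ← hφd, ← pdS_apply]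
    have : pdS l (φ k) y = 𝓕⁻ ((𝓕 (pdS l (φ k)) : 𝓢(Vec d, ℂ)) : Vec d → ℂ) y := by
      rw [← SchwartzMap.fourierInv_coe, FourierTransform.fourierInv_fourier_eq]
    rw [this, Real.fourierInv_eq, Real.fourierInv_eq]
    refine integral_congr_ae ?_
    filter_upwards [ae_ne_zero (d := d)] with ξ hξ
    rw [sum_stokesSymbol_mul_testSymbol hξ (hdiv' ξ)]
  calc ∫ x, ∑ j, (kernelConv α F x j : ℂ) * (fracLap (2 * α) (fun y => (Φ y j : ℂ)) x + ((pd j ψ x : ℝ) : ℂ))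
      = ∫ x, ∑ j, ∑ k, ∑ l,
          ((stokesKernel d α j k l ⋆[ContinuousLinearMap.mul ℝ ℝ, volume] fun y => F y (k, l)) x : ℂ) *
            𝓕⁻ (testSymbol α j (φ j) ψS) x := by
        congr 1
        funext x
        refine Finset.sum_congr rfl fun j _ => ?_
        rw [ht, kernelConv]
        push_cast
        simp only [Finset.sum_mul]
    _ = ∑ j, ∑ k, ∑ l, ∫ x,
          ((stokesKernel d α j k l ⋆[ContinuousLinearMap.mul ℝ ℝ, volume] fun y => F y (k, l)) x : ℂ) *
            𝓕⁻ (testSymbol α j (φ j) ψS) x := by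
        rw [integral_finsetSum _ fun j _ => integrable_finsetSum _ fun k _ => integrable_finsetSum _ fun l _ => hI j k l]
        refine Finset.sum_congr rfl fun j _ => ?_
        rw [integral_finsetSum _ fun k _ => integrable_finsetSum _ fun l _ => hI j k l]
        refine Finset.sum_congr rfl fun k _ => ?_
        rw [integral_finsetSum _ fun l _ => hI j k l]
    _ = ∑ j, ∑ k, ∑ l, -∫ y, ((F y (k, l) : ℝ) : ℂ) *
          𝓕⁻ (fun ξ => Complex.I * (stokesSymbol α j k l ξ : ℂ) * testSymbol α j (φ j) ψS ξ) y := by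
        refine Finset.sum_congr rfl fun j _ => Finset.sum_congr rfl fun k _ => Finset.sum_congr rfl fun l _ => ?_
        exact integral_stokesKernel_convolution_mul_fourierInv e j k l (hcF k l)
          (integrable_testSymbol e j (φ j) ψS).1 (integrable_testSymbol e j (φ j) ψS).2.1
          (integrable_fourierInv_testSymbol e j (φ j) ψS)
    _ = -∑ k, ∑ l, ∑ j, ∫ y, ((F y (k, l) : ℝ) : ℂ) *
          𝓕⁻ (fun ξ => Complex.I * (stokesSymbol α j k l ξ : ℂ) * testSymbol α j (φ j) ψS ξ) y := by
        simp only [Finset.sum_neg_distrib]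
        rw [Finset.sum_comm]
        congr 1
        refine Finset.sum_congr rfl fun k _ => ?_
        rw [Finset.sum_comm]
    _ = -∫ y, ∑ k, ∑ l, ∑ j, ((F y (k, l) : ℝ) : ℂ) *
          𝓕⁻ (fun ξ => Complex.I * (stokesSymbol α j k l ξ : ℂ) * testSymbol α j (φ j) ψS ξ) y := by
        congr 1
        rw [integral_finsetSum _ fun k _ => integrable_finsetSum _ fun l _ => integrable_finsetSum _ fun j _ => hJ j k l]
        refine Finset.sum_congr rfl fun k _ => ?_
        rw [integral_finsetSum _ fun l _ => integrable_finsetSum _ fun j _ => hJ j k l]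
        refine Finset.sum_congr rfl fun l _ => ?_
        rw [integral_finsetSum _ fun j _ => hJ j k l]
    _ = _ := by
        rw [← integral_complex_ofReal]
        congr 2
        funext y
        push_cast
        refine Finset.sum_congr rfl fun k _ => Finset.sum_congr rfl fun l _ => ?_
        rw [← Finset.mul_sum, hS]

/-- The `L^q` bound of the solution. -/
lemma eLpNorm_kernelConv_le (e : Exponents d α p q) : ∃ C : ℝ≥0, ∀ F : Vec d → Tens d,
    MemLp F (ENNReal.ofReal p) → MemLp (kernelConv α F) (ENNReal.ofReal q) ∧
    eLpNorm (kernelConv α F) (ENNReal.ofReal q) volume ≤ C * eLpNorm F (ENNReal.ofReal p) volume := by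
  obtain ⟨C, hC⟩ := eLpNorm_stokesKernel_convolution_le e
  have hq1 : 1 ≤ ENNReal.ofReal q := by
    rw [← ENNReal.ofReal_one]; exact ENNReal.ofReal_le_ofReal e.one_lt_right.le
  -- One copy of the scalar constant for each triple `(j, k, l)`, by the triangle inequality.
  refine ⟨∑ _j : Fin d, ∑ _k : Fin d, ∑ _l : Fin d, C, fun F hF => ?_⟩
  have hcF : ∀ k l, MemLp (fun y => F y (k, l)) (ENNReal.ofReal p) := fun k l => memLp_coord hF (k, l)
  have hmeas : ∀ j k l, AEStronglyMeasurable
      (stokesKernel d α j k l ⋆[ContinuousLinearMap.mul ℝ ℝ, volume] fun y => F y (k, l)) := fun j k l =>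
    (hC j k l _ (hcF k l).1).1
  have hle : ∀ j k l, eLpNorm (stokesKernel d α j k l ⋆[ContinuousLinearMap.mul ℝ ℝ, volume] fun y => F y (k, l))
      (ENNReal.ofReal q) volume ≤ C * eLpNorm F (ENNReal.ofReal p) volume := fun j k l => by
    refine (hC j k l _ (hcF k l).1).2.trans ?_
    gcongr 
    refine eLpNorm_mono fun x => ?_
    exact PiLp.norm_apply_le (F x) (k, l)
  have hmem : ∀ j k l, MemLp (stokesKernel d α j k l ⋆[ContinuousLinearMap.mul ℝ ℝ, volume] fun y => F y (k, l))
      (ENNReal.ofReal q) := fun j k l =>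
    ⟨hmeas j k l, (hle j k l).trans_lt (ENNReal.mul_lt_top ENNReal.coe_lt_top hF.2)⟩
  have hcomp : ∀ j, MemLp (fun x => kernelConv α F x j) (ENNReal.ofReal q) := fun j =>
    memLp_finsetSum (f := fun k x => ∑ l,
      (stokesKernel d α j k l ⋆[ContinuousLinearMap.mul ℝ ℝ, volume] fun y => F y (k, l)) x) Finset.univ
      fun k _ => memLp_finsetSum Finset.univ fun l _ => hmem j k l
  refine ⟨MemLp.of_eval_piLp hcomp, ?_⟩
  have h1 : ∀ x, ‖kernelConv α F x‖ ≤ ‖∑ j, ‖kernelConv α F x j‖‖ := fun x => by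
    rw [Real.norm_of_nonneg (by positivity)]
    have : kernelConv α F x = ∑ j, EuclideanSpace.single j (kernelConv α F x j) := by
      ext i; simp [Finset.sum_apply, Pi.single_apply]
    conv_lhs => rw [this]
    refine (norm_sum_le _ _).trans (le_of_eq ?_)
    simp
  refine (eLpNorm_mono h1).trans ?_
  have h2 : (fun x => ∑ j, ‖kernelConv α F x j‖) = ∑ j, fun x => ‖kernelConv α F x j‖ := by
    funext x; simp
  rw [h2]
  refine (eLpNorm_sum_le (fun j _ => (hcomp j).1.norm) hq1).trans ?_
  rw [ENNReal.ofNNReal_finsetSum, Finset.sum_mul]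
  refine Finset.sum_le_sum fun j _ => ?_
  rw [eLpNorm_norm]
  have h3 : (fun x => kernelConv α F x j) = ∑ k, ∑ l,
      (stokesKernel d α j k l ⋆[ContinuousLinearMap.mul ℝ ℝ, volume] fun y => F y (k, l)) := by
    funext x; simp [kernelConv]
  rw [h3]
  refine (eLpNorm_sum_le (fun k _ => Finset.aestronglyMeasurable_sum _ fun l _ => hmeas j k l) hq1).trans ?_
  rw [ENNReal.ofNNReal_finsetSum, Finset.sum_mul]
  refine Finset.sum_le_sum fun k _ => ?_
  refine (eLpNorm_sum_le (fun l _ => hmeas j k l) hq1).trans ?_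
  rw [ENNReal.ofNNReal_finsetSum, Finset.sum_mul]
  exact Finset.sum_le_sum fun l _ => hle j k l

end Existence

/-! ### From compactly supported test functions to Schwartz functions, and `𝓢₀` as a separating
class -/

section Transfer

variable {d : ℕ} {q : ℝ}

lemma memLp_ofReal {v : Vec d → ℝ} {r : ℝ≥0∞} (hv : MemLp v r) : MemLp (fun x => (v x : ℂ)) r :=
  hv.ofReal

lemma integrable_memLp_mul (hq : 1 < q) {v : Vec d → ℝ} (hv : MemLp v (ENNReal.ofReal q)) {f : Vec d → ℂ}
    (hf : Integrable f) {B : ℝ} (hB : ∀ x, ‖f x‖ ≤ B) : Integrable fun x => (v x : ℂ) * f x := by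
  have hpq := Real.HolderConjugate.conjExponent hq
  have := hpq.ennrealOfReal
  exact MemLp.integrable_mul (memLp_ofReal hv) (memLp_of_bound hf hB hpq.symm.lt.le)

lemma integrable_memLp_mul_schwartz (hq : 1 < q) {v : Vec d → ℝ} (hv : MemLp v (ENNReal.ofReal q))
    (φ : 𝓢(Vec d, ℂ)) : Integrable fun x => (v x : ℂ) * φ x :=
  integrable_memLp_mul hq hv φ.integrable (fun x => SchwartzMap.norm_le_seminorm ℝ φ x)

lemma enorm_integral_mul_le (hq : 1 < q) {v b : Vec d → ℂ} (hv : AEStronglyMeasurable v)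
    (hb : AEStronglyMeasurable b) : ‖∫ x, v x * b x‖ₑ ≤
      eLpNorm v (ENNReal.ofReal q) volume * eLpNorm b (ENNReal.ofReal q.conjExponent) volume := by
  have := (Real.HolderConjugate.conjExponent hq).ennrealOfReal
  refine (enorm_integral_le_lintegral_enorm _).trans ?_
  rw [← eLpNorm_one_eq_lintegral_enorm]
  exact eLpNorm_smul_le_mul_eLpNorm (r := 1) (f := b) (φ := v) hb hv

/-- Fubini for the pairing of an `L^q` function with a convolution. -/
lemma integral_translate_swap (hq : 1 < q) {v : Vec d → ℝ} (hv : MemLp v (ENNReal.ofReal q)) {f : Vec d → ℂ}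
    (hf : Integrable f) {B : ℝ} (hB : ∀ x, ‖f x‖ ≤ B) {g : Vec d → ℂ} (hg : Integrable g) :
    Integrable (fun y => g y * ∫ x, (v x : ℂ) * f (x - y)) ∧
    ∫ y, g y * ∫ x, (v x : ℂ) * f (x - y) = ∫ x, (v x : ℂ) * ∫ y, g y * f (x - y) := by
  have hpq := Real.HolderConjugate.conjExponent hq
  have hm : AEStronglyMeasurable (fun z : Vec d × Vec d => g z.1 * ((v z.2 : ℂ) * f (z.2 - z.1)))
      (volume.prod volume) := by
    refine hg.1.comp_fst.mul ((memLp_ofReal hv).1.comp_snd.mul ?_)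
    have h1 := hf.1.comp_quasiMeasurePreserving (quasiMeasurePreserving_sub_of_right_invariant
      (volume : Measure (Vec d)) (volume : Measure (Vec d)))
    exact h1.prod_swap
  set M := (∫ a, ‖(v a : ℂ)‖ ^ q) ^ (1 / q) * (∫ a, ‖f a‖ ^ q.conjExponent) ^ (1 / q.conjExponent) with hM
  have hint : Integrable (fun z : Vec d × Vec d => g z.1 * ((v z.2 : ℂ) * f (z.2 - z.1)))
      (volume.prod volume) := by
    rw [integrable_prod_iff hm]
    refine ⟨Eventually.of_forall fun y => ?_, ?_⟩
    · exact (integrable_memLp_mul hq hv (hf.comp_sub_right y) (fun x => hB _)).const_mul (g y)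
    · refine Integrable.mono' (hg.norm.mul_const M) hm.norm.integral_prod_right'
        (Eventually.of_forall fun y => ?_)
      rw [Real.norm_of_nonneg (integral_nonneg fun _ => norm_nonneg _)]
      simp only [norm_mul]
      rw [integral_const_mul]
      refine mul_le_mul_of_nonneg_left ?_ (norm_nonneg _)
      refine (integral_mul_norm_le_Lp_mul_Lq hpq (memLp_ofReal hv)
        (memLp_of_bound (hf.comp_sub_right y) (fun x => hB _) hpq.symm.lt.le)).trans (le_of_eq ?_)
      rw [integral_sub_right_eq_self (fun x => ‖f x‖ ^ q.conjExponent) y]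
  have h2 := hint.integral_prod_left
  simp only [integral_const_mul] at h2
  refine ⟨h2, ?_⟩
  have h3 := integral_integral_swap (f := fun y x => g y * ((v x : ℂ) * f (x - y))) hint
  simp only [integral_const_mul] at h3
  rw [h3]
  congr 1
  funext x
  rw [← integral_const_mul]
  congr 1
  funext y
  ring

/-- A dominating function for all translates by `y` near `y₀`, from `1 + |x| ≤ (1 + |x-y|)(2 +
|y₀|)`; the decay exponent `d + 1` makes it integrable. It gives continuity of the pairing in the
translation parameter. -/
lemma schwartz_translate_bound (φ : 𝓢(Vec d, ℂ)) (y₀ : Vec d) : ∃ g : Vec d → ℝ, Integrable g ∧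
    (∃ B, ∀ x, ‖g x‖ ≤ B) ∧ ∀ y ∈ Metric.ball y₀ 1, ∀ x, ‖φ (x - y)‖ ≤ g x := by
  set N : ℕ := d + 1
  obtain ⟨C, hC⟩ : ∃ C : ℝ, ∀ x, (1 + ‖x‖) ^ N * ‖φ x‖ ≤ C := by
    have h := SchwartzMap.one_add_le_sup_seminorm_apply (𝕜 := ℝ) (m := (N, 0)) (k := N) (n := 0) le_rfl le_rfl φ
    simp only [norm_iteratedFDeriv_zero] at h
    exact ⟨_, h⟩
  have hC0 : 0 ≤ C := le_trans (by positivity) (hC 0)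
  have hr : ∀ x : Vec d, (1 + ‖x‖) ^ (-((N : ℕ) : ℝ)) = ((1 + ‖x‖) ^ N)⁻¹ := fun x => by
    rw [Real.rpow_neg (by positivity), Real.rpow_natCast]
  refine ⟨fun x => (2 + ‖y₀‖) ^ N * C * (1 + ‖x‖) ^ (-((N : ℕ) : ℝ)),
    (integrable_one_add_norm (E := Vec d) (by simp [N])).const_mul _, ⟨(2 + ‖y₀‖) ^ N * C, fun x => ?_⟩,
    fun y hy x => ?_⟩
  · rw [Real.norm_of_nonneg (by positivity)]
    refine mul_le_of_le_one_right (by positivity) (Real.rpow_le_one_of_one_le_of_nonpos ?_ ?_)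
    · linarith [norm_nonneg x]
    · simp
  · beta_reduce
    rw [hr, ← div_eq_mul_inv, le_div_iff₀ (by positivity)]
    have h1 : 1 + ‖x‖ ≤ (1 + ‖x - y‖) * (2 + ‖y₀‖) := by
      have h2 : ‖x‖ ≤ ‖x - y‖ + ‖y‖ := by simpa using norm_add_le (x - y) y
      have h3 : ‖y‖ ≤ ‖y₀‖ + 1 := by
        have : ‖y - y₀‖ < 1 := by simpa [dist_eq_norm] using hy
        have := norm_add_le (y - y₀) y₀
        simp only [sub_add_cancel] at this
        linarith
      nlinarith [norm_nonneg (x - y), norm_nonneg y₀]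
    calc ‖φ (x - y)‖ * (1 + ‖x‖) ^ N ≤ ‖φ (x - y)‖ * ((1 + ‖x - y‖) * (2 + ‖y₀‖)) ^ N := by gcongr
      _ = (2 + ‖y₀‖) ^ N * ((1 + ‖x - y‖) ^ N * ‖φ (x - y)‖) := by rw [mul_pow]; ring
      _ ≤ (2 + ‖y₀‖) ^ N * C := by gcongr; exact hC _

lemma continuous_integral_translate (hq : 1 < q) {v : Vec d → ℝ} (hv : MemLp v (ENNReal.ofReal q))
    (φ : 𝓢(Vec d, ℂ)) : Continuous fun y => ∫ x, (v x : ℂ) * φ (x - y) := by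
  rw [continuous_iff_continuousAt]
  intro y₀
  obtain ⟨g, hg, ⟨B, hB⟩, hle⟩ := schwartz_translate_bound φ y₀
  have h1 := (integrable_memLp_mul hq hv (hg.ofReal (𝕜 := ℂ)) (B := B) (fun x => by
    rw [RCLike.norm_ofReal]; exact hB x)).norm
  refine continuousAt_of_dominated (Eventually.of_forall fun y => ?_) ?_ h1 ?_
  · exact (memLp_ofReal hv).1.mul (φ.continuous.comp (continuous_id.sub continuous_const)).aestronglyMeasurable
  · filter_upwards [Metric.ball_mem_nhds y₀ one_pos] with y hy
    refine Eventually.of_forall fun x => ?_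
    rw [norm_mul, norm_mul, RCLike.norm_ofReal]
    gcongr
    exact (hle y hy x).trans (le_abs_self _)
  · exact Eventually.of_forall fun x => (continuous_const.mul
      (φ.continuous.comp (continuous_const.sub continuous_id))).continuousAt

lemma fourier_translate (f : Vec d → ℂ) (y ξ : Vec d) :
    𝓕 (fun x => f (x - y)) ξ = Real.fourierChar (-inner ℝ ξ y) • 𝓕 f ξ := by
  have := congrFun (VectorFourier.fourierIntegral_comp_add_right Real.fourierChar (volume : Measure (Vec d))
    (innerₗ (Vec d)) f (-y)) ξ
  have h2 : 𝓕 (fun x => f (x - y)) ξ = Real.fourierChar (innerₗ (Vec d) (-y) ξ) • 𝓕 f ξ := by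
    rw [← show (f ∘ fun v => v + -y) = fun x => f (x - y) by funext x; simp [sub_eq_add_neg]]
    exact this
  rw [h2]
  congr 2
  simp [real_inner_comm]

lemma fourierInv_mul_translate (m : Vec d → ℂ) (f : Vec d → ℂ) (y x : Vec d) :
    𝓕⁻ (fun ξ => m ξ * 𝓕 (fun x => f (x - y)) ξ) x = 𝓕⁻ (fun ξ => m ξ * 𝓕 f ξ) (x - y) := by
  rw [Real.fourierInv_eq, Real.fourierInv_eq]
  congr 1
  funext ξ
  rw [fourier_translate, mul_smul_comm, smul_smul]
  congr 1
  rw [← AddChar.map_add_eq_mul]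
  congr 1
  rw [inner_sub_right]
  ring

variable [NeZero d]

omit [NeZero d] in
/-- If the `v_i` annihilate `(m_i η̂)^∨` for all test functions `η`, then they annihilate
Schwartz functions of the form `(m_i χ̂)^∨`. -/
lemma sum_integral_eq_zero_of_test (hq : 1 < q) {ι : Type*} [Fintype ι] {v : ι → Vec d → ℝ}
    (hv : ∀ i, MemLp (v i) (ENNReal.ofReal q)) {m : ι → Vec d → ℂ}
    (hm : ∀ i (η : 𝓢(Vec d, ℂ)), Integrable (fun ξ => m i ξ * 𝓕 η ξ) ∧
      Integrable (𝓕⁻ fun ξ => m i ξ * 𝓕 η ξ))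
    (h0 : ∀ (η : Vec d → ℝ), ContDiff ℝ ∞ η → HasCompactSupport η →
      ∑ i, ∫ x, (v i x : ℂ) * 𝓕⁻ (fun ξ => m i ξ * 𝓕 (fun x => (η x : ℂ)) ξ) x = 0)
    {χ : 𝓢(Vec d, ℂ)} {φ : ι → 𝓢(Vec d, ℂ)} (hφ : ∀ i ξ, 𝓕 (φ i) ξ = m i ξ * 𝓕 χ ξ) :
    ∑ i, ∫ x, (v i x : ℂ) * φ i x = 0 := by
  -- The desired sum is `H 0`. Since `H` is continuous, it suffices that it vanishes against every
  -- smooth compactly supported `η`.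
  set H : Vec d → ℂ := fun y => ∑ i, ∫ x, (v i x : ℂ) * φ i (x - y) with hH
  have hHc : Continuous H := continuous_finsetSum _ fun i _ => continuous_integral_translate hq (hv i) (φ i)
  have hHz : ∀ᵐ y, H y = 0 := by
    refine ae_eq_zero_of_integral_contDiff_smul_eq_zero hHc.locallyIntegrable fun η hη hηc => ?_
    set ηS := toS η hη hηc with hηS
    have hηi : Integrable ηS := ηS.integrable
    set θ : ι → Vec d → ℂ := fun i => 𝓕⁻ fun ξ => m i ξ * 𝓕 ηS ξ with hθ
    -- Both convolutions have Fourier transform `m_i η̂ χ̂`, so the multiplier may act on `η`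
    -- instead of `χ`.
    have hsw : ∀ i x, ∫ y, ηS y * φ i (x - y) = ∫ y, χ y * θ i (x - y) := fun i x => by
      have h1 : (φ i : Vec d → ℂ) = 𝓕⁻ ((𝓕 (φ i) : 𝓢(Vec d, ℂ)) : Vec d → ℂ) := by
        rw [← SchwartzMap.fourierInv_coe, FourierTransform.fourierInv_fourier_eq]
      rw [h1, integral_mul_fourierInv_sub hηi (SchwartzMap.integrable _),
        integral_mul_fourierInv_sub χ.integrable (hm i ηS).1]
      congr 1
      funext ξ
      simp only [← SchwartzMap.fourier_coe, hφ, Circle.smul_def, smul_eq_mul]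
      ring
    have e1 := fun i => integral_translate_swap hq (hv i) (φ i).integrable
      (fun x => SchwartzMap.norm_le_seminorm ℝ (φ i) x) hηi
    have e2 := fun i => integral_translate_swap hq (hv i) (hm i ηS).2
      (fun x => norm_fourierInv_le _ x) (χ.integrable (μ := volume))
    calc ∫ y, η y • H y = ∫ y, ∑ i, ηS y * ∫ x, (v i x : ℂ) * φ i (x - y) := by
          congr 1; funext y
          rw [hH, ← Finset.mul_sum, hηS, toS_apply, Complex.real_smul]
      _ = ∑ i, ∫ y, ηS y * ∫ x, (v i x : ℂ) * φ i (x - y) := integral_finsetSum _ fun i _ => (e1 i).1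
      _ = ∑ i, ∫ y, χ y * ∫ x, (v i x : ℂ) * θ i (x - y) := by
          refine Finset.sum_congr rfl fun i _ => ?_
          rw [(e1 i).2, (e2 i).2]
          simp only [hsw]
          rfl
      _ = ∫ y, χ y * ∑ i, ∫ x, (v i x : ℂ) * θ i (x - y) := by
          rw [← integral_finsetSum _ fun i _ => (e2 i).1]
          simp only [Finset.mul_sum, hθ]
      _ = 0 := by
          -- The multiplier commutes with translations, and a translate of `η` is again an
          -- admissible test function.
          have : ∀ y, ∑ i, ∫ x, (v i x : ℂ) * θ i (x - y) = 0 := fun y => by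
            have h2 := h0 (fun x => η (x - y)) (hη.comp (contDiff_id.sub contDiff_const))
              (hηc.comp_homeomorph (Homeomorph.subRight y))
            rw [← h2]
            refine Finset.sum_congr rfl fun i _ => ?_
            congr 1; funext x
            rw [fourierInv_mul_translate (m i) (fun x => (η x : ℂ)) y x]
            rfl
          simp [this]
  have h1 : H = fun _ => 0 := by
    refine (Continuous.ae_eq_iff_eq volume hHc continuous_const).1 hHz
  have h2 := congrFun h1 0
  simpa [hH] using h2

/-- Functions in `L^q` that annihilate `𝓢₀` vanish. -/
lemma ae_eq_zero_of_forall_memS0 (hq : 1 < q) {v : Vec d → ℝ} (hv : MemLp v (ENNReal.ofReal q))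
    (h : ∀ χ : 𝓢(Vec d, ℂ), MemS0 χ → ∫ x, (v x : ℂ) * χ x = 0) : ∀ᵐ x, v x = 0 := by
  have hpq := Real.HolderConjugate.conjExponent hq
  have := hpq.ennrealOfReal
  have hS : ∀ φ : 𝓢(Vec d, ℂ), ∫ x, (v x : ℂ) * φ x = 0 := fun φ => by
    set c : ℕ → ℝ := fun n => (n : ℝ) + 1 with hc_def
    have hc0 : ∀ n, 0 < c n := fun n => by positivity
    have hc : Tendsto c atTop atTop :=
      tendsto_atTop_add_const_right _ _ tendsto_natCast_atTop_atTop
    have h1 := tendsto_eLpNorm_bandPass_cutoff φ hpq.symm.lt hc0 hc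
    have h2 : ∀ n, ‖∫ x, (v x : ℂ) * φ x‖ₑ ≤ eLpNorm (fun x => (v x : ℂ)) (ENNReal.ofReal q) volume *
        eLpNorm (bandPass (cutoff d) (c n) (hc0 n) φ) (ENNReal.ofReal q.conjExponent) volume := fun n => by
      -- The high-frequency part of `φ` is in `𝓢₀` and contributes nothing; the remaining
      -- low-frequency part tends to zero in the dual `L^{q'}`.
      have h3 : ∫ x, (v x : ℂ) * φ x = ∫ x, (v x : ℂ) * bandPass (cutoff d) (c n) (hc0 n) φ x := by
        have h4 := h _ (memS0_highPass (c n) (hc0 n) φ)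
        simp only [highPass, sub_apply, mul_sub] at h4
        rw [integral_sub (integrable_memLp_mul_schwartz hq hv _) (integrable_memLp_mul_schwartz hq hv _)] at h4
        exact sub_eq_zero.1 h4
      rw [h3]
      exact enorm_integral_mul_le hq (memLp_ofReal hv).1 (SchwartzMap.continuous _).aestronglyMeasurable
    have h5 := ge_of_tendsto' (ENNReal.Tendsto.const_mul h1 (Or.inr (memLp_ofReal hv).2.ne)) h2
    rw [mul_zero] at h5
    exact enorm_eq_zero.1 (le_antisymm h5 bot_le)
  refine ae_eq_zero_of_integral_contDiff_smul_eq_zero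
    (hv.locallyIntegrable (by rw [← ENNReal.ofReal_one]; exact ENNReal.ofReal_le_ofReal hq.le)) fun η hη hηc => ?_
  have h1 := hS (toS η hη hηc)
  have h2 : ∫ x, (v x : ℂ) * toS η hη hηc x = ((∫ x, η x • v x : ℝ) : ℂ) := by
    rw [← integral_complex_ofReal]
    congr 1; funext x
    rw [toS_apply]
    push_cast [smul_eq_mul]
    ring
  rw [h2] at h1
  exact_mod_cast h1

end Transfer

/-! ### Uniqueness in `L^q`: the homogeneous solution is divergence free and curl free -/

section Uniqueness

variable {d : ℕ}

lemma fourierInv_fourier_coe (φ : 𝓢(Vec d, ℂ)) : 𝓕⁻ ((𝓕 φ : 𝓢(Vec d, ℂ)) : Vec d → ℂ) = φ := by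
  rw [← SchwartzMap.fourierInv_coe, FourierTransform.fourierInv_fourier_eq]

lemma pdS_comm (j k : Fin d) (φ : 𝓢(Vec d, ℂ)) : pdS j (pdS k φ) = pdS k (pdS j φ) := by
  refine schwartz_ext_fourier fun ξ => ?_
  simp only [fourier_pdS]
  ring

lemma sum_kron_mul (f : Fin d → ℂ) (k : Fin d) : ∑ j, (kron j k : ℂ) * f j = f k := by
  simp [kron, apply_ite]

/-- The `i`-th component of `D_k η e_j - D_j η e_k`. -/
def curlS (j k i : Fin d) (η : 𝓢(Vec d, ℂ)) : 𝓢(Vec d, ℂ) :=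
  (kron i j : ℂ) • pdS k η + (-(kron i k : ℂ)) • pdS j η

lemma curlS_apply (j k i : Fin d) (η : 𝓢(Vec d, ℂ)) (x : Vec d) :
    curlS j k i η x = kron i j * pdS k η x + -kron i k * pdS j η x := rfl

lemma fourier_curlS (j k i : Fin d) (η : 𝓢(Vec d, ℂ)) (ξ : Vec d) :
    𝓕 (curlS j k i η) ξ =
      2 * Real.pi * Complex.I * ((kron i j : ℂ) * ξ k - (kron i k : ℂ) * ξ j) * 𝓕 η ξ := by
  unfold curlS
  rw [FourierTransform.fourier_add, FourierTransform.fourier_smul, FourierTransform.fourier_smul]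
  simp only [add_apply, smul_apply, fourier_pdS, smul_eq_mul]
  ring

lemma contDiff_pd {η : Vec d → ℝ} (hη : ContDiff ℝ ∞ η) (k : Fin d) : ContDiff ℝ ∞ (pd k η) :=
  (hη.fderiv_right (m := ∞) (by simp)).clm_apply contDiff_const

lemma hasCompactSupport_pd {η : Vec d → ℝ} (hη : HasCompactSupport η) (k : Fin d) : HasCompactSupport (pd k η) :=
  hη.fderiv_apply ℝ _

variable [NeZero d] {α p q : ℝ}

/-- A homogeneous very weak solution in `L^q` is divergence free. -/
lemma sum_integral_mul_pdS_eq_zero (e : Exponents d α p q) {w : Vec d → Vec d} (hw : MemLp w (ENNReal.ofReal q))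
    (h : ∀ (Φ : Vec d → Vec d) (ψ : Vec d → ℝ), ContDiff ℝ ∞ Φ → HasCompactSupport Φ →
      (∀ x, ∑ j, pd j (fun y => Φ y j) x = 0) → ContDiff ℝ ∞ ψ → HasCompactSupport ψ →
      ∫ x, ∑ j, (w x j : ℂ) * (fracLap (2 * α) (fun y => (Φ y j : ℂ)) x + ((pd j ψ x : ℝ) : ℂ)) = 0)
    (χ : 𝓢(Vec d, ℂ)) : ∑ j, ∫ x, (w x j : ℂ) * pdS j χ x = 0 := by
  have hq := e.one_lt_right
  have hwj : ∀ j, MemLp (fun x => w x j) (ENNReal.ofReal q) := fun j => hw.eval_piLp j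
  have key : ∀ (j : Fin d) (η : 𝓢(Vec d, ℂ)), (fun ξ : Vec d => 2 * (Real.pi : ℂ) * Complex.I * ξ j * 𝓕 η ξ) =
      ((𝓕 (pdS j η) : 𝓢(Vec d, ℂ)) : Vec d → ℂ) := fun j η => by
    funext ξ; rw [fourier_pdS]
  refine sum_integral_eq_zero_of_test hq hwj (m := fun j ξ => 2 * Real.pi * Complex.I * ξ j)
    (χ := χ) (fun j η => ?_) (fun η hη hηc => ?_) (fun j ξ => fourier_pdS j χ ξ)
  · rw [key, fourierInv_fourier_coe]
    exact ⟨SchwartzMap.integrable _, SchwartzMap.integrable _⟩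
  -- The choice `Φ = 0` isolates the divergence condition.
  · have h1 := h (fun _ => 0) η contDiff_const HasCompactSupport.zero (by simp [pd]) hη hηc
    have h2 : fracLap (d := d) (2 * α) (fun _ => 0) = 0 := by
      have h3 : 𝓕 (fun _ : Vec d => (0 : ℂ)) = 0 := by funext ξ; simp [Real.fourier_eq]
      unfold fracLap
      rw [h3]
      funext x
      simp [Real.fourierInv_eq]
    simp only [PiLp.zero_apply, Complex.ofReal_zero, h2, Pi.zero_apply, zero_add] at h1
    have h4 : ∀ j x, ((pd j η x : ℝ) : ℂ) = pdS j (toS η hη hηc) x := fun j x => by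
      rw [pdS_apply]; exact (pd_ofReal η (hη.differentiable (by simp)) j x).symm
    simp only [h4] at h1
    rw [integral_finsetSum _ fun j _ => integrable_memLp_mul_schwartz hq (hwj j) _] at h1
    rw [← h1]
    refine Finset.sum_congr rfl fun j _ => ?_
    rw [← coe_toS η hη hηc]
    have := key j (toS η hη hηc)
    simp only [SchwartzMap.fourier_coe] at this
    rw [this, ← SchwartzMap.fourier_coe, fourierInv_fourier_coe]

/-- A homogeneous very weak solution in `L^q` is curl free, tested on `𝓢₀`. -/
lemma integral_mul_pdS_comm (e : Exponents d α p q) {w : Vec d → Vec d} (hw : MemLp w (ENNReal.ofReal q))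
    (h : ∀ (Φ : Vec d → Vec d) (ψ : Vec d → ℝ), ContDiff ℝ ∞ Φ → HasCompactSupport Φ →
      (∀ x, ∑ j, pd j (fun y => Φ y j) x = 0) → ContDiff ℝ ∞ ψ → HasCompactSupport ψ →
      ∫ x, ∑ j, (w x j : ℂ) * (fracLap (2 * α) (fun y => (Φ y j : ℂ)) x + ((pd j ψ x : ℝ) : ℂ)) = 0)
    (j k : Fin d) {χ : 𝓢(Vec d, ℂ)} (hχ : MemS0 χ) :
    ∫ x, (w x j : ℂ) * pdS k χ x = ∫ x, (w x k : ℂ) * pdS j χ x := by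
  have hq := e.one_lt_right
  have hα : 0 < 2 * α := by linarith [e.half_lt]
  have hd0 : (0 : ℝ) < d := by exact_mod_cast Nat.pos_of_neZero d
  have hwj : ∀ j, MemLp (fun x => w x j) (ENNReal.ofReal q) := fun j => hw.eval_piLp j
  set m : Fin d → Vec d → ℂ := fun i ξ => (((2 * Real.pi * ‖ξ‖) ^ (2 * α) : ℝ) : ℂ) *
    (2 * Real.pi * Complex.I * ((kron i j : ℂ) * ξ k - (kron i k : ℂ) * ξ j)) with hm
  have key : ∀ (i : Fin d) (η : 𝓢(Vec d, ℂ)), (fun ξ : Vec d => m i ξ * 𝓕 η ξ) =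
      fun ξ => (((2 * Real.pi * ‖ξ‖) ^ (2 * α) : ℝ) : ℂ) * 𝓕 (curlS j k i η) ξ := fun i η => by
    funext ξ; rw [fourier_curlS, hm]; ring
  have key2 : ∀ (i : Fin d) (η : 𝓢(Vec d, ℂ)), 𝓕⁻ (fun ξ : Vec d => m i ξ * 𝓕 η ξ) =
      fracLap (2 * α) (curlS j k i η) := fun i η => by
    rw [key]; rfl
  have hmain : ∑ i, ∫ x, (w x i : ℂ) * curlS j k i χ x = 0 := by
    -- The tests only control `Λ^{2α}` of a curl. Taking `Λ^{-2α}χ` as the Schwartz function undoes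
    -- `Λ^{2α}` and returns the curl of `χ`; it need not have compact support, hence the transfer.
    refine sum_integral_eq_zero_of_test hq hwj (m := m) (χ := lapS0 (-(2 * α)) χ)
      (fun i η => ?_) (fun η hη hηc => ?_) (fun i ξ => ?_)
    · rw [key2, key]
      exact ⟨integrable_symbol_mul_schwartz (by linarith) _, integrable_fracLap hα _⟩
    -- The real field `D_k η e_j - D_j η e_k` is divergence free because partial derivatives
    -- commute.
    · set Φ : Vec d → Vec d := fun y => EuclideanSpace.single j (pd k η y) - EuclideanSpace.single k (pd j η y)
        with hΦ
      have hcomp : ∀ i y, Φ y i = kron i j * pd k η y - kron i k * pd j η y := fun i y => by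
        simp [hΦ, kron]
      set ηS := toS η hη hηc with hηS
      have hpd : ∀ l y, pdS l ηS y = ((pd l η y : ℝ) : ℂ) := fun l y => by
        rw [pdS_apply]; exact pd_ofReal η (hη.differentiable (by simp)) l y
      have hΦS : ∀ i, (fun y => ((Φ y i : ℝ) : ℂ)) = curlS j k i ηS := fun i => by
        funext y
        rw [hcomp, curlS_apply, hpd, hpd]
        push_cast; ring
      have hΦd : ContDiff ℝ ∞ Φ := by
        rw [contDiff_euclidean]
        intro i
        simp only [hcomp]
        exact (contDiff_const.mul (contDiff_pd hη k)).sub (contDiff_const.mul (contDiff_pd hη j))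
      have hΦc : HasCompactSupport Φ := by
        have h1 : HasCompactSupport fun y => (EuclideanSpace.single j (pd k η y) : Vec d) :=
          (hasCompactSupport_pd hηc k).comp_left (g := fun r => (EuclideanSpace.single j r : Vec d)) (by simp)
        have h2 : HasCompactSupport fun y => (EuclideanSpace.single k (pd j η y) : Vec d) :=
          (hasCompactSupport_pd hηc j).comp_left (g := fun r => (EuclideanSpace.single k r : Vec d)) (by simp)
        exact h1.sub h2
      have hdiv : ∀ x, ∑ i, pd i (fun y => Φ y i) x = 0 := fun x => by
        have h1 : ∑ i, pdS i (curlS j k i ηS) = 0 := by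
          refine schwartz_ext_fourier fun ξ => ?_
          rw [FourierTransform.fourier_sum]
          simp only [sum_apply, fourier_pdS, fourier_curlS, FourierTransform.fourier_zero, zero_apply]
          have e1 : ∀ i : Fin d, 2 * (Real.pi : ℂ) * Complex.I * ξ i *
              (2 * Real.pi * Complex.I * ((kron i j : ℂ) * ξ k - (kron i k : ℂ) * ξ j) * 𝓕 ηS ξ) =
              (kron i j : ℂ) * (2 * Real.pi * Complex.I * (2 * Real.pi * Complex.I) * ξ k * 𝓕 ηS ξ * ξ i) -
              (kron i k : ℂ) * (2 * Real.pi * Complex.I * (2 * Real.pi * Complex.I) * ξ j * 𝓕 ηS ξ * ξ i) :=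
            fun i => by ring
          rw [Finset.sum_congr rfl fun i _ => e1 i, Finset.sum_sub_distrib, sum_kron_mul, sum_kron_mul]
          ring
        have h2 := congrArg (fun f : 𝓢(Vec d, ℂ) => f x) h1
        simp only [sum_apply, pdS_apply, zero_apply] at h2
        have h3 : ∀ i, pd i (curlS j k i ηS) x = ((pd i (fun y => Φ y i) x : ℝ) : ℂ) := fun i => by
          rw [← hΦS]
          exact pd_ofReal _ ((contDiff_coord hΦd i).differentiable (by simp)) i x
        simp only [h3] at h2
        exact_mod_cast h2
      have h1 := h Φ (fun _ => 0) hΦd hΦc hdiv contDiff_const HasCompactSupport.zero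
      have h2 : ∀ i x, pd i (fun _ : Vec d => (0 : ℝ)) x = 0 := fun i x => by simp [pd]
      simp only [h2, Complex.ofReal_zero, add_zero, hΦS] at h1
      rw [integral_finsetSum _ fun i _ => integrable_memLp_mul hq (hwj i) (integrable_fracLap hα _)
        (fracLap_bounded (s := 2 * α) (curlS j k i ηS)).choose_spec] at h1
      rw [← h1]
      refine Finset.sum_congr rfl fun i _ => ?_
      have := key2 i ηS
      simp only [SchwartzMap.fourier_coe] at this
      rw [← coe_toS η hη hηc, this]
    -- At the origin the powers `2α` and `-2α` do not cancel, but both sides vanish because `χ̂(0) =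
    -- 0`.
    · by_cases hξ : ξ = 0
      · have h1 : 𝓕 χ ξ = 0 := by
          have := hχ 0
          rw [hξ]
          simpa using congrArg (fun L => L (fun i : Fin 0 => i.elim0)) this
        rw [fourier_curlS, fourier_lapS0 _ hχ, h1]; simp
      · have hn := norm_pos_iff.2 hξ
        rw [fourier_curlS, fourier_lapS0 _ hχ, hm]
        have hA : (((2 * Real.pi * ‖ξ‖) ^ (2 * α) : ℝ) : ℂ) * (((2 * Real.pi * ‖ξ‖) ^ (-(2 * α)) : ℝ) : ℂ) = 1 := by
          rw [← Complex.ofReal_mul, ← Real.rpow_add (by positivity)]; simp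
        linear_combination (-(2 * Real.pi * Complex.I * ((kron i j : ℂ) * ξ k - (kron i k : ℂ) * ξ j) * 𝓕 χ ξ)) * hA
  have h1 : ∀ i, ∫ x, (w x i : ℂ) * curlS j k i χ x = (kron i j : ℂ) * (∫ x, (w x i : ℂ) * pdS k χ x) -
      (kron i k : ℂ) * ∫ x, (w x i : ℂ) * pdS j χ x := fun i => by
    rw [← integral_const_mul, ← integral_const_mul, ← integral_sub
      ((integrable_memLp_mul_schwartz hq (hwj i) _).const_mul _)
      ((integrable_memLp_mul_schwartz hq (hwj i) _).const_mul _)]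
    congr 1; funext x
    rw [curlS_apply]; ring
  rw [Finset.sum_congr rfl fun i _ => h1 i, Finset.sum_sub_distrib,
    sum_kron_mul (fun i => ∫ x, (w x i : ℂ) * pdS k χ x),
    sum_kron_mul (fun i => ∫ x, (w x i : ℂ) * pdS j χ x)] at hmain
  exact sub_eq_zero.1 hmain

/-- The Laplacian is `-Λ²`, hence invertible on `𝓢₀`. Every `g` in `𝓢₀` is therefore `Δχ` with `χ =
-Λ^{-2}g` again in `𝓢₀`. -/
lemma sum_pdS_pdS_lapS0 {g : 𝓢(Vec d, ℂ)} (hg : MemS0 g) :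
    ∑ k, pdS k (pdS k ((-1 : ℂ) • lapS0 (-2) g)) = g := by
  refine schwartz_ext_fourier_ne fun ξ hξ => ?_
  have hn := norm_pos_iff.2 hξ
  rw [FourierTransform.fourier_sum]
  simp only [sum_apply, fourier_pdS, FourierTransform.fourier_smul, smul_apply, fourier_lapS0 _ hg, smul_eq_mul]
  have e1 : ∀ k : Fin d, 2 * (Real.pi : ℂ) * Complex.I * ξ k * (2 * Real.pi * Complex.I * ξ k *
      (-1 * ((((2 * Real.pi * ‖ξ‖) ^ (-2 : ℝ) : ℝ) : ℂ) * 𝓕 g ξ))) =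
      ((ξ k : ℂ) * ξ k) * (4 * Real.pi ^ 2 * (((2 * Real.pi * ‖ξ‖) ^ (-2 : ℝ) : ℝ) : ℂ) * 𝓕 g ξ) := fun k => by
    linear_combination (-(4 * (Real.pi : ℂ) ^ 2 * ξ k * ξ k * (((2 * Real.pi * ‖ξ‖) ^ (-2 : ℝ) : ℝ) : ℂ) * 𝓕 g ξ)) *
      Complex.I_sq
  simp only [e1]
  rw [← Finset.sum_mul]
  have hsq : ∑ j, (ξ j : ℂ) * ξ j = (‖ξ‖ : ℂ) ^ 2 := by
    have := EuclideanSpace.real_norm_sq_eq ξ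
    rw [← Complex.ofReal_pow, this]
    push_cast
    simp [sq]
  have hn' : (‖ξ‖ : ℂ) ≠ 0 := by exact_mod_cast hn.ne'
  have hpi : (Real.pi : ℂ) ≠ 0 := by exact_mod_cast Real.pi_ne_zero
  rw [hsq, Real.rpow_neg (by positivity), show (2 : ℝ) = ((2 : ℕ) : ℝ) by norm_num, Real.rpow_natCast]
  push_cast
  field_simp
  ring

/-- Uniqueness of very weak solutions in `L^q`. -/
lemma ae_eq_zero_of_homogeneous (e : Exponents d α p q) {w : Vec d → Vec d} (hw : MemLp w (ENNReal.ofReal q))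
    (h : ∀ (Φ : Vec d → Vec d) (ψ : Vec d → ℝ), ContDiff ℝ ∞ Φ → HasCompactSupport Φ →
      (∀ x, ∑ j, pd j (fun y => Φ y j) x = 0) → ContDiff ℝ ∞ ψ → HasCompactSupport ψ →
      ∫ x, ∑ j, (w x j : ℂ) * (fracLap (2 * α) (fun y => (Φ y j : ℂ)) x + ((pd j ψ x : ℝ) : ℂ)) = 0) :
    w =ᵐ[volume] 0 := by
  have hq := e.one_lt_right
  have hwj : ∀ j, MemLp (fun x => w x j) (ENNReal.ofReal q) := fun j => hw.eval_piLp j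
  have h1 : ∀ j, ∀ᵐ x, w x j = 0 := fun j => by
    refine ae_eq_zero_of_forall_memS0 hq (hwj j) fun g hg => ?_
    set χ := (-1 : ℂ) • lapS0 (-2) g with hχ
    have hχ0 : MemS0 χ := (hg.lapS0 _).smul _
    have h2 : ∫ x, (w x j : ℂ) * g x = ∑ k, ∫ x, (w x j : ℂ) * pdS k (pdS k χ) x := by
      rw [← integral_finsetSum _ fun k _ => integrable_memLp_mul_schwartz hq (hwj j) _]
      congr 1; funext x
      rw [← Finset.mul_sum]
      congr 1
      conv_lhs => rw [← sum_pdS_pdS_lapS0 hg]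
      rw [sum_apply]
    -- Pairing `w_j` with `Δχ`: curl-freeness turns `w_j D_k(D_k χ)` into `w_k D_j(D_k χ) = w_k
    -- D_k(D_j χ)`, and the sum over `k` is the divergence condition tested on `D_j χ`.
    rw [h2, ← sum_integral_mul_pdS_eq_zero e hw h (pdS j χ)]
    refine Finset.sum_congr rfl fun k _ => ?_
    rw [integral_mul_pdS_comm e hw h j k (hχ0.pdS k), pdS_comm]
  filter_upwards [ae_all_iff.2 h1] with x hx
  ext j
  exact hx j

lemma ae_eq_of_isVeryWeakSolution (e : Exponents d α p q) {F : Vec d → Tens d} {u v : Vec d → Vec d}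
    (hu : MemLp u (ENNReal.ofReal q)) (hv : MemLp v (ENNReal.ofReal q))
    (hus : IsVeryWeakSolution α F u) (hvs : IsVeryWeakSolution α F v) : v =ᵐ[volume] u := by
  have hq := e.one_lt_right
  have hα : 0 < 2 * α := by linarith [e.half_lt]
  have h0 : v - u =ᵐ[volume] 0 := by
    refine ae_eq_zero_of_homogeneous e (hv.sub hu) fun Φ ψ hΦ hΦc hdiv hψ hψc => ?_
    have hI : ∀ {w : Vec d → Vec d}, MemLp w (ENNReal.ofReal q) → Integrable fun x =>
        ∑ j, (w x j : ℂ) * (fracLap (2 * α) (fun y => (Φ y j : ℂ)) x + ((pd j ψ x : ℝ) : ℂ)) := fun {w} hw => by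
      refine integrable_finsetSum _ fun j _ => ?_
      simp only [mul_add]
      have hwj : MemLp (fun x => w x j) (ENNReal.ofReal q) := hw.eval_piLp j
      refine Integrable.add ?_ ?_
      · set φ := toS (fun x => Φ x j) (contDiff_coord hΦ j) (hasCompactSupport_coord hΦc j)
        exact integrable_memLp_mul hq hwj (integrable_fracLap hα φ)
          (fracLap_bounded (s := 2 * α) φ).choose_spec
      · have h1 := integrable_memLp_mul_schwartz hq hwj (pdS j (toS ψ hψ hψc))
        refine h1.congr (Eventually.of_forall fun x => ?_)
        beta_reduce
        rw [pdS_apply, coe_toS, pd_ofReal ψ (hψ.differentiable (by simp))]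
    have h1 := hus.2 Φ ψ hΦ hΦc hdiv hψ hψc
    have h2 := hvs.2 Φ ψ hΦ hΦc hdiv hψ hψc
    have h3 := sub_eq_zero.2 (h2.trans h1.symm)
    rw [← integral_sub (hI hv) (hI hu)] at h3
    rw [← h3]
    congr 1; funext x
    rw [← Finset.sum_sub_distrib]
    refine Finset.sum_congr rfl fun j _ => ?_
    simp only [Pi.sub_apply, PiLp.sub_apply]
    push_cast
    ring
  filter_upwards [h0] with x hx
  exact sub_eq_zero.1 hx

end Uniqueness

/-! ### Riesz transforms on `L²` -/

section RieszTransform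

variable {d : ℕ}

/-- Complex-valued square integrable functions. -/
abbrev L2 (d : ℕ) : Type := Lp ℂ 2 (volume : Measure (Vec d))

lemma memS0_zero : MemS0 (0 : 𝓢(Vec d, ℂ)) := by
  intro n
  rw [FourierTransform.fourier_zero]
  change iteratedFDeriv ℝ n (fun _ => (0 : ℂ)) (0 : Vec d) = 0
  rw [iteratedFDeriv_fun_zero]
  rfl

/-- The space `𝓢₀` as a subspace of the Schwartz space. -/
def S0 (d : ℕ) : Submodule ℂ 𝓢(Vec d, ℂ) where
  carrier := {φ | MemS0 φ}
  add_mem' h h' := MemS0.add h h'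
  zero_mem' := memS0_zero
  smul_mem' c _ h := MemS0.smul c h

/-- The inclusion of `𝓢₀` into `L²`. -/
def S0.toL2 : S0 d →ₗ[ℂ] L2 d :=
  (SchwartzMap.toLpCLM ℂ ℂ 2 (volume : Measure (Vec d))).toLinearMap ∘ₗ (S0 d).subtype

lemma S0.toL2_apply (φ : S0 d) : S0.toL2 φ = (φ : 𝓢(Vec d, ℂ)).toLp 2 := rfl

lemma fourier_add_apply (φ ψ : 𝓢(Vec d, ℂ)) (ξ : Vec d) : 𝓕 (φ + ψ) ξ = 𝓕 φ ξ + 𝓕 ψ ξ := by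
  rw [FourierTransform.fourier_add]; rfl

lemma fourier_smul_apply (c : ℂ) (φ : 𝓢(Vec d, ℂ)) (ξ : Vec d) : 𝓕 (c • φ) ξ = c * 𝓕 φ ξ := by
  rw [FourierTransform.fourier_smul]; rfl

/-- The Riesz transforms on `𝓢₀`, with values in `L²`. -/
def rieszToL2 (l : Fin d) : S0 d →ₗ[ℂ] L2 d where
  toFun φ := (rieszS0 l φ).toLp 2
  map_add' φ ψ := by
    have : rieszS0 l ((φ + ψ : S0 d) : 𝓢(Vec d, ℂ)) = rieszS0 l φ + rieszS0 l ψ := by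
      refine schwartz_ext_fourier fun ξ => ?_
      rw [fourier_add_apply, fourier_rieszS0 l (φ + ψ).2, fourier_rieszS0 l φ.2, fourier_rieszS0 l ψ.2,
        Submodule.coe_add, fourier_add_apply]
      ring
    rw [this]
    rfl
  map_smul' c φ := by
    have : rieszS0 l ((c • φ : S0 d) : 𝓢(Vec d, ℂ)) = c • rieszS0 l φ := by
      refine schwartz_ext_fourier fun ξ => ?_
      rw [fourier_smul_apply, fourier_rieszS0 l (c • φ).2, fourier_rieszS0 l φ.2,
        Submodule.coe_smul, fourier_smul_apply]
      ring
    rw [this]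
    rfl

/-- Plancherel, as the symbol has modulus at most one. The explicit factor `1` is the constant in
the bound required for the extension by density. -/
lemma norm_rieszToL2_le (l : Fin d) (φ : S0 d) : ‖rieszToL2 l φ‖ ≤ 1 * ‖S0.toL2 φ‖ := by
  have e1 : rieszToL2 l φ = (rieszS0 l φ).toLp 2 := rfl
  rw [one_mul, S0.toL2_apply, e1, ← SchwartzMap.norm_fourier_toL2_eq (rieszS0 l φ),
    ← SchwartzMap.norm_fourier_toL2_eq (φ : 𝓢(Vec d, ℂ)), SchwartzMap.norm_toLp, SchwartzMap.norm_toLp]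
  refine ENNReal.toReal_mono (SchwartzMap.memLp _ 2 _).2.ne (eLpNorm_mono fun ξ => ?_)
  rw [fourier_rieszS0 l φ.2, norm_mul, norm_mul, Complex.norm_I, one_mul, Complex.norm_real]
  refine mul_le_of_le_one_left (norm_nonneg _) ?_
  rw [Real.norm_eq_abs, abs_div, abs_norm]
  exact div_le_one_of_le₀ (abs_coord_le ξ l) (norm_nonneg _)

variable [NeZero d]

/-- Schwartz functions are dense, and deleting low frequencies changes them little in `L²`. -/
lemma denseRange_S0_toL2 : DenseRange (S0.toL2 (d := d)) := by
  have h1 : DenseRange (SchwartzMap.toLpCLM ℝ ℂ 2 (volume : Measure (Vec d))) :=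
    SchwartzMap.denseRange_toLpCLM ENNReal.ofNat_ne_top
  refine dense_iff_closure_eq.2 (Set.eq_univ_of_univ_subset ?_)
  rw [← h1.closure_range]
  refine closure_minimal ?_ isClosed_closure
  rintro _ ⟨φ, rfl⟩
  set c : ℕ → ℝ := fun n => (n : ℝ) + 1 with hc_def
  have hc0 : ∀ n, 0 < c n := fun n => by positivity
  have hc : Tendsto c atTop atTop := tendsto_atTop_add_const_right _ _ tendsto_natCast_atTop_atTop
  have h2 := tendsto_eLpNorm_bandPass_cutoff φ (one_lt_two (α := ℝ)) hc0 hc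
  rw [show ENNReal.ofReal 2 = 2 by simp] at h2
  refine mem_closure_of_tendsto (b := atTop) (f := fun n => (highPass (c n) (hc0 n) φ).toLp 2) ?_
    (Eventually.of_forall fun n => ⟨⟨highPass (c n) (hc0 n) φ, memS0_highPass _ _ _⟩, rfl⟩)
  rw [SchwartzMap.toLpCLM_apply]
  refine (Lp.tendsto_Lp_iff_tendsto_eLpNorm'' _ (fun n => SchwartzMap.memLp _ 2 _) _ (SchwartzMap.memLp _ 2 _)).2 ?_
  refine h2.congr fun n => ?_
  rw [← eLpNorm_neg]
  congr 1
  funext x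
  simp [highPass]

/-- The Riesz transforms on `L²`. -/
def riesz (l : Fin d) : L2 d →L[ℂ] L2 d := (rieszToL2 l).extendOfNorm S0.toL2

lemma riesz_toLp (l : Fin d) {φ : 𝓢(Vec d, ℂ)} (h : MemS0 φ) : riesz l (φ.toLp 2) = (rieszS0 l φ).toLp 2 :=
  LinearMap.extendOfNorm_eq denseRange_S0_toL2 ⟨1, norm_rieszToL2_le l⟩ ⟨φ, h⟩

lemma sum_rieszS0_rieszS0 {φ : 𝓢(Vec d, ℂ)} (h : MemS0 φ) : ∑ l, rieszS0 l (rieszS0 l φ) = -φ := by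
  refine schwartz_ext_fourier_ne fun ξ hξ => ?_
  have hn := norm_pos_iff.2 hξ
  rw [FourierTransform.fourier_sum, FourierTransform.fourier_neg]
  simp only [sum_apply, neg_apply, fourier_rieszS0 _ (h.rieszS0 _), fourier_rieszS0 _ h]
  have e1 : ∀ l : Fin d, Complex.I * ((ξ l / ‖ξ‖ : ℝ) : ℂ) * (Complex.I * ((ξ l / ‖ξ‖ : ℝ) : ℂ) * 𝓕 φ ξ) =
      ((ξ l : ℂ) * ξ l) * (-1 / (‖ξ‖ : ℂ) ^ 2 * 𝓕 φ ξ) := fun l => by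
    push_cast
    linear_combination ((ξ l : ℂ) / ‖ξ‖ * (ξ l / ‖ξ‖) * 𝓕 φ ξ) * Complex.I_sq
  have hsq : ∑ j, (ξ j : ℂ) * ξ j = (‖ξ‖ : ℂ) ^ 2 := by
    have := EuclideanSpace.real_norm_sq_eq ξ
    rw [← Complex.ofReal_pow, this]
    push_cast
    simp [sq]
  have hn' : (‖ξ‖ : ℂ) ≠ 0 := by exact_mod_cast hn.ne'
  simp only [e1]
  rw [← Finset.sum_mul, hsq]
  field_simp

lemma sum_riesz_riesz (f : L2 d) : ∑ l, riesz l (riesz l f) = -f := by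
  refine congrFun (denseRange_S0_toL2.equalizer (g := fun f => ∑ l, riesz l (riesz l f)) (h := fun f => -f)
    (by fun_prop) (by fun_prop) ?_) f
  funext φ
  simp only [Function.comp_apply, S0.toL2_apply, riesz_toLp _ φ.2, riesz_toLp _ (φ.2.rieszS0 _)]
  have h1 := congrArg (SchwartzMap.toLpCLM ℂ ℂ 2 (volume : Measure (Vec d))) (sum_rieszS0_rieszS0 φ.2)
  rw [map_sum, map_neg] at h1
  exact h1

/-- The bilinear pairing of `L²` functions. -/
def pairing : L2 d →L[ℂ] L2 d →L[ℂ] ℂ := (ContinuousLinearMap.mul ℂ ℂ).lpPairing volume 2 2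

omit [NeZero d] in
lemma pairing_apply (f g : L2 d) : pairing f g = ∫ x, f x * g x := by
  rw [pairing, ContinuousLinearMap.lpPairing_eq_integral]
  rfl

omit [NeZero d] in
lemma pairing_toLp (f : L2 d) (φ : 𝓢(Vec d, ℂ)) : pairing f (φ.toLp 2) = ∫ x, f x * φ x := by
  rw [pairing_apply]
  refine integral_congr_ae ?_
  filter_upwards [φ.coeFn_toLp 2 volume] with x hx
  rw [hx]

-- The pairing has no complex conjugate, so it couples the frequencies `ξ` and `-ξ`; the symbol `i
-- ξ_l / |ξ|` is odd, whence the sign.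
omit [NeZero d] in
lemma integral_rieszS0_mul (l : Fin d) {φ ψ : 𝓢(Vec d, ℂ)} (h : MemS0 φ) (h' : MemS0 ψ) :
    ∫ x, rieszS0 l φ x * ψ x = -∫ x, φ x * rieszS0 l ψ x := by
  have key : ∀ f g : 𝓢(Vec d, ℂ), ∫ x, f x * g x = ∫ ξ, 𝓕 f ξ * 𝓕 g (-ξ) := fun f g => by
    have h1 := SchwartzMap.integral_fourier_mul_eq f (𝓕⁻ g)
    rw [FourierTransform.fourier_fourierInv_eq] at h1
    rw [← h1]
    refine integral_congr_ae (Eventually.of_forall fun ξ => ?_)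
    beta_reduce
    rw [SchwartzMap.fourierInv_apply_eq]
    rfl
  rw [key, key, ← integral_neg]
  refine integral_congr_ae (Eventually.of_forall fun ξ => ?_)
  beta_reduce
  rw [fourier_rieszS0 l h, fourier_rieszS0 l h', PiLp.neg_apply, norm_neg]
  push_cast
  ring

lemma pairing_riesz (l : Fin d) (f g : L2 d) : pairing (riesz l f) g = -pairing f (riesz l g) := by
  refine congrFun (denseRange_S0_toL2.equalizer (g := fun f => pairing (riesz l f) g)
    (h := fun f => -pairing f (riesz l g)) (by fun_prop) (by fun_prop) ?_) f
  funext φ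
  refine congrFun (denseRange_S0_toL2.equalizer (g := fun g => pairing (riesz l (S0.toL2 φ)) g)
    (h := fun g => -pairing (S0.toL2 φ) (riesz l g)) (by fun_prop) (by fun_prop) ?_) g
  funext ψ
  have e1 : ∀ a b : 𝓢(Vec d, ℂ), pairing (a.toLp 2) (b.toLp 2) = ∫ x, a x * b x := fun a b => by
    rw [pairing_toLp]
    refine integral_congr_ae ?_
    filter_upwards [a.coeFn_toLp 2 volume] with x hx
    rw [hx]
  simp only [Function.comp_apply, S0.toL2_apply, riesz_toLp _ φ.2, riesz_toLp _ ψ.2, e1]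
  exact integral_rieszS0_mul l φ.2 ψ.2

end RieszTransform

/-! ### The energy identity -/

section Energy

variable {d : ℕ}

/-- Complex conjugation of Schwartz functions. -/
def conjS (φ : 𝓢(Vec d, ℂ)) : 𝓢(Vec d, ℂ) := φ.postcompCLM (𝕜 := ℝ) (Complex.conjCLE : ℂ →L[ℝ] ℂ)

lemma conjS_apply (φ : 𝓢(Vec d, ℂ)) (x : Vec d) : conjS φ x = (starRingEnd ℂ) (φ x) := rfl

lemma fourier_conjS (φ : 𝓢(Vec d, ℂ)) (ξ : Vec d) : 𝓕 (conjS φ) ξ = (starRingEnd ℂ) (𝓕 φ (-ξ)) := by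
  rw [SchwartzMap.fourier_coe, SchwartzMap.fourier_coe, Real.fourier_eq, Real.fourier_eq, ← integral_conj]
  refine integral_congr_ae (Eventually.of_forall fun x => ?_)
  simp only [conjS_apply, Circle.smul_def, smul_eq_mul, map_mul, inner_neg_right, neg_neg]
  congr 1
  rw [← Circle.coe_inv_eq_conj, ← AddChar.map_neg_eq_inv]

lemma MemS0.conjS {φ : 𝓢(Vec d, ℂ)} (h : MemS0 φ) : MemS0 (conjS φ) := by
  intro n
  have h1 : ((𝓕 (FracStokes.conjS φ) : 𝓢(Vec d, ℂ)) : Vec d → ℂ) =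
      Complex.conjLIE ∘ (((𝓕 φ : 𝓢(Vec d, ℂ)) : Vec d → ℂ) ∘ (LinearIsometryEquiv.neg ℝ (E := Vec d))) := by
    funext ξ
    exact fourier_conjS φ ξ
  rw [h1, ← norm_eq_zero, LinearIsometryEquiv.norm_iteratedFDeriv_comp_left,
    LinearIsometryEquiv.norm_iteratedFDeriv_comp_right, map_zero, h n, norm_zero]

/-- The symbol is real and even. This is used to see that `Λ^s` of a real function is real. -/
lemma lapS0_conjS (s : ℝ) {φ : 𝓢(Vec d, ℂ)} (h : MemS0 φ) : lapS0 s (conjS φ) = conjS (lapS0 s φ) := by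
  refine schwartz_ext_fourier fun ξ => ?_
  rw [fourier_lapS0 _ h.conjS, fourier_conjS, fourier_conjS, fourier_lapS0 _ h, map_mul, norm_neg,
    Complex.conj_ofReal]

variable [NeZero d]

lemma lapS0_lapS0_neg (s : ℝ) {φ : 𝓢(Vec d, ℂ)} (h : MemS0 φ) : lapS0 s (lapS0 (-s) φ) = φ := by
  refine schwartz_ext_fourier_ne fun ξ hξ => ?_
  have hn := norm_pos_iff.2 hξ
  rw [fourier_lapS0 _ (h.lapS0 _), fourier_lapS0 _ h, ← mul_assoc, ← Complex.ofReal_mul,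
    ← Real.rpow_add (by positivity)]
  simp

/-- `D_k = Λ^{1-s} R_k Λ^s`. -/
lemma pdS_eq_lapS0_rieszS0 (s : ℝ) (k : Fin d) {φ : 𝓢(Vec d, ℂ)} (h : MemS0 φ) :
    pdS k φ = lapS0 (1 - s) (rieszS0 k (lapS0 s φ)) := by
  refine schwartz_ext_fourier_ne fun ξ hξ => ?_
  have hn := norm_pos_iff.2 hξ
  rw [fourier_lapS0 _ ((h.lapS0 _).rieszS0 _), fourier_rieszS0 _ (h.lapS0 _), fourier_lapS0 _ h, fourier_pdS]
  have h1 : (((2 * Real.pi * ‖ξ‖) ^ (1 - s) : ℝ) : ℂ) * (((2 * Real.pi * ‖ξ‖) ^ s : ℝ) : ℂ) =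
      2 * Real.pi * ‖ξ‖ := by
    rw [← Complex.ofReal_mul, ← Real.rpow_add (by positivity)]
    simp
  have hn' : (‖ξ‖ : ℂ) ≠ 0 := by exact_mod_cast hn.ne'
  have h2 : 2 * (Real.pi : ℂ) * Complex.I * ξ k =
      (2 * Real.pi * ‖ξ‖) * (Complex.I * ((ξ k / ‖ξ‖ : ℝ) : ℂ)) := by
    push_cast
    field_simp
  rw [h2, ← h1]
  ring

/-- The zero-order part of the Stokes kernel acting on `𝓢₀`. -/
def stokesS0 (j k l : Fin d) (φ : 𝓢(Vec d, ℂ)) : 𝓢(Vec d, ℂ) :=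
  rieszS0 l ((kron j k : ℂ) • φ + rieszS0 k (rieszS0 j φ))

omit [NeZero d] in
lemma MemS0.stokesS0_arg (j k : Fin d) {φ : 𝓢(Vec d, ℂ)} (h : MemS0 φ) :
    MemS0 ((kron j k : ℂ) • φ + FracStokes.rieszS0 k (FracStokes.rieszS0 j φ)) :=
  (h.smul _).add ((h.rieszS0 j).rieszS0 k)

omit [NeZero d] in
lemma MemS0.stokesS0 (j k l : Fin d) {φ : 𝓢(Vec d, ℂ)} (h : MemS0 φ) : MemS0 (FracStokes.stokesS0 j k l φ) :=
  (h.stokesS0_arg j k).rieszS0 l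

/-- The symbol factors as `i σ (2π|ξ|)^α = (2π|ξ|)^{1-α} (i ξ_l / |ξ|)(δ_{jk} - ξ_j ξ_k / |ξ|²)`,
and `R_k R_j` has symbol `-ξ_j ξ_k / |ξ|²`. The outer `Λ^{1-α}` is the one that can be moved onto
`F`. -/
lemma fourierInv_stokesSymbol_mul (α : ℝ) (j k l : Fin d) {φ : 𝓢(Vec d, ℂ)} (h : MemS0 φ) :
    𝓕⁻ (fun ξ => Complex.I * (stokesSymbol α j k l ξ : ℂ) * 𝓕 (lapS0 α φ) ξ) =
      lapS0 (1 - α) (stokesS0 j k l φ) := by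
  rw [← fourierInv_fourier_coe (lapS0 (1 - α) (stokesS0 j k l φ))]
  funext x
  rw [Real.fourierInv_eq, Real.fourierInv_eq]
  refine integral_congr_ae ?_
  filter_upwards [ae_ne_zero (d := d)] with ξ hξ
  congr 1
  have hn := norm_pos_iff.2 hξ
  rw [fourier_lapS0 _ h, fourier_lapS0 _ (h.stokesS0 j k l), stokesS0, fourier_rieszS0 _ (h.stokesS0_arg j k),
    fourier_add_apply, fourier_smul_apply, fourier_rieszS0 _ (h.rieszS0 j), fourier_rieszS0 _ h, stokesSymbol]
  have h1 : (((2 * Real.pi * ‖ξ‖) ^ (1 - α) : ℝ) : ℂ) =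
      2 * Real.pi * ‖ξ‖ * ((((2 * Real.pi * ‖ξ‖) ^ (-(2 * α)) : ℝ) : ℂ) * (((2 * Real.pi * ‖ξ‖) ^ α : ℝ) : ℂ)) := by
    rw [← Complex.ofReal_mul, ← Real.rpow_add (by positivity), sub_eq_add_neg, Real.rpow_add (by positivity),
      Real.rpow_one, show -(2 * α) + α = -α by ring]
    push_cast
    ring
  have hn' : (‖ξ‖ : ℂ) ≠ 0 := by exact_mod_cast hn.ne'
  rw [h1]
  push_cast
  field_simp
  rw [Complex.I_sq]
  ring

section Potential

variable (w : Fin d → Fin d → L2 d)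

/-- The `k`-th component of the zero-order part of `div F`. -/
def divPart (k : Fin d) : L2 d := ∑ l, riesz l (w k l)

/-- The projection of `divPart` onto divergence-free fields; it represents `Λ^α u`. -/
def solPart (j : Fin d) : L2 d := divPart w j + riesz j (∑ k, riesz k (divPart w k))

/-- Since `∑ R_j R_j = -1`, the correction term cancels the divergence of `divPart`. -/
lemma sum_riesz_solPart : ∑ j, riesz j (solPart w j) = 0 := by
  simp only [solPart, map_add, Finset.sum_add_distrib]
  rw [sum_riesz_riesz]
  simp

/-- `solPart` differs from `divPart` by a gradient `R_j(…)`. By antisymmetry of `R_j`, gradients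
pair to zero with the divergence-free `solPart`. -/
lemma sum_pairing_divPart_solPart :
    ∑ j, pairing (divPart w j) (solPart w j) = ∑ j, pairing (solPart w j) (solPart w j) := by
  have h1 : ∑ j, pairing (riesz j (∑ k, riesz k (divPart w k))) (solPart w j) = 0 := by
    simp only [pairing_riesz]
    rw [Finset.sum_neg_distrib, ← map_sum, sum_riesz_solPart]
    simp
  have h2 : ∀ j, pairing (solPart w j) (solPart w j) = pairing (divPart w j) (solPart w j) +
      pairing (riesz j (∑ k, riesz k (divPart w k))) (solPart w j) := fun j => by
    have h3 : pairing (solPart w j) =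
        pairing (divPart w j) + pairing (riesz j (∑ k, riesz k (divPart w k))) := by rw [solPart, map_add]
    exact congrArg (fun L => L (solPart w j)) h3
  simp only [h2, Finset.sum_add_distrib, h1, add_zero]

/-- The two terms contain one and three Riesz transforms; moving an odd number of antisymmetric
operators across gives the overall minus sign. -/
lemma pairing_stokesS0 (f : L2 d) (j k l : Fin d) {φ : 𝓢(Vec d, ℂ)} (h : MemS0 φ) :
    pairing f ((stokesS0 j k l φ).toLp 2) = -((kron k j : ℂ) * pairing (riesz l f) (φ.toLp 2) +
      pairing (riesz j (riesz k (riesz l f))) (φ.toLp 2)) := by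
  have h1 : ((kron j k : ℂ) • φ + rieszS0 k (rieszS0 j φ)).toLp 2 (volume : Measure (Vec d)) =
      (kron j k : ℂ) • φ.toLp 2 (volume : Measure (Vec d)) +
        (rieszS0 k (rieszS0 j φ)).toLp 2 (volume : Measure (Vec d)) := rfl
  have h2 : kron j k = kron k j := by simp [kron, eq_comm]
  rw [stokesS0, ← riesz_toLp l (h.stokesS0_arg j k), ← neg_eq_iff_eq_neg.2 (pairing_riesz l _ _), h1, map_add,
    map_smul, ← riesz_toLp k (h.rieszS0 j), ← riesz_toLp j h, ← neg_eq_iff_eq_neg.2 (pairing_riesz k _ _),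
    ← neg_eq_iff_eq_neg.2 (pairing_riesz j _ _), neg_neg, smul_eq_mul, h2]

lemma sum_pairing_stokesS0 (j : Fin d) {φ : 𝓢(Vec d, ℂ)} (h : MemS0 φ) :
    ∑ k, ∑ l, pairing (w k l) ((stokesS0 j k l φ).toLp 2) = -pairing (solPart w j) (φ.toLp 2) := by
  have hL : ∀ f, pairing f (φ.toLp 2 (volume : Measure (Vec d))) =
      pairing.flip (φ.toLp 2 (volume : Measure (Vec d))) f := fun f => rfl
  simp only [pairing_stokesS0 _ j _ _ h, hL]
  generalize pairing.flip (φ.toLp 2 (volume : Measure (Vec d))) = L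
  simp only [Finset.sum_neg_distrib, Finset.sum_add_distrib, ← Finset.mul_sum]
  rw [sum_kron_mul (fun k => ∑ l, L (riesz l (w k l)))]
  simp only [solPart, divPart, map_sum, map_add]

end Potential

variable {α p q : ℝ}

/-- The `L²` class of a component of a real field. -/
def compL2 {ι : Type*} [Fintype ι] {w : Vec d → EuclideanSpace ℝ ι} (hw : MemLp w 2) (i : ι) : L2 d :=
  (memLp_ofReal (hw.eval_piLp i)).toLp (fun x => ((w x i : ℝ) : ℂ))

omit [NeZero d] in
lemma pairing_compL2 {ι : Type*} [Fintype ι] {w : Vec d → EuclideanSpace ℝ ι} (hw : MemLp w 2) (i : ι)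
    (φ : 𝓢(Vec d, ℂ)) : pairing (compL2 hw i) (φ.toLp 2) = ∫ x, ((w x i : ℝ) : ℂ) * φ x := by
  rw [pairing_toLp]
  refine integral_congr_ae ?_
  filter_upwards [(memLp_ofReal (hw.eval_piLp i)).coeFn_toLp] with x hx
  rw [compL2, hx]

omit [NeZero d] in
lemma integral_mul_lapS0 {ι : Type*} [Fintype ι] {s : ℝ} {F w : Vec d → EuclideanSpace ℝ ι} (hw : MemLp w 2)
    (hFw : FracLapEq s F w) (i : ι) {φ : 𝓢(Vec d, ℂ)} (h : MemS0 φ) :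
    ∫ x, ((F x i : ℝ) : ℂ) * lapS0 s φ x = pairing (compL2 hw i) (φ.toLp 2) := by
  rw [pairing_compL2, ← hFw φ h i, fracLap_eq_lapS0 s h]

/-- `Λ^α u` in terms of `Λ^{1-α} F`. -/
lemma integral_kernelConv_mul_lapS0 (e : Exponents d α p q) {F : Vec d → Tens d} (hF : MemLp F (ENNReal.ofReal p))
    {w : Vec d → Tens d} (hw : MemLp w 2) (hFw : FracLapEq (1 - α) F w) (j : Fin d) {φ : 𝓢(Vec d, ℂ)}
    (h : MemS0 φ) :
    ∫ x, (kernelConv α F x j : ℂ) * lapS0 α φ x =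
      pairing (solPart (fun k l => compL2 hw (k, l)) j) (φ.toLp 2) := by
  have hcF : ∀ k l, MemLp (fun y => F y (k, l)) (ENNReal.ofReal p) := fun k l => memLp_coord hF (k, l)
  set g := lapS0 α φ with hg
  have hI : ∀ k l, Integrable fun x =>
      ((stokesKernel d α j k l ⋆[ContinuousLinearMap.mul ℝ ℝ, volume] fun y => F y (k, l)) x : ℂ) * g x :=
    fun k l => integrable_stokesKernel_convolution_mul e j k l (hcF k l) g.integrable
      (fun x => SchwartzMap.norm_le_seminorm ℝ g x)
  have h1 : ∀ k l, ∫ x,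
      ((stokesKernel d α j k l ⋆[ContinuousLinearMap.mul ℝ ℝ, volume] fun y => F y (k, l)) x : ℂ) * g x =
      -pairing (compL2 hw (k, l)) ((stokesS0 j k l φ).toLp 2) := fun k l => by
    have h2 := integral_stokesKernel_convolution_mul_fourierInv e j k l (hcF k l) (h := ((𝓕 g : 𝓢(Vec d, ℂ)) : Vec d → ℂ))
      (SchwartzMap.integrable _) (integrable_rpow_norm_mul_schwartz (by linarith [e.lt_half]) _)
      (by rw [fourierInv_fourier_coe]; exact g.integrable)
    rw [fourierInv_fourier_coe, hg, fourierInv_stokesSymbol_mul α j k l h] at h2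
    rw [hg, h2, integral_mul_lapS0 hw hFw (k, l) (h.stokesS0 j k l)]
  rw [← neg_neg (pairing _ _), ← sum_pairing_stokesS0 _ j h]
  calc ∫ x, (kernelConv α F x j : ℂ) * g x = ∫ x, ∑ k, ∑ l,
        ((stokesKernel d α j k l ⋆[ContinuousLinearMap.mul ℝ ℝ, volume] fun y => F y (k, l)) x : ℂ) * g x := by
        congr 1; funext x
        rw [kernelConv]
        push_cast
        simp only [Finset.sum_mul]
    _ = ∑ k, ∑ l, ∫ x,
        ((stokesKernel d α j k l ⋆[ContinuousLinearMap.mul ℝ ℝ, volume] fun y => F y (k, l)) x : ℂ) * g x := by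
        rw [integral_finsetSum _ fun k _ => integrable_finsetSum _ fun l _ => hI k l]
        refine Finset.sum_congr rfl fun k _ => ?_
        rw [integral_finsetSum _ fun l _ => hI k l]
    _ = _ := by simp only [h1, Finset.sum_neg_distrib]

/-- A complex `L²` function representing `Λ^s` of a real function is real. -/
lemma ae_im_eq_zero {v : Vec d → ℝ} {s : ℝ} {W : L2 d}
    (h : ∀ φ : 𝓢(Vec d, ℂ), MemS0 φ → ∫ x, (v x : ℂ) * lapS0 s φ x = pairing W (φ.toLp 2)) :
    ∀ᵐ x, (W x).im = 0 := by
  have hW : MemLp (fun x => W x) 2 volume := Lp.memLp W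
  have him : MemLp (fun x => (W x).im) (ENNReal.ofReal 2) volume := by
    rw [show ENNReal.ofReal 2 = 2 by simp]; exact hW.im
  refine ae_eq_zero_of_forall_memS0 one_lt_two him fun φ hφ => ?_
  have hi : ∀ ψ : 𝓢(Vec d, ℂ), Integrable fun x => W x * ψ x := fun ψ =>
    MemLp.integrable_mul hW (ψ.memLp 2 volume)
  have h1 := h φ hφ
  have h2 := h _ hφ.conjS
  rw [pairing_toLp] at h1 h2
  rw [lapS0_conjS s hφ] at h2
  -- As `v` is real and `𝓢₀` and `Λ^s` are compatible with conjugation, `W` and its conjugate define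
  -- the same functional on `𝓢₀`; so `Im W` annihilates `𝓢₀`.
  have h3 : ∫ x, (starRingEnd ℂ) (W x) * φ x = ∫ x, W x * φ x := by
    rw [← h1]
    calc ∫ x, (starRingEnd ℂ) (W x) * φ x = ∫ x, (starRingEnd ℂ) (W x * conjS φ x) := by
          congr 1; funext x; simp [conjS_apply]
      _ = (starRingEnd ℂ) (∫ x, W x * conjS φ x) := integral_conj
      _ = ∫ x, (v x : ℂ) * lapS0 s φ x := by
          rw [← h2, ← integral_conj]
          congr 1; funext x; simp [conjS_apply]
  have hi' : Integrable fun x => (starRingEnd ℂ) (W x) * φ x := by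
    refine ((Complex.conjCLE : ℂ →L[ℝ] ℂ).integrable_comp (hi (conjS φ))).congr (Eventually.of_forall fun x => ?_)
    simp [conjS_apply]
  have h4 : (2 * Complex.I) * ∫ x, ((W x).im : ℂ) * φ x = 0 := by
    rw [← integral_const_mul, ← sub_eq_zero.2 h3.symm, ← integral_sub (hi φ) hi']
    congr 1; funext x
    rw [← sub_mul, Complex.sub_conj]
    push_cast; ring
  simpa using h4

/-- The energy part of the theorem. -/
lemma energy (e : Exponents d α p q) {F : Vec d → Tens d} (hF : MemLp F (ENNReal.ofReal p))
    {w : Vec d → Tens d} (hw : MemLp w 2) (hFw : FracLapEq (1 - α) F w) :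
    EnergyIdentity α F (kernelConv α F) := by
  set θ : Fin d → Fin d → L2 d := fun k l => compL2 hw (k, l) with hθ
  have hmain := fun j (φ : 𝓢(Vec d, ℂ)) (h : MemS0 φ) => integral_kernelConv_mul_lapS0 e hF hw hFw j h
  have hreal : ∀ j, (fun x => (((solPart θ j x).re : ℝ) : ℂ)) =ᵐ[volume] solPart θ j := fun j => by
    filter_upwards [ae_im_eq_zero (hmain j)] with x hx
    exact Complex.ext rfl hx.symm
  -- `Λ^α u` is found as a complex `L²` field; its imaginary part vanishes, and the real part is the
  -- required real field.
  set W : Vec d → Vec d := fun x => WithLp.toLp 2 fun j => (solPart θ j x).re with hWdef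
  have hW : MemLp W 2 volume := MemLp.of_eval_piLp fun j => (Lp.memLp (solPart θ j)).re
  have hWj : ∀ j, (fun x => ((W x j : ℝ) : ℂ)) =ᵐ[volume] solPart θ j := hreal
  -- Writing `D_k = Λ^{1-α} R_k Λ^α` moves `Λ^{1-α}` onto `F`; the sign from the antisymmetry of
  -- `R_k` cancels the one in `divAction`.
  have hdiv : ∀ Φ : Fin d → 𝓢(Vec d, ℂ), (∀ j, MemS0 (Φ j)) →
      divAction F Φ = ∑ j, pairing (divPart θ j) ((lapS0 α (Φ j)).toLp 2) := fun Φ hΦ => by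
    have hI : ∀ j k, Integrable fun x => ((F x (j, k) : ℝ) : ℂ) * pd k (Φ j) x := fun j k => by
      rw [← coe_pdS]
      exact integrable_memLp_mul_schwartz e.one_lt (memLp_coord hF (j, k)) _
    rw [divAction, integral_finsetSum _ fun j _ => integrable_finsetSum _ fun k _ => hI j k,
      ← Finset.sum_neg_distrib]
    refine Finset.sum_congr rfl fun j _ => ?_
    rw [integral_finsetSum _ fun k _ => hI j k, divPart, map_sum, sum_apply, ← Finset.sum_neg_distrib]
    refine Finset.sum_congr rfl fun k _ => ?_
    rw [← coe_pdS, pdS_eq_lapS0_rieszS0 α k (hΦ j),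
      integral_mul_lapS0 hw hFw (j, k) (((hΦ j).lapS0 α).rieszS0 k), ← riesz_toLp k ((hΦ j).lapS0 α), pairing_riesz]
  refine ⟨W, hW, fun φ hφ j => ?_, ⟨?_, ?_⟩⟩
  · rw [fracLap_eq_lapS0 α hφ, hmain j φ hφ, pairing_toLp]
    refine integral_congr_ae ?_
    filter_upwards [hWj j] with x hx
    rw [hx]
  -- By `hdiv`, `div F` acts on `Λ^α Φ` as a bounded functional on `L²`.
  · refine ⟨∑ j, ‖pairing (divPart θ j)‖₊, fun Φ hΦ => ?_⟩
    rw [hdiv Φ hΦ]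
    refine (enorm_sum_le _ _).trans ?_
    rw [Finset.mul_sum]
    refine Finset.sum_le_sum fun j _ => ?_
    have h1 : ‖pairing (divPart θ j) ((lapS0 α (Φ j)).toLp 2)‖ₑ ≤
        ‖pairing (divPart θ j)‖₊ * ‖(lapS0 α (Φ j)).toLp 2 (volume : Measure (Vec d))‖ₑ :=
      (pairing (divPart θ j)).le_opENorm _
    refine h1.trans ?_
    rw [fracLap_eq_lapS0 α (hΦ j)]
    gcongr
    · exact Finset.single_le_sum (f := fun j => ‖pairing (divPart θ j)‖₊) (fun _ _ => bot_le) (Finset.mem_univ j)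
    · rw [Lp.enorm_def, eLpNorm_congr_ae (SchwartzMap.coeFn_toLp _ 2 volume)]
  -- The approximants of `u` are `Λ^{-α} g_n`, where `g_n` in `𝓢₀` tends to `Λ^α u` in `L²`.
  · have hseq : ∀ j, ∃ g : ℕ → S0 d, Tendsto (fun n => S0.toL2 (g n)) atTop (𝓝 (solPart θ j)) := fun j => by
      obtain ⟨x, hx, hlim⟩ := mem_closure_iff_seq_limit.1 (denseRange_S0_toL2 (solPart θ j))
      choose g hg using hx
      exact ⟨g, by simpa only [hg] using hlim⟩
    choose g hg using hseq
    have hlap : ∀ n j, lapS0 α (lapS0 (-α) (g j n : 𝓢(Vec d, ℂ))) = g j n := fun n j => lapS0_lapS0_neg α (g j n).2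
    refine ⟨fun n j => lapS0 (-α) (g j n), fun n j => (g j n).2.lapS0 _, fun j => ?_, ?_⟩
    · have h1 := (Lp.tendsto_Lp_iff_tendsto_eLpNorm' _ _).1 (hg j)
      refine h1.congr fun n => eLpNorm_congr_ae ?_
      rw [fracLap_eq_lapS0 α ((g j n).2.lapS0 _), hlap, S0.toL2_apply]
      filter_upwards [hWj j, SchwartzMap.coeFn_toLp (g j n : 𝓢(Vec d, ℂ)) 2 volume] with x hx hx'
      rw [Pi.sub_apply, hx, hx']
    · have h1 : Tendsto (fun n => ∑ j, pairing (divPart θ j) (S0.toL2 (g j n))) atTop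
          (𝓝 (∑ j, pairing (divPart θ j) (solPart θ j))) :=
        tendsto_finsetSum _ fun j _ => ((pairing (divPart θ j)).continuous.tendsto _).comp (hg j)
      have h2 : ∑ j, pairing (divPart θ j) (solPart θ j) = ((∫ x, ‖W x‖ ^ 2 : ℝ) : ℂ) := by
        rw [sum_pairing_divPart_solPart]
        have h3 : ∀ j, pairing (solPart θ j) (solPart θ j) = ((∫ x, (W x j) ^ 2 : ℝ) : ℂ) := fun j => by
          rw [pairing_apply, ← integral_complex_ofReal]
          refine integral_congr_ae ?_
          filter_upwards [hWj j] with x hx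
          rw [← hx]; push_cast; ring
        simp only [h3, EuclideanSpace.real_norm_sq_eq]
        rw [integral_finsetSum _ fun j _ => (hW.eval_piLp j).integrable_sq]
        push_cast
        rfl
      rw [← h2]
      refine h1.congr fun n => ?_
      rw [hdiv _ fun j => (g j n).2.lapS0 _]
      simp only [hlap]
      rfl

end Energy

/-! ### Invariance under modification on null sets -/

section Congruence

variable {d : ℕ} {α : ℝ}

lemma IsVeryWeakSolution.congr_ae {F : Vec d → Tens d} {u v : Vec d → Vec d} (h : IsVeryWeakSolution α F u)
    (huv : u =ᵐ[volume] v) : IsVeryWeakSolution α F v := by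
  obtain ⟨⟨a, b, ha, hb, hab⟩, h⟩ := h
  refine ⟨⟨a, b, ha, hb, huv.symm.trans hab⟩, fun Φ ψ hΦ hΦc hdiv hψ hψc => ?_⟩
  rw [← h Φ ψ hΦ hΦc hdiv hψ hψc]
  refine integral_congr_ae ?_
  filter_upwards [huv] with x hx
  simp only [hx]

lemma FracLapEq.congr_ae {ι : Type*} {s : ℝ} {f g w : Vec d → EuclideanSpace ℝ ι} (h : FracLapEq s f w)
    (hfg : f =ᵐ[volume] g) : FracLapEq s g w := fun φ hφ i => by
  rw [← h φ hφ i]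
  refine integral_congr_ae ?_
  filter_upwards [hfg] with x hx
  simp only [hx]

lemma EnergyIdentity.congr_ae {F : Vec d → Tens d} {u v : Vec d → Vec d} (h : EnergyIdentity α F u)
    (huv : u =ᵐ[volume] v) : EnergyIdentity α F v := by
  obtain ⟨w, hw, huw, hF⟩ := h
  exact ⟨w, hw, huw.congr_ae huv, hF⟩

lemma EnergyIdentity.memHomSobolev {F : Vec d → Tens d} {u : Vec d → Vec d} (h : EnergyIdentity α F u) :
    MemHomSobolev α u := by
  obtain ⟨w, hw, huw, -⟩ := h
  exact ⟨w, hw, huw⟩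

end Congruence

end

end FracStokes

/-! ### The theorem -/

open FracStokes

theorem mainTheorem4 (d : ℕ) (hd : 2 ≤ d) (α p q : ℝ)
    (hα : 1 / 2 < α) (hα' : α < ((d : ℝ) + 1) / 2)
    (hp : 1 < p) (hp' : p < d / (2 * α - 1))
    (hq : 1 / q = 1 / p - (2 * α - 1) / d) :
    ∃ C : ℝ, 0 < C ∧
      ∀ F : Lp (Tens d) (ENNReal.ofReal p) (volume : Measure (Vec d)),
        ∃ u : Lp (Vec d) (ENNReal.ofReal q) (volume : Measure (Vec d)),
          IsVeryWeakSolution α F u ∧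
          (∀ v : Lp (Vec d) (ENNReal.ofReal q) (volume : Measure (Vec d)),
            IsVeryWeakSolution α F v → v = u) ∧
          (∀ᵐ x ∂(volume : Measure (Vec d)), KernelConvExistsAt α F x) ∧
          u =ᵐ[volume] kernelConv α F ∧
          ‖u‖ ≤ C * ‖F‖ ∧
          (MemHomSobolev (1 - α) F → MemHomSobolev α u ∧ EnergyIdentity α F u) := by
  have : NeZero d := ⟨by omega⟩
  have e : Exponents d α p q := ⟨hα, hα', hp, hp', hq⟩
  obtain ⟨C, hC⟩ := eLpNorm_kernelConv_le e
  -- The `1` is there only to make the constant strictly positive.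
  refine ⟨C + 1, by positivity, fun F => ?_⟩
  have hF : MemLp F (ENNReal.ofReal p) volume := Lp.memLp F
  obtain ⟨hu, hle⟩ := hC F hF
  have hu' : hu.toLp (kernelConv α F) =ᵐ[volume] kernelConv α F := hu.coeFn_toLp
  have hs := isVeryWeakSolution_kernelConv e hF hu
  refine ⟨hu.toLp (kernelConv α F), hs.congr_ae hu'.symm, fun v hv => ?_, ?_, hu', ?_, ?_⟩
  · exact Lp.ext ((ae_eq_of_isVeryWeakSolution e hu (Lp.memLp v) hs hv).trans hu'.symm)
  · have h := fun i : Fin d × Fin d => convolutionExistsAt_stokesKernel e (memLp_coord hF i)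
    filter_upwards [ae_all_iff.2 h] with x hx j k l
    exact hx (k, l) j k l
  · have h1 : ‖hu.toLp (kernelConv α F)‖ ≤ C * ‖F‖ := by
      rw [Lp.norm_toLp, Lp.norm_def, ← ENNReal.coe_toReal, ← ENNReal.toReal_mul]
      exact ENNReal.toReal_mono (ENNReal.mul_ne_top ENNReal.coe_ne_top hF.eLpNorm_ne_top) hle
    exact h1.trans (mul_le_mul_of_nonneg_right (by linarith) ENNReal.toReal_nonneg)
  · rintro ⟨w, hw, hFw⟩
    have h := (energy e hF hw hFw).congr_ae hu'.symm
    exact ⟨h.memHomSobolev, h⟩
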